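/- Let $F$ be a field with a fixed separable closure $\bar F$ and absolute Galois group $\operatorname{Gal}_F=\operatorname{Gal}(\bar F/F)$. For an $F$-torus $T$ let $\hat T=\operatorname{Hom}_{\bar F}(T_{\bar F},\mathbb{G}_{m,\bar F})$ be its character lattice, a $\operatorname{Gal}_F$-module. The torus $T$ is *split* by an extension $E/F$ if $\operatorname{Gal}_E$ acts trivially on $\hat T$. It is *quasitrivial* if it is isomorphic to a finite product of Weil restrictions $\mathrm{R}_{E/F}\mathbb{G}_{m,E}$ with $E/F$ finite separable. It is *flasque* (resp. *coflasque*) if $\operatorname{Ext}^1_{\mathbb{Z}[\operatorname{Gal}_F]}(\hat T,M)=0$ (resp. $\operatorname{Ext}^1_{\mathbb{Z}[\operatorname{Gal}_F]}(M,\hat T)=0$) for every permutation $\operatorname{Gal}_F$-lattice $M$, that is, every lattice with a continuous $\operatorname{Gal}_F$-action and a finite $\mathbb{Z}$-basis permuted by $\operatorname{Gal}_F$. A two-term complex of $F$-tori $[T_1\to T_2]$ has $T_1$ in degree $-1$ and $T_2$ in degree $0$. Quasi-isomorphisms, morphisms in the derived category and distinguished triangles are understood through the contravariant functor $T\mapsto\hat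 T$ of Cartier duality, that is, in the derived category of the opposite of the category of $\mathbb{Z}[\operatorname{Gal}_F]$-modules. A *flasque resolution* of $\mathscr{T}=[T_1\to T_2]$ is a complex of $F$-tori $[S\to Q]$ with $S$ flasque and $Q$ quasitrivial, together with a quasi-isomorphism (an isomorphism in the derived category) $[S\to Q]\simeq\mathscr{T}$. A *coflasque resolution* is a complex of $F$-tori $[P\to R]$ with $P$ quasitrivial and $R$ coflasque, together with a quasi-isomorphism $[P\to R]\simeq\mathscr{T}$. A resolution $[A\to B]\simeq\mathscr{T}$ yields a distinguished triangle $A\to B\to\mathscr{T}\to A[1]$. **Theorem.** Let $\mathscr{T}=[T_1\xrightarrow{\partial}T_2]$ be a complex of $F$-tori. 1. $\mathscr{T}$ admits a flasque resolution. If $[S\to Q]$ and $[S'\to Q']$ are two flasque resolutions of $\mathscr{T}$, then $S\times_F Q'\cong S'\times_F Q$ as $F$-tori. 2. Let $f:\mathscr{T}\to\mathscr{T}'$ be a morphism in the derived category, where $\mathscr{T}'$ is another two-term complex of $F$-tori, and let $[S\to Q]\simeq\mathscr{T}$ and $[S'\to Q']\simeq\mathscr{T}'$ be flasque resolutions. Then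 there are homomorphisms of $F$-tori $a:S\to S'$ and $b:Q\to Q'$ such that $(a,b,f,a[1])$ is a morphism from the distinguished triangle $S\to Q\to\mathscr{T}\to S[1]$ to the distinguished triangle $S'\to Q'\to\mathscr{T}'\to S'[1]$. 3. $\mathscr{T}$ admits a coflasque resolution. If $[P\to R]$ and $[P'\to R']$ are two coflasque resolutions of $\mathscr{T}$, then $P\times_F R'\cong P'\times_F R$ as $F$-tori. 4. Let $f:\mathscr{T}\to\mathscr{T}'$ be a morphism in the derived category, where $\mathscr{T}'$ is another two-term complex of $F$-tori, and let $[P\to R]\simeq\mathscr{T}$ and $[P'\to R']\simeq\mathscr{T}'$ be coflasque resolutions. Then there are homomorphisms of $F$-tori $a:P\to P'$ and $b:R\to R'$ such that $(a,b,f,a[1])$ is a morphism from the distinguished triangle $P\to R\to\mathscr{T}\to P[1]$ to the distinguished triangle $P'\to R'\to\mathscr{T}'\to P'[1]$. 5. If $T_1$ and $T_2$ are split by a finite separable extension $E/F$, then $\mathscr{T}$ admits a flasque resolution $[S\to Q]$ and a coflasque resolution $[P\to R]$ such that $S$, $Q$, $P$ and $R$ are all split by $E$. -/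

import Mathlib

open CategoryTheory CategoryTheory.Limits CategoryTheory.Pretriangulated
open scoped TensorProduct

universe w v u

noncomputable section

/-! ## Two-term complexes in an abelian category and their distinguished triangles -/

namespace TwoTerm
variable {C : Type u} [Category.{v} C] [Abelian C]

/-- The complex `[X ⟶ Y]` with `X` in degree `-1` and `Y` in degree `0`. -/
abbrev complex {X Y : C} (d : X ⟶ Y) : CochainComplex C ℤ :=
  HomologicalComplex.double d (c := ComplexShape.up ℤ) (i₀ := -1) (i₁ := 0) (by simp)

/-- The degree `0` term of the one-term complex `X[0]` is `X`. -/
def singleXIso (X : C) : ((CochainComplex.singleFunctor C 0).obj X).X 0 ≅ X :=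
  HomologicalComplex.singleObjXSelf (ComplexShape.up ℤ) 0 X

/-- The degree `-1` term of `[X ⟶ Y]` is `X`. -/
def leftIso {X Y : C} (d : X ⟶ Y) : (complex d).X (-1) ≅ X :=
  HomologicalComplex.doubleXIso₀ d _

/-- The degree `0` term of `[X ⟶ Y]` is `Y`. -/
def rightIso {X Y : C} (d : X ⟶ Y) : (complex d).X 0 ≅ Y :=
  HomologicalComplex.doubleXIso₁ d _ (by simp)

/-- The morphism of complexes `Y[0] ⟶ [X ⟶ Y]` which is the identity in degree `0`. -/
def incl {X Y : C} (d : X ⟶ Y) : (CochainComplex.singleFunctor C 0).obj Y ⟶ complex d :=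
  HomologicalComplex.mkHomFromSingle (rightIso d).inv
    (fun j _ => by
      rw [HomologicalComplex.double_d_eq_zero₀ _ _ _ _ (by simp), comp_zero])

lemma singleXIso_comm {X Y : C} (d : X ⟶ Y) :
    (singleXIso X).inv ≫ ((CochainComplex.singleFunctor C 0).map d).f 0 =
      d ≫ (singleXIso Y).inv := by
  have h := HomologicalComplex.single_map_f_self (ComplexShape.up ℤ) 0 d
  change (singleXIso X).inv ≫ ((HomologicalComplex.single C (ComplexShape.up ℤ) 0).map d).f 0 = _
  rw [h]
  exact Iso.inv_hom_id_assoc (singleXIso X) _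

lemma single_d (X : C) (i j : ℤ) : ((CochainComplex.singleFunctor C 0).obj X).d i j = 0 :=
  HomologicalComplex.single_obj_d _ _ _ _ _

lemma isZero_single (X : C) (i : ℤ) (hi : i ≠ 0) :
    IsZero (((CochainComplex.singleFunctor C 0).obj X).X i) :=
  HomologicalComplex.isZero_single_obj_X (ComplexShape.up ℤ) 0 X i hi

/-- The morphism of complexes `[X ⟶ Y] ⟶ X[0]⟦1⟧`, given by the identity of `X` in degree `-1`
up to the sign which the conventions of Mathlib for distinguished triangles impose. -/
def proj {X Y : C} (d : X ⟶ Y) :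
    complex d ⟶ ((CochainComplex.singleFunctor C 0).obj X)⟦(1 : ℤ)⟧ :=
  HomologicalComplex.mkHomFromDouble _ (by simp)
    (-((singleXIso X).inv ≫
      (((CochainComplex.singleFunctor C 0).obj X).shiftFunctorObjXIso 1 (-1) 0 (by simp)).inv))
    0
    (IsZero.eq_of_tgt (isZero_single X (0 + 1) (by simp)) _ _)
    (fun _ _ => zero_comp)

open CochainComplex.mappingCone in
/-- The isomorphism from `[X ⟶ Y]` to the mapping cone of `X[0] ⟶ Y[0]`. -/
def toCone {X Y : C} (d : X ⟶ Y) :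
    complex d ⟶ CochainComplex.mappingCone ((CochainComplex.singleFunctor C 0).map d) :=
  HomologicalComplex.mkHomFromDouble _ (by simp)
    ((singleXIso X).inv ≫ (inl ((CochainComplex.singleFunctor C 0).map d)).v 0 (-1) (by simp))
    ((singleXIso Y).inv ≫ (inr ((CochainComplex.singleFunctor C 0).map d)).f 0)
    (by
      rw [Category.assoc, inl_v_d _ 0 (-1) 1 (by simp) (by simp), single_d, zero_comp, sub_zero,
        reassoc_of% (singleXIso_comm d)])
    (fun k _ => by rw [Category.assoc, inr_f_d, single_d]; simp)

open CochainComplex.mappingCone in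
instance isIso_toCone {X Y : C} (d : X ⟶ Y) : IsIso (toCone d) := by
  have (n : ℤ) : IsIso ((toCone d).f n) := by
    set φ := (CochainComplex.singleFunctor C 0).map d with hφ
    by_cases h1 : n = -1
    · subst h1
      have : IsIso ((inl φ).v 0 (-1) (by simp)) := by
        refine ⟨(fst φ).1.v (-1) 0 (by simp), by simp, ?_⟩
        apply ext_from φ 0 (-1) (by simp)
        · simp
        · exact (isZero_single Y (-1) (by simp)).eq_of_src _ _
      have h : (toCone d).f (-1) = (leftIso d).hom ≫ (singleXIso X).inv ≫ (inl φ).v 0 (-1) (by simp) :=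
        HomologicalComplex.mkHomFromDouble_f₀ ..
      rw [h]; infer_instance
    by_cases h0 : n = 0
    · subst h0
      have : IsIso ((inr φ).f 0) := by
        refine ⟨(snd φ).v 0 0 (by simp), by simp, ?_⟩
        apply ext_from φ 1 0 (by simp)
        · exact (isZero_single X 1 (by simp)).eq_of_src _ _
        · simp
      have h : (toCone d).f 0 = (rightIso d).hom ≫ (singleXIso Y).inv ≫ (inr φ).f 0 :=
        HomologicalComplex.mkHomFromDouble_f₁ ..
      rw [h]; infer_instance
    · refine IsZero.isIso (HomologicalComplex.isZero_double_X _ _ n h1 h0) ?_ _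
      rw [CochainComplex.mappingCone.isZero_X_iff]
      exact ⟨isZero_single _ _ (by omega), isZero_single _ _ h0⟩
  exact HomologicalComplex.Hom.isIso_of_components _

open CochainComplex.mappingCone in
lemma incl_toCone {X Y : C} (d : X ⟶ Y) :
    incl d ≫ toCone d = inr ((CochainComplex.singleFunctor C 0).map d) := by
  apply HomologicalComplex.from_single_hom_ext
  have h : (toCone d).f 0 = (rightIso d).hom ≫ (singleXIso Y).inv ≫
      (inr ((CochainComplex.singleFunctor C 0).map d)).f 0 :=
    HomologicalComplex.mkHomFromDouble_f₁ ..
  have h' : (incl d).f 0 = (singleXIso Y).hom ≫ (rightIso d).inv :=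
    HomologicalComplex.mkHomFromSingle_f ..
  rw [HomologicalComplex.comp_f, h, h']
  simp only [Category.assoc, Iso.inv_hom_id_assoc, Iso.hom_inv_id_assoc]
  rfl

open CochainComplex.mappingCone in
lemma toCone_mor₃ {X Y : C} (d : X ⟶ Y) :
    toCone d ≫ (CochainComplex.mappingCone.triangle
      ((CochainComplex.singleFunctor C 0).map d)).mor₃ = proj d := by
  apply HomologicalComplex.from_double_hom_ext
  · have h : (toCone d).f (-1) = (leftIso d).hom ≫ (singleXIso X).inv ≫
        (inl ((CochainComplex.singleFunctor C 0).map d)).v 0 (-1) (by simp) :=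
      HomologicalComplex.mkHomFromDouble_f₀ ..
    have h' : (proj d).f (-1) = (leftIso d).hom ≫ (-((singleXIso X).inv ≫
      (((CochainComplex.singleFunctor C 0).obj X).shiftFunctorObjXIso 1 (-1) 0 (by simp)).inv)) :=
      HomologicalComplex.mkHomFromDouble_f₀ ..
    change (toCone d).f (-1) ≫ (CochainComplex.mappingCone.triangle
      ((CochainComplex.singleFunctor C 0).map d)).mor₃.f (-1) = _
    rw [h, h', ← Preadditive.comp_neg]
    exact (Category.assoc _ _ _).trans (congrArg _ ((Category.assoc _ _ _).trans
      (congrArg _ (inl_v_triangle_mor₃_f _ 0 (-1) (by simp)))))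
  · exact (isZero_single X (0 + 1) (by simp)).eq_of_tgt _ _

variable [HasDerivedCategory.{w} C]

/-- Let `e` be an isomorphism `[X ⟶ Y] ≅ K` in the derived category. This is the triangle
`X ⟶ Y ⟶ K ⟶ X⟦1⟧` deduced from `e`, whose first map is `d`. -/
def triangle {X Y : C} (d : X ⟶ Y) {K : DerivedCategory C}
    (e : DerivedCategory.Q.obj (complex d) ≅ K) : Triangle (DerivedCategory C) :=
  Triangle.mk ((DerivedCategory.singleFunctor C 0).map d)
    (DerivedCategory.Q.map (incl d) ≫ e.hom : (DerivedCategory.singleFunctor C 0).obj Y ⟶ K)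
    (e.inv ≫ DerivedCategory.Q.map (proj d) ≫
      (DerivedCategory.Q.commShiftIso (1 : ℤ)).hom.app _)

lemma comp_aux {D : Type*} [Category D] {A B B' E G : D} (a : A ⟶ B) (t : B ⟶ B') (m : B' ⟶ E)
    (p : B ⟶ E) (s : E ⟶ G) (h : t ≫ m = p) : (a ≫ p ≫ s) ≫ 𝟙 G = (a ≫ t) ≫ m ≫ s := by
  simp [← h]

/-- The triangle `X ⟶ Y ⟶ K ⟶ X⟦1⟧` attached to `[X ⟶ Y] ≅ K` is distinguished. -/
lemma triangle_distinguished {X Y : C} (d : X ⟶ Y) {K : DerivedCategory C}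
    (e : DerivedCategory.Q.obj (complex d) ≅ K) :
    triangle d e ∈ distTriang (DerivedCategory C) := by
  refine isomorphic_distinguished _ (DerivedCategory.mappingCone_triangle_distinguished
    ((CochainComplex.singleFunctor C 0).map d)) _
    (Triangle.isoMk _ _ (Iso.refl _) (Iso.refl _)
      (e.symm ≪≫ DerivedCategory.Q.mapIso (@asIso _ _ _ _ (toCone d) (isIso_toCone d))) ?_ ?_ ?_)
  · exact (Category.comp_id _).trans (Category.id_comp _).symm
  · have h := congrArg DerivedCategory.Q.map (incl_toCone d)
    rw [Functor.map_comp] at h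
    change (DerivedCategory.Q.map (incl d) ≫ e.hom) ≫ e.inv ≫ DerivedCategory.Q.map (toCone d) =
      𝟙 _ ≫ DerivedCategory.Q.map _
    rw [Category.assoc, e.hom_inv_id_assoc, h]
    exact (Category.id_comp _).symm
  · have h := (Functor.map_comp DerivedCategory.Q (toCone d) _).symm.trans
      (congrArg DerivedCategory.Q.map (toCone_mor₃ d))
    exact (congrArg (_ ≫ ·) (CategoryTheory.Functor.map_id _ _)).trans (comp_aux _ _ _ _ _ h)

end TwoTerm

/-! ## Tori -/

/-- Let `K` be a separable closure of the field `F`. An `F`-torus, given by its coordinate ring: a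
commutative Hopf algebra over `F` which becomes isomorphic over `K` to the coordinate ring
`K[ℤⁿ] = K[t₁^±1, …, tₙ^±1]` of `𝔾ₘⁿ` (as an algebra and a coalgebra). -/
structure Torus (F K : Type u) [Field F] [Field K] [Algebra F K] where
  /-- The coordinate ring. -/
  coord : Type u
  [commRing : CommRing coord]
  [hopfAlgebra : HopfAlgebra F coord]
  isForm : ∃ n : ℕ, Nonempty (K ⊗[F] coord ≃ₐc[K] AddMonoidAlgebra K (Fin n → ℤ))

attribute [instance] Torus.commRing Torus.hopfAlgebra

namespace Torus

/-- Morphisms of tori `T ⟶ T'` are homomorphisms of algebraic groups, that is, homomorphisms of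
Hopf algebras `T'.coord → T.coord`. -/
instance (F K : Type u) [Field F] [Field K] [Algebra F K] : Category (Torus F K) where
  Hom T T' := T'.coord →ₐc[F] T.coord
  id T := BialgHom.id F T.coord
  comp f g := BialgHom.comp f g

section Characters

variable {F K : Type u} [Field F] [Field K] [Algebra F K] {A : Type u} [CommRing A] [HopfAlgebra F A]

/-- The action of `σ` on `K ⊗ A` through the first factor. -/
def galCoord (A : Type u) [CommRing A] [HopfAlgebra F A] (σ : K ≃ₐ[F] K) :
    K ⊗[F] A →ₐ[F] K ⊗[F] A :=
  Algebra.TensorProduct.map (σ : K →ₐ[F] K) (AlgHom.id F A)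

lemma galCoord_tmul (σ : K ≃ₐ[F] K) (s : K) (a : A) :
    galCoord A σ (s ⊗ₜ a) = σ s ⊗ₜ a := rfl

open TensorProduct.AlgebraTensorModule in
lemma comul_baseChange (x : K ⊗[F] A) :
    Coalgebra.comul (R := K) x = distribBaseChange F K A A
      (LinearMap.lTensor K (Coalgebra.comul (R := F) (A := A)) x) := by
  induction x with
  | zero => simp
  | add x y hx hy => simp only [map_add, hx, hy]
  | tmul s a =>
    rw [TensorProduct.comul_tmul, LinearMap.lTensor_tmul]
    generalize (Coalgebra.comul (R := F) a) = b
    induction b with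
    | zero => simp
    | add x y hx hy => simp only [TensorProduct.tmul_add, map_add, hx, hy]
    | tmul b c =>
      have : (1 : K) ⊗ₜ[F] b ⊗ₜ[K] (s ⊗ₜ[F] c) = s ⊗ₜ[F] b ⊗ₜ[K] ((1 : K) ⊗ₜ[F] c) := by
        rw [← mul_one s, ← smul_eq_mul, ← TensorProduct.smul_tmul', ← TensorProduct.smul_tmul',
          TensorProduct.smul_tmul]
      simp [tensorTensorTensorComm_tmul, this]

open TensorProduct.AlgebraTensorModule in
lemma distribBaseChange_galCoord (σ : K ≃ₐ[F] K) (x y : K ⊗[F] A) :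
    distribBaseChange F K A A
      (LinearMap.rTensor (A ⊗[F] A) (σ : K →ₐ[F] K).toLinearMap
        ((distribBaseChange F K A A).symm (x ⊗ₜ y))) =
      galCoord A σ x ⊗ₜ galCoord A σ y := by
  induction x with
  | zero => simp
  | add x x' hx hx' => simp only [TensorProduct.add_tmul, map_add, hx, hx']
  | tmul s a =>
    induction y with
    | zero => simp
    | add y y' hy hy' => simp only [TensorProduct.tmul_add, map_add, hy, hy']
    | tmul t b =>
      have key (p q : K) : distribBaseChange F K A A ((p * q) ⊗ₜ (a ⊗ₜ b)) =
          (p ⊗ₜ[F] a) ⊗ₜ[K] (q ⊗ₜ[F] b) := by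
        rw [distribBaseChange_tmul, mul_comm, ← smul_eq_mul, ← TensorProduct.smul_tmul',
          TensorProduct.smul_tmul, TensorProduct.smul_tmul', smul_eq_mul, mul_one]
      rw [← key s t, LinearEquiv.symm_apply_apply, LinearMap.rTensor_tmul, galCoord_tmul,
        galCoord_tmul, ← key, AlgHom.toLinearMap_apply, map_mul]
      rfl

lemma isGroupLikeElem_galCoord (σ : K ≃ₐ[F] K) {x : K ⊗[F] A}
    (hx : IsGroupLikeElem K x) : IsGroupLikeElem K (galCoord A σ x) := by
  constructor
  · have h (y : K ⊗[F] A) : Coalgebra.counit (R := K) (galCoord A σ y) =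
        σ (Coalgebra.counit (R := K) y) := by
      induction y with
      | zero => simp
      | add x y hx hy => simp only [map_add, hx, hy]
      | tmul s a => simp [galCoord_tmul]
    rw [h, hx.counit_eq_one, map_one]
  · have h := hx.comul_eq_tmul_self
    rw [comul_baseChange] at h ⊢
    rw [← distribBaseChange_galCoord, ← h, LinearEquiv.symm_apply_apply]
    congr 1
    change LinearMap.lTensor _ _ (LinearMap.rTensor _ _ x) = _
    rw [← LinearMap.comp_apply, ← LinearMap.comp_apply, LinearMap.lTensor_comp_rTensor,
      LinearMap.rTensor_comp_lTensor]

lemma galCoord_one (x : K ⊗[F] A) : galCoord A (1 : K ≃ₐ[F] K) x = x := by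
  induction x with
  | zero => simp
  | add x y hx hy => rw [map_add, hx, hy]
  | tmul s a => rfl

lemma galCoord_mul (σ τ : K ≃ₐ[F] K) (x : K ⊗[F] A) :
    galCoord A (σ * τ) x = galCoord A σ (galCoord A τ x) := by
  induction x with
  | zero => simp
  | add x y hx hy => simp only [map_add, hx, hy]
  | tmul s a => rfl

variable (F K) in
/-- The Galois module of geometric characters of the affine group scheme `Spec A` over `F`.
Characters `Spec (K ⊗ A) → 𝔾ₘ` are the group-like elements `χ` of the Hopf algebra `K ⊗ A` over
`K`; the group law is written additively, and the Galois group acts through the coefficients, that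
is, `(σ χ) (g) = σ (χ (σ⁻¹ g))` on `K`-points. -/
def charRep (A : Type u) [CommRing A] [HopfAlgebra F A] :
    Representation ℤ (K ≃ₐ[F] K) (Additive (GroupLike K (K ⊗[F] A))) where
  toFun σ := (MonoidHom.toAdditive
    { toFun := fun χ => ⟨galCoord A σ χ.val, isGroupLikeElem_galCoord σ χ.isGroupLikeElem_val⟩
      map_one' := GroupLike.ext (map_one _)
      map_mul' := fun _ _ => GroupLike.ext (map_mul _ _ _) } :
      Additive (GroupLike K (K ⊗[F] A)) →+ Additive (GroupLike K (K ⊗[F] A))).toIntLinearMap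
  map_one' := LinearMap.ext fun χ =>
    Additive.toMul.injective (GroupLike.ext (galCoord_one χ.toMul.val))
  map_mul' σ τ := LinearMap.ext fun χ =>
    Additive.toMul.injective (GroupLike.ext (galCoord_mul σ τ χ.toMul.val))

variable (F K) in
/-- The map on geometric characters induced by a homomorphism of Hopf algebras `A → B`. -/
def charMap {A B : Type u} [CommRing A] [HopfAlgebra F A] [CommRing B] [HopfAlgebra F B]
    (f : A →ₐc[F] B) : (charRep F K A).IntertwiningMap (charRep F K B) where
  toLinearMap := (MonoidHom.toAdditive
    { toFun := fun χ => ⟨Bialgebra.TensorProduct.map (BialgHom.id K K) f χ.val,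
        χ.isGroupLikeElem_val.map _⟩
      map_one' := GroupLike.ext (map_one _)
      map_mul' := fun _ _ => GroupLike.ext (map_mul _ _ _) } :
      Additive (GroupLike K (K ⊗[F] A)) →+ Additive (GroupLike K (K ⊗[F] B))).toIntLinearMap
  isIntertwining' σ := LinearMap.ext fun χ => by
    apply Additive.toMul.injective
    apply GroupLike.ext
    change Bialgebra.TensorProduct.map (BialgHom.id K K) f (galCoord A σ χ.toMul.val) =
      galCoord B σ (Bialgebra.TensorProduct.map (BialgHom.id K K) f χ.toMul.val)
    induction χ.toMul.val with
    | zero => simp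
    | add x y hx hy => simp only [map_add, hx, hy]
    | tmul s a => rfl

end Characters

variable {F K : Type u} [Field F] [Field K] [Algebra F K]

/-- The character module `T̂` of a torus `T`, as a module over the absolute Galois group of `F`. -/
abbrev charModule (T : Torus F K) : Rep.{u} ℤ (K ≃ₐ[F] K) := Rep.of (charRep F K T.coord)

variable (F K) in
/-- The contravariant functor `T ↦ T̂` (Cartier duality), regarded as a covariant functor to the
opposite of the category of Galois modules. -/
def charFunctor : Torus F K ⥤ (Rep.{u} ℤ (K ≃ₐ[F] K))ᵒᵖ where
  obj T := Opposite.op T.charModule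
  map f := (Rep.ofHom (charMap F K f)).op
  map_id T := by
    apply Quiver.Hom.unop_inj
    apply Rep.hom_ext
    ext χ
    apply Additive.toMul.injective
    apply GroupLike.ext
    change Bialgebra.TensorProduct.map (BialgHom.id K K) (BialgHom.id F T.coord) χ.toMul.val =
      χ.toMul.val
    induction χ.toMul.val with
    | zero => simp
    | add x y hx hy => rw [map_add, hx, hy]
    | tmul s a => rfl
  map_comp {T T' T''} f g := by
    apply Quiver.Hom.unop_inj
    apply Rep.hom_ext
    ext χ
    apply Additive.toMul.injective
    apply GroupLike.ext
    change Bialgebra.TensorProduct.map (BialgHom.id K K) (BialgHom.comp f g) χ.toMul.val =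
      Bialgebra.TensorProduct.map (BialgHom.id K K) f
        (Bialgebra.TensorProduct.map (BialgHom.id K K) g χ.toMul.val)
    induction χ.toMul.val with
    | zero => simp
    | add x y hx hy => simp only [map_add, hx, hy]
    | tmul s a => rfl

/-- `T` is split by a finite separable extension `E` of `F`: for one (equivalently, every)
embedding of `E` in the separable closure `K`, the absolute Galois group of `E` acts trivially on
the character module of `T`. -/
def IsSplitBy (T : Torus F K) (E : Type v) [Field E] [Algebra F E] : Prop :=
  ∀ (φ : E →ₐ[F] K) (σ : K ≃ₐ[F] K), (∀ x, σ (φ x) = φ x) → ∀ χ, T.charModule.ρ σ χ = χ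

/-- `T` is quasitrivial: it is isomorphic to a finite product of Weil restrictions
`R_{E/F} 𝔾ₘ` for finite separable extensions `E` of `F`. This is expressed on functors of points:
there are isomorphisms of groups `T(B) ≃ ∏ᵢ (Eᵢ ⊗ B)ˣ`, natural in the commutative
`F`-algebra `B`. The group `T(B)` consists of the algebra homomorphisms from the coordinate ring
to `B`, with the convolution product. -/
def IsQuasitrivial (T : Torus F K) : Prop :=
  ∃ (m : ℕ) (E : Fin m → Type u) (_ : ∀ i, Field (E i)) (_ : ∀ i, Algebra F (E i)),
    (∀ i, FiniteDimensional F (E i)) ∧ (∀ i, Algebra.IsSeparable F (E i)) ∧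
    ∃ φ : ∀ (B : Type u) [CommRing B] [Algebra F B],
      WithConv (T.coord →ₐ[F] B) ≃* (∀ i, (E i ⊗[F] B)ˣ),
      ∀ (B B' : Type u) [CommRing B] [Algebra F B] [CommRing B'] [Algebra F B'] (h : B →ₐ[F] B')
        (t : T.coord →ₐ[F] B) (i : Fin m),
        φ B' (WithConv.toConv (h.comp t)) i =
          Units.map (Algebra.TensorProduct.map (AlgHom.id F (E i)) h : E i ⊗[F] B →* E i ⊗[F] B')
            (φ B (WithConv.toConv t) i)

end Torus

/-! ## Permutation, flasque and coflasque Galois modules -/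

namespace GaloisModule

variable {G : Type u} [Group G] [TopologicalSpace G]

/-- A permutation `G`-lattice: there is a finite `ℤ`-basis permuted by `G`, and the action is
continuous. -/
def IsPermutation (M : Rep.{u} ℤ G) : Prop :=
  ∃ (n : ℕ) (b : Module.Basis (Fin n) ℤ M),
    (∀ g i, ∃ j, M.ρ g (b i) = b j) ∧ ∀ i, IsOpen {g : G | M.ρ g (b i) = b i}

/-- A `G`-lattice `M` is flasque if `Ext¹(M, P) = 0`, over `ℤ[G]`, for any permutation `G`-lattice
`P`. -/
def IsFlasque (M : Rep.{u} ℤ G) : Prop :=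
  ∀ P : Rep.{u} ℤ G, IsPermutation P →
    Subsingleton (@Abelian.Ext (Rep.{u} ℤ G) _ _ (HasExt.standard _) M P 1)

/-- A `G`-lattice `M` is coflasque if `Ext¹(P, M) = 0`, over `ℤ[G]`, for any permutation
`G`-lattice `P`. -/
def IsCoflasque (M : Rep.{u} ℤ G) : Prop :=
  ∀ P : Rep.{u} ℤ G, IsPermutation P →
    Subsingleton (@Abelian.Ext (Rep.{u} ℤ G) _ _ (HasExt.standard _) P M 1)

end GaloisModule

namespace Torus

variable {F K : Type u} [Field F] [Field K] [Algebra F K]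

/-- A torus is flasque if its character module is. -/
def IsFlasque (T : Torus F K) : Prop := GaloisModule.IsFlasque T.charModule

/-- A torus is coflasque if its character module is. -/
def IsCoflasque (T : Torus F K) : Prop := GaloisModule.IsCoflasque T.charModule

/-! ## Complexes of tori in the derived category -/

instance : HasDerivedCategory.{u + 1} (Rep.{u} ℤ (K ≃ₐ[F] K))ᵒᵖ :=
  HasDerivedCategory.standard _

variable (F K) in
/-- The derived category in which complexes of tori are considered: by the exact anti-equivalence
`T ↦ T̂`, it is the derived category of the opposite of the abelian category of Galois modules. -/
abbrev Derived : Type (u + 1) := DerivedCategory (Rep.{u} ℤ (K ≃ₐ[F] K))ᵒᵖ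

variable (F K) in
/-- A torus as an object of the derived category, placed in degree `0`. -/
abbrev single : Torus F K ⥤ Derived F K :=
  charFunctor F K ⋙ DerivedCategory.singleFunctor _ 0

/-- The complex of tori `[T₁ ⟶ T₂]` as an object of the derived category, with `T₁` and `T₂`
placed in respective degrees `-1` and `0`. -/
abbrev twoTerm {T₁ T₂ : Torus F K} (d : T₁ ⟶ T₂) : Derived F K :=
  DerivedCategory.Q.obj (TwoTerm.complex ((charFunctor F K).map d))

end Torus

/-- A complex of tori `[A ⟶ B]` with a quasi-isomorphism (an isomorphism in the derived category) to
the complex of tori `[T₁ ⟶ T₂]`. -/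
structure TorusResolution {F K : Type u} [Field F] [Field K] [Algebra F K] {T₁ T₂ : Torus F K}
    (d : T₁ ⟶ T₂) where
  /-- The term `A` in degree `-1`. -/
  left : Torus F K
  /-- The term `B` in degree `0`. -/
  right : Torus F K
  /-- The differential `A ⟶ B`. -/
  diff : left ⟶ right
  /-- The quasi-isomorphism. -/
  iso : Torus.twoTerm diff ≅ Torus.twoTerm d

namespace TorusResolution

variable {F K : Type u} [Field F] [Field K] [Algebra F K] {T₁ T₂ : Torus F K} {d : T₁ ⟶ T₂}

/-- `[S ⟶ Q]` is a flasque resolution: `S` is flasque and `Q` is quasitrivial. -/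
def IsFlasque (R : TorusResolution d) : Prop := R.left.IsFlasque ∧ R.right.IsQuasitrivial

/-- `[P ⟶ R]` is a coflasque resolution: `P` is quasitrivial and `R` is coflasque. -/
def IsCoflasque (R : TorusResolution d) : Prop := R.left.IsQuasitrivial ∧ R.right.IsCoflasque

/-- Both tori of the resolution are split by `E`. -/
def IsSplitBy (R : TorusResolution d) (E : Type v) [Field E] [Algebra F E] : Prop :=
  R.left.IsSplitBy E ∧ R.right.IsSplitBy E

/-- The triangle `A ⟶ B ⟶ [T₁ ⟶ T₂] ⟶ A⟦1⟧` attached to a resolution `[A ⟶ B]` of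
`[T₁ ⟶ T₂]`. -/
def triangle (R : TorusResolution d) : Triangle (Torus.Derived F K) :=
  TwoTerm.triangle ((Torus.charFunctor F K).map R.diff) R.iso

/-- The triangle attached to a resolution is distinguished. -/
lemma triangle_distinguished (R : TorusResolution d) :
    R.triangle ∈ distTriang (Torus.Derived F K) :=
  TwoTerm.triangle_distinguished _ _

/-- `R` and `R'` are resolutions of two complexes of tori, and `f` is a morphism between the latter
in the derived category. There are homomorphisms of tori `a` and `b` such that
`(a, b, f, a⟦1⟧)` is a morphism from the distinguished triangle of `R` to that of `R'`. -/
def Lifts {T₁' T₂' : Torus F K} {d' : T₁' ⟶ T₂'} (R : TorusResolution d)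
    (R' : TorusResolution d') (f : Torus.twoTerm d ⟶ Torus.twoTerm d') : Prop :=
  ∃ (a : R.left ⟶ R'.left) (b : R.right ⟶ R'.right) (φ : R.triangle ⟶ R'.triangle),
    φ.hom₁ = (Torus.single F K).map a ∧ φ.hom₂ = (Torus.single F K).map b ∧ φ.hom₃ = f

end TorusResolution

end

/-!
A complex of tori `[T₁ ⟶ T₂]` is treated through its dual, the morphism `T̂₂ ⟶ T̂₁` of Galois
lattices. The proof rests on the following ideas.

*Two-term complexes.* In an abelian category, let `[X ⟶ Y] ≃ K` and `[X' ⟶ Y'] ≃ K'` in the derived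
category. The obstruction to lifting a morphism `Y ⟶ K ⟶ K'` to `Y'` lies in `Ext¹(Y, X')`. If this
group vanishes, every morphism `K ⟶ K'` extends to the triangles
(`TwoTerm.exists_triangle_hom`). If `K = K'` and both `Ext¹(Y, X')` and `Ext¹(Y', X)` vanish, then
`X ⊞ Y' ≅ X' ⊞ Y`, as in Schanuel's lemma (`TwoTerm.nonempty_biprod_iso`). The definitions of
flasque and coflasque modules provide the vanishing, in the opposite category (`noExtension_op`).

*Permutation lattices.* The groups `Ext¹` are taken over the abstract group ring `ℤ[G]` of the
profinite group `G`, so that crossed homomorphisms need not be continuous. Still, `H¹(H, P) = 0` for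
`P` a permutation lattice and `H` an open subgroup (`GaloisModule.h1Vanishing_of_basis`), as a compact
group has no nonzero homomorphism to `ℤ`, even discontinuous (`eq_zero_of_compactSpace`).
By Shapiro's lemma, done by hand on a permuted basis, a lattice `M` is coflasque if `H¹(H, M) = 0` for
all open `H`, and flasque if the same is true of its dual.

*Existence for lattices.* A lattice `M` is a quotient of a permutation lattice `P` such that
`P ^ H → M ^ H` is surjective for all `H`, so that the kernel has no `H¹`
(`GaloisModule.IsLattice.exists_cover`). Dually, `M` embeds in a permutation lattice
(`GaloisModule.IsLattice.exists_embedding`). Given a morphism of lattices, a pushout along such an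
embedding and a pullback along such a cover, in one order or the other, give quasi-isomorphic
morphisms, the last of which is a flasque or a coflasque resolution
(`GaloisModule.exists_flasque_bicartesianSq`, `GaloisModule.exists_coflasque_bicartesianSq`). An open
subgroup acting trivially on the given lattices acts trivially on all the others, whence the
statement on splitting fields.

*Cartier duality.* The lattices are turned into tori by Galois descent. The Hopf algebra of the torus
with character lattice `M` is the algebra of invariants of the Galois group in `K[M]`, for `K` the
separable closure (`Torus.ofInvariants_bijective`, `Torus.exists_charModule_iso`), and
homomorphisms descend as well, so that `T ↦ T̂` is full. The points of a torus with
a permuted basis of characters are families of units (`Torus.exists_points_mulEquiv`), which,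
by Yoneda's lemma, identifies the quasitrivial tori with those whose character module is a
permutation lattice (`Torus.isQuasitrivial_of_isPermutation`,
`Torus.isPermutation_of_isQuasitrivial`).
-/

universe t

noncomputable section

/-! ### Quasi-isomorphisms and triangles of two-term complexes -/

namespace TwoTerm

variable {C : Type u} [Category.{v} C] [Abelian C]

/-- The morphism of complexes `[X ⟶ Y] ⟶ [X' ⟶ Y']` given by a commutative square. -/
def map {X Y X' Y' : C} {d : X ⟶ Y} {d' : X' ⟶ Y'} {a : X ⟶ X'} {b : Y ⟶ Y'}
    (sq : CommSq d a b d') : complex d ⟶ complex d' :=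
  HomologicalComplex.mkHomFromDouble _ (by simp) (a ≫ (leftIso d').inv) (b ≫ (rightIso d').inv)
    (by
      have h := HomologicalComplex.double_d d' (c := ComplexShape.up ℤ) (i₀ := -1) (i₁ := 0)
        (by simp) (by simp)
      erw [h]
      have h2 : (leftIso d').inv ≫ (HomologicalComplex.doubleXIso₀ d' (by simp)).hom = 𝟙 _ :=
        (leftIso d').inv_hom_id
      rw [Category.assoc, reassoc_of% h2, reassoc_of% sq.w]
      rfl)
    (fun k hk => by
      erw [HomologicalComplex.double_d_eq_zero₀ _ _ _ _ (by simp), comp_zero])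

lemma map_f_left {X Y X' Y' : C} {d : X ⟶ Y} {d' : X' ⟶ Y'} {a : X ⟶ X'} {b : Y ⟶ Y'}
    (sq : CommSq d a b d') : (map sq).f (-1) = (leftIso d).hom ≫ a ≫ (leftIso d').inv :=
  HomologicalComplex.mkHomFromDouble_f₀ ..

lemma map_f_right {X Y X' Y' : C} {d : X ⟶ Y} {d' : X' ⟶ Y'} {a : X ⟶ X'} {b : Y ⟶ Y'}
    (sq : CommSq d a b d') : (map sq).f 0 = (rightIso d).hom ≫ b ≫ (rightIso d').inv :=
  HomologicalComplex.mkHomFromDouble_f₁ ..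

lemma incl_map {X Y X' Y' : C} {d : X ⟶ Y} {d' : X' ⟶ Y'} {a : X ⟶ X'} {b : Y ⟶ Y'}
    (sq : CommSq d a b d') :
    incl d ≫ map sq = (CochainComplex.singleFunctor C 0).map b ≫ incl d' := by
  apply HomologicalComplex.from_single_hom_ext
  have h {X Y : C} (d : X ⟶ Y) : (incl d).f 0 = (singleXIso Y).hom ≫ (rightIso d).inv :=
    HomologicalComplex.mkHomFromSingle_f ..
  have h' := singleXIso_comm b
  rw [Iso.inv_comp_eq] at h'
  rw [HomologicalComplex.comp_f, HomologicalComplex.comp_f, h, h, map_f_right, h', Category.assoc,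
    Category.assoc, Category.assoc]
  exact congrArg _ ((rightIso d).inv_hom_id_assoc _ |>.trans (congrArg _
    ((singleXIso Y').inv_hom_id_assoc _).symm))

lemma complex_d {X Y : C} (d : X ⟶ Y) :
    (complex d).d (-1) 0 = (leftIso d).hom ≫ d ≫ (rightIso d).inv :=
  HomologicalComplex.double_d d _ (by simp)

/-- In a commutative square which is both cartesian and cocartesian, the horizontal maps have the
same kernel and the same cokernel. -/
lemma quasiIso_map {X Y X' Y' : C} {d : X ⟶ Y} {d' : X' ⟶ Y'} {a : X ⟶ X'} {b : Y ⟶ Y'}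
    (sq : BicartesianSq d a b d') : QuasiIso (map sq.toCommSq) := by
  set f := map sq.toCommSq with hf
  have hl : IsPullback ((complex d).d (-1) 0) (f.f (-1)) (f.f 0) ((complex d').d (-1) 0) :=
    sq.toIsPullback.of_iso (leftIso d).symm (rightIso d).symm (leftIso d').symm (rightIso d').symm
      (by simp [complex_d]) (by simp [hf, map_f_left]) (by simp [hf, map_f_right])
      (by simp [complex_d])
  have hr : IsPushout ((complex d).d (-1) 0) (f.f (-1)) (f.f 0) ((complex d').d (-1) 0) :=
    sq.toIsPushout.of_iso (leftIso d).symm (rightIso d).symm (leftIso d').symm (rightIso d').symm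
      (by simp [complex_d]) (by simp [hf, map_f_left]) (by simp [hf, map_f_right])
      (by simp [complex_d])
  have hz {X Y : C} (d : X ⟶ Y) (n : ℤ) (h1 : n ≠ -1) (h0 : n ≠ 0) :
      IsZero ((complex d).X n) := HomologicalComplex.isZero_double_X _ _ n h1 h0
  refine ⟨fun n => ?_⟩
  by_cases h1 : n = -1
  · subst h1
    rw [quasiIsoAt_iff' f (-2) (-1) 0 (by simp) (by simp)]
    refine (ShortComplex.LeftHomologyMapData.ofIsLimitKernelFork _
      ((hz d (-2) (by simp) (by simp)).eq_of_src _ _) _ (kernelIsKernel _)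
      ((hz d' (-2) (by simp) (by simp)).eq_of_src _ _) _ (kernelIsKernel _)
      (kernel.map _ _ _ _ hl.w) (by
        exact (kernel.lift_ι _ _ _).symm)).quasiIso_iff.2 (isIso_kernel_map_of_isPullback hl)
  by_cases h0 : n = 0
  · subst h0
    rw [quasiIsoAt_iff' f (-1) 0 1 (by simp) (by simp)]
    refine (ShortComplex.RightHomologyMapData.ofIsColimitCokernelCofork _
      ((hz d 1 (by simp) (by simp)).eq_of_tgt _ _) _ (cokernelIsCokernel _)
      ((hz d' 1 (by simp) (by simp)).eq_of_tgt _ _) _ (cokernelIsCokernel _)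
      (cokernel.map _ _ _ _ hr.w) (by
        exact (cokernel.π_desc _ _ _).symm)).quasiIso_iff.2 (isIso_cokernel_map_of_isPushout hr)
  · rw [quasiIsoAt_iff_exactAt _ _ (.of_isZero (hz d n h1 h0))]
    exact .of_isZero (hz d' n h1 h0)

/-- The square witnessing that `[X ⊞ Z ⟶ Y ⊞ Z]` and `[X ⟶ Y]` are quasi-isomorphic. -/
lemma bicartesianSq_biprod_map_id {X Y : C} (d : X ⟶ Y) (Z : C) :
    BicartesianSq (biprod.map d (𝟙 Z)) biprod.fst biprod.fst d := by
  refine .of_isPullback_isPushout ?_ ?_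
  · refine ⟨⟨by simp⟩, ⟨PullbackCone.IsLimit.mk _
      (fun s => biprod.lift s.snd (s.fst ≫ biprod.snd)) (fun s => ?_) (fun s => ?_)
      (fun s m h1 h2 => ?_)⟩⟩
    · ext
      · simpa using s.condition.symm
      · simp
    · simp
    · ext
      · simpa using h2
      · simp [← h1]
  · refine ⟨⟨by simp⟩, ⟨PushoutCocone.IsColimit.mk _
      (fun s => biprod.inl ≫ s.inl) (fun s => ?_) (fun s => ?_)
      (fun s m h1 h2 => ?_)⟩⟩
    · ext
      · simp
      · have := biprod.inr ≫= s.condition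
        simp at this
        simp [this]
    · have := biprod.inl ≫= s.condition
      simpa using this
    · simp [← h1]

variable [HasDerivedCategory.{w} C]

/-- The isomorphism in the derived category given by a bicartesian square. -/
def isoOfBicartesian {X Y X' Y' : C} {d : X ⟶ Y} {d' : X' ⟶ Y'} {a : X ⟶ X'} {b : Y ⟶ Y'}
    (sq : BicartesianSq d a b d') :
    DerivedCategory.Q.obj (complex d) ≅ DerivedCategory.Q.obj (complex d') :=
  haveI := quasiIso_map sq
  asIso (DerivedCategory.Q.map (map sq.toCommSq))

lemma triangle_mor₂_isoOfBicartesian {X Y X' Y' : C} {d : X ⟶ Y} {d' : X' ⟶ Y'} {a : X ⟶ X'}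
    {b : Y ⟶ Y'} (sq : BicartesianSq d a b d') {K : DerivedCategory C}
    (e : DerivedCategory.Q.obj (complex d') ≅ K) :
    (triangle d (isoOfBicartesian sq ≪≫ e)).mor₂ =
      (DerivedCategory.singleFunctor C 0).map b ≫ (triangle d' e).mor₂ := by
  have h := congrArg DerivedCategory.Q.map (incl_map sq.toCommSq)
  rw [Functor.map_comp, Functor.map_comp] at h
  change DerivedCategory.Q.map (incl d) ≫ DerivedCategory.Q.map (map sq.toCommSq) ≫ e.hom =
    DerivedCategory.Q.map _ ≫ DerivedCategory.Q.map (incl d') ≫ e.hom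
  rw [reassoc_of% h]

/-- There are no nonzero morphisms from `Y` to `X⟦1⟧` in the derived category: equivalently,
`Ext¹(Y, X) = 0`. -/
def NoExtension (Y X : C) : Prop :=
  ∀ g : (DerivedCategory.singleFunctor C 0).obj Y ⟶
    ((DerivedCategory.singleFunctor C 0).obj X)⟦(1 : ℤ)⟧, g = 0

/-- As the obstruction to lifting `Y ⟶ K ⟶ K'` to `Y'` lies in `Ext¹(Y, X')`, a morphism
`K ⟶ K'` extends to the triangles when this group vanishes. -/
theorem exists_triangle_hom {X Y X' Y' : C} {d : X ⟶ Y} {d' : X' ⟶ Y'} {K K' : DerivedCategory C}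
    (e : DerivedCategory.Q.obj (complex d) ≅ K) (e' : DerivedCategory.Q.obj (complex d') ≅ K')
    (h : NoExtension Y X') (f : K ⟶ K') :
    ∃ (a : X ⟶ X') (b : Y ⟶ Y') (φ : triangle d e ⟶ triangle d' e'),
      φ.hom₁ = (DerivedCategory.singleFunctor C 0).map a ∧
      φ.hom₂ = (DerivedCategory.singleFunctor C 0).map b ∧ φ.hom₃ = f := by
  obtain ⟨b, hb⟩ := Triangle.coyoneda_exact₃ _ (triangle_distinguished d' e')
    ((triangle d e).mor₂ ≫ f) (h _)
  obtain ⟨a, ha, ha'⟩ := complete_distinguished_triangle_morphism₁ _ _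
    (triangle_distinguished d e) (triangle_distinguished d' e') b f hb
  obtain ⟨a, rfl⟩ := (DerivedCategory.singleFunctor C 0).map_surjective a
  obtain ⟨b, rfl⟩ := (DerivedCategory.singleFunctor C 0).map_surjective b
  exact ⟨a, b, ⟨_, _, _, ha, hb, ha'⟩, rfl, rfl, rfl⟩

/-- Schanuel's lemma for two-term complexes. The maps `p : Y ⟶ K` and `p' : Y' ⟶ K` factor
through each other, so that `(p, 0) : Y ⊞ Y' ⟶ K` and `(p', 0) : Y' ⊞ Y ⟶ K` differ by an
isomorphism; hence the same holds for their fibres, `X ⊞ Y'` and `X' ⊞ Y`. -/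
theorem nonempty_biprod_iso {X Y X' Y' : C} {d : X ⟶ Y} {d' : X' ⟶ Y'} {K : DerivedCategory C}
    (e : DerivedCategory.Q.obj (complex d) ≅ K) (e' : DerivedCategory.Q.obj (complex d') ≅ K)
    (h : NoExtension Y X') (h' : NoExtension Y' X) : Nonempty (X ⊞ Y' ≅ X' ⊞ Y) := by
  obtain ⟨-, b, φ, -, hb, hφ⟩ := exists_triangle_hom e e' h (𝟙 K)
  obtain ⟨-, b', φ', -, hb', hφ'⟩ := exists_triangle_hom e' e h' (𝟙 K)
  let s := DerivedCategory.singleFunctor C 0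
  let p : s.obj Y ⟶ K := (triangle d e).mor₂
  let p' : s.obj Y' ⟶ K := (triangle d' e').mor₂
  have hp : s.map b ≫ p' = p := by
    have := φ.comm₂
    rw [hb, hφ] at this
    exact this.symm.trans (Category.comp_id _)
  have hp' : s.map b' ≫ p = p' := by
    have := φ'.comm₂
    rw [hb', hφ'] at this
    exact this.symm.trans (Category.comp_id _)
  -- the triangles on `(p, 0)` and `(p', 0)`
  let T := triangle _ (isoOfBicartesian (bicartesianSq_biprod_map_id d Y') ≪≫ e)
  let T' := triangle _ (isoOfBicartesian (bicartesianSq_biprod_map_id d' Y) ≪≫ e')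
  -- `α` carries `(p, p')` to `(p, 0)`, and `β` carries `(p', p)` to `(p', 0)`.
  let α : Y ⊞ Y' ≅ Y ⊞ Y' :=
    ⟨𝟙 _ - biprod.snd ≫ b' ≫ biprod.inl, 𝟙 _ + biprod.snd ≫ b' ≫ biprod.inl,
      by simp [Preadditive.comp_add, Preadditive.sub_comp],
      by simp [Preadditive.comp_sub, Preadditive.add_comp]⟩
  let β : Y' ⊞ Y ≅ Y' ⊞ Y :=
    ⟨𝟙 _ + biprod.snd ≫ b ≫ biprod.inl, 𝟙 _ - biprod.snd ≫ b ≫ biprod.inl,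
      by simp [Preadditive.comp_sub, Preadditive.add_comp],
      by simp [Preadditive.comp_add, Preadditive.sub_comp]⟩
  let θ : Y ⊞ Y' ≅ Y' ⊞ Y := α ≪≫ biprod.braiding Y Y' ≪≫ β
  have hT : T.mor₂ = s.map biprod.fst ≫ p := triangle_mor₂_isoOfBicartesian _ _
  have hT' : T'.mor₂ = s.map biprod.fst ≫ p' := triangle_mor₂_isoOfBicartesian _ _
  have hθ : θ.hom ≫ biprod.fst = biprod.fst ≫ b + biprod.snd - biprod.snd ≫ b' ≫ b := by
    simp [θ, α, β, Preadditive.sub_comp, Preadditive.add_comp]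
    abel
  have comm' : s.map biprod.fst ≫ p = s.map θ.hom ≫ s.map biprod.fst ≫ p' := by
    rw [← Functor.map_comp_assoc, hθ]
    simp only [Functor.map_sub, Functor.map_add, Functor.map_comp, Preadditive.sub_comp,
      Preadditive.add_comp, Category.assoc, hp, hp']
    abel
  have comm : T.mor₂ ≫ 𝟙 K = s.map θ.hom ≫ T'.mor₂ := by
    refine (Category.comp_id _).trans (hT.trans (comm'.trans ?_))
    exact congrArg (fun z => s.map θ.hom ≫ z) hT'.symm
  obtain ⟨a, ha, ha'⟩ := complete_distinguished_triangle_morphism₁ T T'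
    (triangle_distinguished _ _) (triangle_distinguished _ _) (s.map θ.hom) (𝟙 K) comm
  let ψ : T ⟶ T' := ⟨a, s.map θ.hom, 𝟙 K, ha, comm, ha'⟩
  have h₂ : IsIso ψ.hom₂ := inferInstanceAs (IsIso (s.map θ.hom))
  have h₃ : IsIso ψ.hom₃ := inferInstanceAs (IsIso (𝟙 K))
  have h₁ : IsIso ψ.hom₁ := isIso₁_of_isIso₂₃ ψ (triangle_distinguished _ _)
    (triangle_distinguished _ _) h₂ h₃
  exact ⟨s.preimageIso (@asIso _ _ _ _ ψ.hom₁ h₁)⟩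

/-- A morphism `Y ⟶ X⟦1⟧` vanishes as soon as, for some embedding of `X` in an injective object
`I`, every morphism `Y ⟶ I / X` lifts to `I`. -/
lemma noExtension_of_injective {S : ShortComplex C} (hS : S.ShortExact) [Injective S.X₂] {Y : C}
    (h : ∀ g : Y ⟶ S.X₃, ∃ l : Y ⟶ S.X₂, l ≫ S.g = g) : NoExtension Y S.X₁ := by
  intro g
  have h0 (g : (DerivedCategory.singleFunctor C 0).obj Y ⟶
      ((DerivedCategory.singleFunctor C 0).obj S.X₂)⟦(1 : ℤ)⟧) : g = 0 := by
    let K := (CochainComplex.singleFunctor C 0).obj Y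
    have := K.isStrictlyGE_of_ge 0 0 le_rfl
    rw [← cancel_mono (((DerivedCategory.singleFunctors C).shiftIso 1 (-1) 0 (by lia)).hom.app _),
      zero_comp]
    exact DerivedCategory.to_singleFunctor_obj_eq_zero_of_injective (K := K) (n := 0) _ (by lia)
  obtain ⟨k, hk⟩ := Triangle.coyoneda_exact₁ _ hS.singleTriangle_distinguished g (h0 _)
  obtain ⟨k, rfl⟩ := (DerivedCategory.singleFunctor C 0).map_surjective k
  obtain ⟨l, rfl⟩ := h k
  rw [hk, Functor.map_comp]
  refine (Category.assoc _ _ _).trans ((congrArg _ ?_).trans comp_zero)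
  exact comp_distTriang_mor_zero₂₃ _ hS.singleTriangle_distinguished

end TwoTerm

/-! ### Vanishing of `Ext¹` in a category and in its opposite -/

section Ext

variable {C : Type u} [Category.{v} C] [Abelian C]

/-- If `Ext¹(M, N) = 0`, then a morphism to `N` from the kernel of `P ⟶ M` extends to `P`. -/
lemma exists_extension_of_subsingleton_ext [HasExt.{w} C] {S : ShortComplex C} (hS : S.ShortExact)
    {N : C} [Subsingleton (Abelian.Ext S.X₃ N 1)] (g : S.X₁ ⟶ N) : ∃ l : S.X₂ ⟶ N, S.f ≫ l = g := by
  obtain ⟨x, hx⟩ := Abelian.Ext.contravariant_sequence_exact₁ hS N (Abelian.Ext.mk₀ g) (n₁ := 1) rfl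
    (Subsingleton.elim _ _)
  obtain ⟨l, rfl⟩ := (Abelian.Ext.mk₀_bijective _ _).2 x
  rw [Abelian.Ext.mk₀_comp_mk₀] at hx
  exact ⟨l, (Abelian.Ext.mk₀_bijective _ _).1 hx⟩

/-- If every extension of `M` by `N` splits, then `Ext¹(M, N) = 0`. -/
lemma subsingleton_ext_of_split [HasExt.{w} C] [EnoughProjectives C] {M N : C}
    (h : ∀ (E : C) (i : N ⟶ E) (p : E ⟶ M) (w : i ≫ p = 0), (ShortComplex.mk i p w).ShortExact →
      ∃ r : E ⟶ N, i ≫ r = 𝟙 N) : Subsingleton (Abelian.Ext M N 1) := by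
  refine ⟨fun x y => ?_⟩
  suffices H : ∀ x : Abelian.Ext M N 1, x = 0 by rw [H x, H y]
  clear x y
  intro x
  let p := Projective.π M
  let S : ShortComplex C := ShortComplex.mk (kernel.ι p) p (kernel.condition p)
  have hS : S.ShortExact := { exact := S.exact_of_f_is_kernel (kernelIsKernel p) }
  obtain ⟨y, rfl⟩ := Abelian.Ext.contravariant_sequence_exact₃ hS N x
    (Abelian.Ext.eq_zero_of_projective _) (n₀ := 0) rfl
  obtain ⟨g, rfl⟩ := (Abelian.Ext.mk₀_bijective _ _).2 y
  let q : pushout S.f g ⟶ M := pushout.desc p 0 (by simp [S])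
  have hpo := IsPushout.of_hasPushout S.f g
  have hq : pushout.inr S.f g ≫ q = 0 := pushout.inr_desc ..
  have : Epi q := epi_of_epi_fac (pushout.inl_desc p 0 (by simp [S]) : pushout.inl S.f g ≫ q = p)
  have hE : (ShortComplex.mk _ q hq).ShortExact := by
    refine { exact := ?_, mono_f := ?_, epi_g := ‹_› }
    · refine ShortComplex.exact_of_g_is_cokernel _ (CokernelCofork.IsColimit.ofπ' _ _ fun {A} k
        (hk : pushout.inr S.f g ≫ k = 0) => ?_)
      refine ⟨hS.exact.desc (pushout.inl _ _ ≫ k) ?_, ?_⟩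
      · rw [pushout.condition_assoc, hk, comp_zero]
      · apply pushout.hom_ext
        · rw [pushout.inl_desc_assoc]
          exact hS.exact.g_desc _ _
        · rw [pushout.inr_desc_assoc, zero_comp, hk]
    · exact inferInstanceAs (Mono (pushout.inr S.f g))
  obtain ⟨r, hr⟩ := h _ _ _ _ hE
  have hg : S.f ≫ pushout.inl S.f g ≫ r = g := by
    rw [pushout.condition_assoc, hr, Category.comp_id]
  rw [← hg, ← Abelian.Ext.mk₀_comp_mk₀, ← Abelian.Ext.comp_assoc_of_second_deg_zero,
    hS.extClass_comp, Abelian.Ext.zero_comp]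

/-- Comparison of the vanishing of `Ext¹` in a category and in its opposite: a projective
presentation of `M` becomes an embedding of `op M` in an injective object. -/
lemma noExtension_op [HasExt.{w} C] [EnoughProjectives C] [HasDerivedCategory.{t} Cᵒᵖ] {M N : C}
    (h : Subsingleton (Abelian.Ext M N 1)) :
    TwoTerm.NoExtension (Opposite.op N) (Opposite.op M) := by
  let p := Projective.π M
  let S : ShortComplex C := ShortComplex.mk (kernel.ι p) p (kernel.condition p)
  have hS : S.ShortExact := { exact := S.exact_of_f_is_kernel (kernelIsKernel p) }
  have : Injective S.op.X₂ := inferInstanceAs (Injective (Opposite.op (Projective.over M)))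
  have : Subsingleton (Abelian.Ext S.X₃ N 1) := h
  refine TwoTerm.noExtension_of_injective hS.op (fun g => ?_)
  obtain ⟨l, hl⟩ := exists_extension_of_subsingleton_ext hS (N := N) g.unop
  exact ⟨l.op, Quiver.Hom.unop_inj hl⟩

end Ext

/-! ### Vanishing of `H¹` and permutation lattices -/

/-- An abstract homomorphism from a compact group to `ℤ` is trivial. By compactness every `g` is a
product of an infinitely `2`-divisible and an infinitely `3`-divisible element. -/
theorem eq_zero_of_compactSpace {H : Type*} [Group H] [TopologicalSpace H] [IsTopologicalGroup H]
    [CompactSpace H] [T2Space H] (f : H → ℤ) (hf : ∀ x y, f (x * y) = f x + f y) (g : H) :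
    f g = 0 := by
  -- pairs of sequences `x`, `y` with `x₀ y₀ = g`, `xₖ = xₖ₊₁²`, `yₖ = yₖ₊₁³` for `k < n`
  let Z (n : ℕ) : Set ((ℕ → H) × (ℕ → H)) :=
    {z | z.1 0 * z.2 0 = g ∧ ∀ k < n, z.1 (k + 1) ^ 2 = z.1 k ∧ z.2 (k + 1) ^ 3 = z.2 k}
  have hZ (n : ℕ) : IsClosed (Z n) := by
    have h1 (k : ℕ) : IsClosed {z : (ℕ → H) × (ℕ → H) | z.1 (k + 1) ^ 2 = z.1 k ∧
        z.2 (k + 1) ^ 3 = z.2 k} :=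
      (isClosed_eq (by fun_prop) (by fun_prop)).inter (isClosed_eq (by fun_prop) (by fun_prop))
    have : Z n = {z | z.1 0 * z.2 0 = g} ∩ ⋂ k ∈ Set.Iio n, {z : (ℕ → H) × (ℕ → H) |
        z.1 (k + 1) ^ 2 = z.1 k ∧ z.2 (k + 1) ^ 3 = z.2 k} := by
      ext z; simp [Z]
    rw [this]
    exact (isClosed_eq (by fun_prop) (by fun_prop)).inter (isClosed_biInter fun k _ => h1 k)
  have hne (n : ℕ) : (Z n).Nonempty := by
    -- for `a 2ⁿ + b 3ⁿ = 1`, the powers of `g` with exponents `a 2ⁿ⁻ᵏ` and `b 3ⁿ⁻ᵏ`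
    obtain ⟨a, b, hab⟩ : IsCoprime ((2 : ℤ) ^ n) ((3 : ℤ) ^ n) := by
      apply IsCoprime.pow
      exact ⟨-1, 1, by norm_num⟩
    refine ⟨(fun k => g ^ (a * 2 ^ (n - k)), fun k => g ^ (b * 3 ^ (n - k))), ?_, fun k hk => ?_⟩
    · simp only [Nat.sub_zero]
      rw [← zpow_add, hab, zpow_one]
    · have : n - k = n - (k + 1) + 1 := by omega
      simp only [this, ← zpow_natCast, ← zpow_mul, pow_succ]
      constructor <;> congr 1 <;> push_cast <;> ring
  have hanti : ∀ n, Z (n + 1) ⊆ Z n := fun n z hz => ⟨hz.1, fun k hk => hz.2 k (by omega)⟩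
  obtain ⟨z, hz⟩ := IsCompact.nonempty_iInter_of_sequence_nonempty_isCompact_isClosed Z hanti hne
    (hZ 0).isCompact hZ
  rw [Set.mem_iInter] at hz
  have hpow (x : H) (k : ℕ) : f (x ^ k) = k * f x := by
    induction k with
    | zero =>
      have := hf 1 1
      rw [mul_one] at this
      simp; omega
    | succ k ih => rw [pow_succ, hf, ih]; push_cast; ring
  have key (p : ℕ) (hp : 2 ≤ p) (x : ℕ → H) (hx : ∀ k, x (k + 1) ^ p = x k) : f (x 0) = 0 := by
    have hdvd (k : ℕ) : f (x 0) = (p : ℤ) ^ k * f (x k) := by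
      induction k with
      | zero => simp
      | succ k ih => rw [ih, ← hx k, hpow]; ring
    by_contra h0
    have h1 : ((p ^ (f (x 0)).natAbs : ℕ) : ℤ) ∣ f (x 0) := by
      push_cast
      exact ⟨_, hdvd _⟩
    have h2 := Nat.le_of_dvd (Int.natAbs_pos.2 h0) (Int.natCast_dvd.1 h1)
    exact absurd (Nat.lt_pow_self (n := (f (x 0)).natAbs) (by omega : 1 < p)) (by omega)
  rw [← (hz 0).1, hf, key 2 le_rfl z.1 fun k => ((hz (k + 1)).2 k (by omega)).1,
    key 3 (by norm_num) z.2 fun k => ((hz (k + 1)).2 k (by omega)).2, add_zero]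

namespace GaloisModule

-- `ℤ`-linear maps and bases refer to the module structure which is part of a representation.
attribute [local instance 2000] Rep.hV2

/-- Let `X` be a `G`-set, and let `R` be an invariant relation between `X` and another `G`-set `E`.
If every `x : X` is related to an element fixed by the stabilizer of `x`, then there is an
equivariant choice of related elements. -/
lemma exists_equivariant_choice {G X E : Type*} [Group G] [MulAction G X] [MulAction G E]
    (R : X → E → Prop) (hR : ∀ (g : G) x e, R x e → R (g • x) (g • e))
    (h : ∀ x, ∃ e, R x e ∧ ∀ g ∈ MulAction.stabilizer G x, g • e = e) :
    ∃ s : X → E, (∀ x, R x (s x)) ∧ ∀ (g : G) x, s (g • x) = g • s x := by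
  choose e he hfix using h
  let r (x : X) : X := (Quotient.mk (MulAction.orbitRel G X) x).out
  have hr (x : X) : ∃ g : G, g • r x = x := by
    have : MulAction.orbitRel G X (r x) x := Quotient.exact (Quotient.out_eq _)
    rw [MulAction.orbitRel_apply] at this
    exact (MulAction.mem_orbit_symm.1 this)
  choose k hk using hr
  have hrg (g : G) (x : X) : r (g • x) = r x := by
    have : (Quotient.mk (MulAction.orbitRel G X) (g • x)) = Quotient.mk _ x :=
      Quotient.sound (MulAction.mem_orbit x g)
    simp [r, this]
  have key (g g' : G) (x : X) (h : g • x = g' • x) : g • e x = g' • e x := by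
    rw [← inv_smul_eq_iff, smul_smul]
    exact hfix x _ (by rw [MulAction.mem_stabilizer_iff, ← smul_smul, h, inv_smul_smul])
  refine ⟨fun x => k x • e (r x), fun x => ?_, fun g x => ?_⟩
  · have := hR (k x) _ _ (he (r x))
    rwa [hk] at this
  · change k (g • x) • e (r (g • x)) = g • k x • e (r x)
    rw [hrg, smul_smul]
    refine key _ _ _ ?_
    rw [← smul_smul, hk, ← hrg g x, hk]

variable {G : Type u} [Group G] [TopologicalSpace G]

/-- All the groups `H¹(H, V)`, for `H` an open subgroup of `G`, are zero: every crossed homomorphism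
from `H` to `V` is principal. A crossed homomorphism is the restriction to `H` of a function on
`G`, whose values outside `H` do not matter. No continuity is imposed. -/
def H1Vanishing {V : Type*} [AddCommGroup V] [Module ℤ V] (ρ : Representation ℤ G V) : Prop :=
  ∀ H : Subgroup G, IsOpen (H : Set G) → ∀ c : G → V,
    (∀ g ∈ H, ∀ h ∈ H, c (g * h) = c g + ρ g (c h)) → ∃ v, ∀ g ∈ H, c g = ρ g v - v

/-- Vanishing of `H¹` for permutation lattices. By Shapiro's lemma this comes down to the absence
of nonzero homomorphisms from a compact group to `ℤ`. -/
theorem h1Vanishing_of_basis [IsTopologicalGroup G] [CompactSpace G] [T2Space G]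
    {V X : Type*} [AddCommGroup V] [Module ℤ V] {ρ : Representation ℤ G V} [MulAction G X] [Finite X]
    (b : Module.Basis X ℤ V) (hb : ∀ (g : G) x, ρ g (b x) = b (g • x))
    (ho : ∀ x : X, IsOpen (MulAction.stabilizer G x : Set G)) : H1Vanishing ρ := by
  classical
  have := Fintype.ofFinite X
  intro H hH c hc
  have hrepr (g : G) (v : V) (x : X) : b.repr (ρ g v) (g • x) = b.repr v x := by
    have h1 : (Finsupp.lapply (g • x)).comp (b.repr.toLinearMap.comp (ρ g)) =
        (Finsupp.lapply x).comp b.repr.toLinearMap := by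
      refine b.ext fun y => ?_
      simp [hb, Finsupp.single_apply]
    exact LinearMap.congr_fun h1 v
  have hmul {g h : G} (hg : g ∈ H) (hh : h ∈ H) (x : X) :
      b.repr (c (g * h)) ((g * h) • x) = b.repr (c g) ((g * h) • x) + b.repr (c h) (h • x) := by
    rw [hc g hg h hh, map_add, Finsupp.add_apply, mul_smul, hrepr]
  have hstab {s : G} (hs : s ∈ H) {x : X} (hsx : s • x = x) : b.repr (c s) x = 0 := by
    let S : Subgroup G := MulAction.stabilizer G x ⊓ H
    have hS : IsOpen (S : Set G) := (ho x).inter hH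
    have : CompactSpace S := isCompact_iff_compactSpace.1 (S.isClosed_of_isOpen hS).isCompact
    refine eq_zero_of_compactSpace (fun s : S => b.repr (c s) x) (fun g h => ?_) ⟨s, hsx, hs⟩
    have hx := MulAction.mem_stabilizer_iff.1 (g * h).2.1
    have hx' := MulAction.mem_stabilizer_iff.1 h.2.1
    have := hmul g.2.2 h.2.2 x
    rw [hx'] at this
    rwa [show ((g : G) * h) • x = x from hx] at this
  let r (x : X) : X := (Quotient.mk (MulAction.orbitRel H X) x).out
  have hr (x : X) : ∃ g : H, g • r x = x := by
    have : MulAction.orbitRel H X (r x) x := Quotient.exact (Quotient.out_eq _)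
    rw [MulAction.orbitRel_apply] at this
    exact (MulAction.mem_orbit_symm.1 this)
  choose k hk using hr
  have hrg (g : H) (x : X) : r (g • x) = r x := by
    have : (Quotient.mk (MulAction.orbitRel H X) (g • x)) = Quotient.mk _ x :=
      Quotient.sound (MulAction.mem_orbit x g)
    simp [r, this]
  have hk' (x : X) : (k x : G) • r x = x := hk x
  -- the coordinate of `c g` at `g • x` depends only on `g • x` when `x` is a fixed representative
  have key {g : G} (hg : g ∈ H) {x y : X} (h : g • r x = y) (hy : r y = r x) :
      b.repr (c g) y = b.repr (c (k y)) y := by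
    have h1 : ((k y : G)⁻¹ * g) • r x = r x := by
      rw [mul_smul, h, inv_smul_eq_iff, ← hy, hk']
    have h2 := hmul (k y).2 (H.mul_mem (H.inv_mem (k y).2) hg) (r x)
    rwa [mul_inv_cancel_left, h1, h, hstab (H.mul_mem (H.inv_mem (k y).2) hg) h1, add_zero] at h2
  refine ⟨b.equivFun.symm fun y => -b.repr (c (k y)) y, fun g hg => ?_⟩
  set m := b.equivFun.symm fun y => -b.repr (c (k y)) y
  have hm (y : X) : b.repr m y = -b.repr (c (k y)) y :=
    congrFun (b.equivFun.apply_symm_apply fun y => -b.repr (c (k y)) y) y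
  refine b.repr.injective (Finsupp.ext fun y => ?_)
  obtain ⟨x, rfl⟩ : ∃ x, g • x = y := ⟨g⁻¹ • y, smul_inv_smul _ _⟩
  have hx : r (g • x) = r x := hrg ⟨g, hg⟩ x
  have h1 : (g * k x) • r x = g • x := by rw [mul_smul, hk']
  have h2 := hmul hg (k x).2 (r x)
  rw [h1, hk', key (H.mul_mem hg (k x).2) h1 hx] at h2
  rw [map_sub, Finsupp.sub_apply, hrepr, hm, hm, h2]
  ring

variable {M N : Rep.{u} ℤ G}

omit [TopologicalSpace G] in
lemma hV2_eq (M : Rep.{u} ℤ G) : AddCommGroup.toIntModule M = M.hV2 := Subsingleton.elim _ _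

/-- The `G`-set underlying a permutation lattice. -/
lemma IsPermutation.exists_mulAction (hM : IsPermutation M) :
    ∃ (n : ℕ) (_ : MulAction G (Fin n)) (b : Module.Basis (Fin n) ℤ M),
      (∀ g i, M.ρ g (b i) = b (g • i)) ∧
      ∀ i : Fin n, IsOpen (MulAction.stabilizer G i : Set G) := by
  unfold IsPermutation at hM
  rw [hV2_eq] at hM
  obtain ⟨n, b, hb, ho⟩ := hM
  choose j hj using hb
  let A : MulAction G (Fin n) :=
    { smul := j
      one_smul := fun i => b.injective ((hj 1 i).symm.trans (by simp))
      mul_smul := fun g h i => b.injective <| by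
        refine (hj (g * h) i).symm.trans ?_
        rw [map_mul, Module.End.mul_apply, hj, hj]
        rfl }
  refine ⟨n, A, b, hj, fun i => ?_⟩
  convert ho i using 1
  ext g
  change j g i = i ↔ _
  rw [Set.mem_ofPred_eq, hj]
  exact b.injective.eq_iff.symm

/-- A lattice with a finite basis permuted by `G`, with open stabilizers. -/
lemma isPermutation_of_basis {X : Type*} [Finite X] [MulAction G X]
    (b : Module.Basis X ℤ M)
    (hb : ∀ (g : G) x, M.ρ g (b x) = b (g • x))
    (ho : ∀ x : X, IsOpen (MulAction.stabilizer G x : Set G)) : IsPermutation M := by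
  obtain ⟨n, ⟨e⟩⟩ := Finite.exists_equiv_fin X
  unfold IsPermutation
  rw [hV2_eq]
  refine ⟨n, b.reindex e, fun g i => ⟨e (g • e.symm i), by simp [hb]⟩, fun i => ?_⟩
  convert ho (e.symm i) using 1
  ext g
  simp [hb, MulAction.mem_stabilizer_iff, b.injective.eq_iff]

lemma IsPermutation.h1Vanishing [IsTopologicalGroup G] [CompactSpace G] [T2Space G]
    (hM : IsPermutation M) : H1Vanishing M.ρ := by
  obtain ⟨n, _, b, hb, ho⟩ := hM.exists_mulAction
  exact h1Vanishing_of_basis b hb ho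

omit [TopologicalSpace G] in
lemma exact_iff {S : ShortComplex (Rep.{u} ℤ G)} :
    S.Exact ↔ ∀ y : S.X₂, S.g.hom y = 0 → ∃ x : S.X₁, S.f.hom x = y := by
  rw [← ShortComplex.exact_map_iff_of_faithful S (forget₂ (Rep.{u} ℤ G) (ModuleCat.{u} ℤ)),
    ShortComplex.moduleCat_exact_iff]
  exact Iff.rfl

omit [TopologicalSpace G] in
instance : EnoughProjectives (Rep.{u} ℤ G) :=
  Rep.equivalenceModuleMonoidAlgebra.enoughProjectives_iff.2 ModuleCat.enoughProjectives.{u}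

/-- An extension `E` of a permutation lattice `P` by `N` splits as soon as each element of the
permuted basis lifts to an element of `E` fixed by its stabilizer. The obstruction is a class in `H¹`
of the stabilizer with values in `N`. -/
theorem isCoflasque_of_h1Vanishing (hN : H1Vanishing N.ρ) : IsCoflasque N := by
  intro P hP
  let := HasExt.standard (Rep.{u} ℤ G)
  obtain ⟨n, _, b, hb, ho⟩ := hP.exists_mulAction
  refine subsingleton_ext_of_split fun E i p w hS => ?_
  have hi : Function.Injective i.hom := (Rep.mono_iff_injective i).1 hS.mono_f
  have hp : Function.Surjective p.hom := (Rep.epi_iff_surjective p).1 hS.epi_g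
  have hex := exact_iff.1 hS.exact
  let : MulAction G E :=
    { smul := fun g e => E.ρ g e
      one_smul := fun e => by change E.ρ 1 e = e; simp
      mul_smul := fun g h e => by change E.ρ (g * h) e = E.ρ g (E.ρ h e); simp }
  obtain ⟨s, hs, hsg⟩ := exists_equivariant_choice (G := G) (X := Fin n) (E := E)
    (fun x e => p.hom e = b x) (fun g x e h => by
      change p.hom (E.ρ g e) = _
      rw [Rep.hom_comm_apply, h, hb]) (fun x => by
      obtain ⟨e, he⟩ := hp (b x)
      have h1 (g : G) : ∃ y : N, g ∈ MulAction.stabilizer G x → i.hom y = E.ρ g e - e := by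
        by_cases hg : g ∈ MulAction.stabilizer G x
        · obtain ⟨y, hy⟩ := hex (E.ρ g e - e) (by
            change p.hom _ = 0
            rw [map_sub, Rep.hom_comm_apply, he, hb, MulAction.mem_stabilizer_iff.1 hg, sub_self])
          exact ⟨y, fun _ => hy⟩
        · exact ⟨0, fun h => absurd h hg⟩
      choose c hc using h1
      obtain ⟨y, hy⟩ := hN _ (ho x) c (fun g hg h hh => hi (by
        rw [map_add, Rep.hom_comm_apply, hc _ hg, hc _ hh, hc _ (mul_mem hg hh)]
        simp))
      have hw : p.hom (i.hom y) = 0 := by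
        have := congrArg (fun f => f.hom y) w
        simpa using this
      refine ⟨e - i.hom y, by simp [he, hw], fun g hg => ?_⟩
      change E.ρ g (e - i.hom y) = _
      have := congrArg i.hom (hy g hg)
      rw [hc g hg, map_sub, Rep.hom_comm_apply] at this
      rw [map_sub, ← sub_eq_zero]
      rw [← sub_eq_zero] at this
      rw [← this]
      abel)
  let σ : P ⟶ E := Rep.ofHom (σ := E.ρ) (ρ := P.ρ) ⟨b.constr ℕ s, fun g => b.ext fun x => by
    have : s (g • x) = E.ρ g (s x) := hsg g x
    change b.constr ℕ s (P.ρ g (b x)) = E.ρ g (b.constr ℕ s (b x))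
    rw [hb, b.constr_basis, b.constr_basis, this]⟩
  have hσ : σ ≫ p = 𝟙 P := ?_
  · exact ⟨_, (ShortComplex.Splitting.ofExactOfSection _ hS.exact σ hσ hS.mono_f).f_r⟩
  apply Rep.hom_ext
  apply Representation.IntertwiningMap.ext
  refine b.ext fun x => ?_
  change p.hom (b.constr ℕ s (b x)) = b x
  rw [b.constr_basis, hs]

/-- An extension `E` of `M` by a permutation lattice `P` splits as soon as each coordinate form on
`P` extends to a linear form on `E` fixed by its stabilizer. The obstruction is a class in `H¹` of
the stabilizer with values in the dual of `M`. -/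
theorem isFlasque_of_h1Vanishing_dual (hfree : Module.Free ℤ M)
    (hM : H1Vanishing M.ρ.dual) :
    IsFlasque M := by
  intro P hP
  let := HasExt.standard (Rep.{u} ℤ G)
  obtain ⟨n, _, b, hb, ho⟩ := hP.exists_mulAction
  refine subsingleton_ext_of_split fun E i p w hS => ?_
  have hi : Function.Injective i.hom := (Rep.mono_iff_injective i).1 hS.mono_f
  have hp : Function.Surjective p.hom := (Rep.epi_iff_surjective p).1 hS.epi_g
  have hw (y : P) : p.hom (i.hom y) = 0 := by
    have := congrArg (fun f => f.hom y) w
    simpa using this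
  have hex : Function.Exact i.hom.toLinearMap p.hom.toLinearMap := fun y =>
    Iff.intro (exact_iff.1 hS.exact y) (by rintro ⟨x, rfl⟩; exact hw x)
  -- a retraction of abelian groups
  obtain ⟨l, hl⟩ := Module.projective_lifting_property p.hom.toLinearMap LinearMap.id hp
  obtain ⟨q, hq⟩ : ∃ q : E →ₗ[ℤ] P, q ∘ₗ i.hom.toLinearMap = LinearMap.id :=
     ((hex.split_tfae hi hp).out 0 1).1 (Exists.intro l hl)
  have hdual (g : G) (f : Module.Dual ℤ E) (e : E) : E.ρ.dual g f e = f (E.ρ g⁻¹ e) := rfl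
  have hcoord (g : G) (x : Fin n) (y : P) : b.coord x (P.ρ g⁻¹ y) = b.coord (g • x) y := by
    have : (b.coord x).comp (P.ρ g⁻¹) = b.coord (g • x) := by
      classical
      refine b.ext fun z => ?_
      simp [hb, Finsupp.single_apply, inv_smul_eq_iff]
    exact LinearMap.congr_fun this y
  let : MulAction G (Module.Dual ℤ E) :=
    { smul := fun g e => E.ρ.dual g e
      one_smul := fun e => by change E.ρ.dual 1 e = e; rw [map_one]; rfl
      mul_smul := fun g h e => by
        change E.ρ.dual (g * h) e = E.ρ.dual g (E.ρ.dual h e); rw [map_mul]; rfl }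
  obtain ⟨s, hs, hsg⟩ := exists_equivariant_choice (G := G) (X := Fin n) (E := Module.Dual ℤ E)
    (fun x f => ∀ y : P, f (i.hom y) = b.coord x y) (fun g x f h y => by
      change E.ρ.dual g f _ = _
      rw [hdual, ← Rep.hom_comm_apply, h, hcoord]) (fun x => by
      let f : Module.Dual ℤ E := b.coord x ∘ₗ q
      have hf (y : P) : f (i.hom y) = b.coord x y :=
        congrArg (b.coord x) (LinearMap.congr_fun hq y)
      have h1 (g : G) : ∃ m : Module.Dual ℤ M, g ∈ MulAction.stabilizer G x →
          m ∘ₗ p.hom.toLinearMap = E.ρ.dual g f - f := by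
        by_cases hg : g ∈ MulAction.stabilizer G x
        · have hker : LinearMap.ker p.hom.toLinearMap ≤ LinearMap.ker (E.ρ.dual g f - f) := by
            intro e he
            obtain ⟨y, rfl⟩ := (hex e).1 he
            change E.ρ.dual g f (i.hom y) - f (i.hom y) = 0
            rw [hdual, ← Rep.hom_comm_apply, hf, hf, hcoord, MulAction.mem_stabilizer_iff.1 hg,
              sub_self]
          refine ⟨(E.ρ.dual g f - f) ∘ₗ l, fun _ => LinearMap.ext fun e => ?_⟩
          have he : l (p.hom e) - e ∈ LinearMap.ker p.hom.toLinearMap := by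
            rw [LinearMap.mem_ker, map_sub, sub_eq_zero]
            exact LinearMap.congr_fun hl (p.hom e)
          have := hker he
          rwa [LinearMap.mem_ker, map_sub, sub_eq_zero] at this
        · exact ⟨0, fun h => absurd h hg⟩
      choose c hc using h1
      have hdualp (g : G) (m : Module.Dual ℤ M) : M.ρ.dual g m ∘ₗ p.hom.toLinearMap =
          E.ρ.dual g (m ∘ₗ p.hom.toLinearMap) := by
        ext e
        change m (M.ρ g⁻¹ (p.hom e)) = m (p.hom (E.ρ g⁻¹ e))
        rw [Rep.hom_comm_apply]
      have hinj (m m' : Module.Dual ℤ M)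
          (h : m ∘ₗ p.hom.toLinearMap = m' ∘ₗ p.hom.toLinearMap) : m = m' :=
        (LinearMap.cancel_right hp).1 h
      obtain ⟨m, hm⟩ := hM _ (ho x) c (fun g hg h hh => hinj _ _ (by
        rw [LinearMap.add_comp, hdualp, hc _ hg, hc _ hh, hc _ (mul_mem hg hh), map_mul]
        simp))
      refine ⟨f - m ∘ₗ p.hom.toLinearMap, fun y => ?_, fun g hg => ?_⟩
      · change f (i.hom y) - m (p.hom (i.hom y)) = _
        rw [hw, map_zero, sub_zero, hf]
      · change E.ρ.dual g (f - m ∘ₗ p.hom.toLinearMap) = _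
        have := hc g hg
        rw [hm g hg, LinearMap.sub_comp, hdualp] at this
        rw [map_sub, ← sub_eq_zero]
        rw [← sub_eq_zero] at this
        rw [← neg_eq_zero, ← this]
        abel)
  let r : E ⟶ P := Rep.ofHom (σ := P.ρ) (ρ := E.ρ)
    ⟨b.equivFun.symm.toLinearMap ∘ₗ LinearMap.pi s, fun g => LinearMap.ext fun e => by
      have h1 (x : Fin n) : s x (E.ρ g e) = s (g⁻¹ • x) e := by
        have : s (g⁻¹ • x) = E.ρ.dual g⁻¹ (s x) := hsg g⁻¹ x
        rw [this, hdual, inv_inv]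
      change b.equivFun.symm (fun x => s x (E.ρ g e)) = P.ρ g (b.equivFun.symm fun x => s x e)
      simp only [b.equivFun_symm_apply, h1, map_sum, LinearMap.map_smul, hb]
      exact Fintype.sum_equiv (MulAction.toPerm g⁻¹) _ _ (fun x => by simp)⟩
  refine ⟨r, ?_⟩
  apply Rep.hom_ext
  apply Representation.IntertwiningMap.ext
  refine LinearMap.ext fun y => ?_
  change b.equivFun.symm (fun x => s x (i.hom y)) = y
  simp only [hs]
  exact b.equivFun.symm_apply_apply y

end GaloisModule

/-! ### Bicartesian squares of lattices -/

section BicartesianSq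

variable {C : Type*} [Category* C] [Abelian C] {X₁ X₂ X₃ X₄ : C}
  {t : X₁ ⟶ X₂} {l : X₁ ⟶ X₃} {r : X₂ ⟶ X₄} {b : X₃ ⟶ X₄}

/-- A pushout of a monomorphism in an abelian category is also a pullback. -/
lemma bicartesianSq_of_isPushout_of_mono (h : IsPushout t l r b) (hl : Mono l) :
    BicartesianSq t l r b := by
  have hm : Mono (biprod.lift t (-l)) := by
    have : Mono (biprod.lift t (-l) ≫ biprod.snd) := by rw [biprod.lift_snd]; infer_instance
    exact mono_of_mono _ biprod.snd
  have hex (s : PullbackCone r b) :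
      ∃ x : s.pt ⟶ X₁, x ≫ biprod.lift t (-l) = biprod.lift s.fst (-s.snd) :=
    have : Mono h.shortComplex.f := hm
    ⟨_, h.exact_shortComplex.lift_f (A := s.pt) _
      (show biprod.lift s.fst (-s.snd) ≫ biprod.desc r b = 0 by simp [s.condition])⟩
  choose x hx using hex
  have h1 (s) : x s ≫ t = s.fst := by simpa using hx s =≫ biprod.fst
  have h2 (s) : x s ≫ l = s.snd := by simpa using hx s =≫ biprod.snd
  refine ⟨⟨h.toCommSq, ⟨PullbackCone.IsLimit.mk _ x h1 h2 fun s m _ hm => ?_⟩⟩, h.isColimit'⟩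
  rw [← cancel_mono l, hm, h2]

/-- A pullback of an epimorphism in an abelian category is also a pushout. -/
lemma bicartesianSq_of_isPullback_of_epi (h : IsPullback t l r b) (hr : Epi r) :
    BicartesianSq t l r b := by
  have hm : Epi (biprod.desc r (-b)) := by
    have : Epi (biprod.inl ≫ biprod.desc r (-b)) := by rw [biprod.inl_desc]; infer_instance
    exact epi_of_epi biprod.inl _
  have hex (s : PushoutCocone t l) :
      ∃ x : X₄ ⟶ s.pt, biprod.desc r (-b) ≫ x = biprod.desc s.inl (-s.inr) :=
    have : Epi h.shortComplex'.g := hm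
    ⟨_, h.exact_shortComplex'.g_desc (A := s.pt) _
      (show biprod.lift t l ≫ biprod.desc s.inl (-s.inr) = 0 by simp [s.condition])⟩
  choose x hx using hex
  have h1 (s) : r ≫ x s = s.inl := by simpa using biprod.inl ≫= hx s
  have h2 (s) : b ≫ x s = s.inr := by simpa using biprod.inr ≫= hx s
  refine ⟨h, ⟨PushoutCocone.IsColimit.mk _ x h1 h2 fun s m hm _ => ?_⟩⟩
  rw [← cancel_epi r, hm, h1]

end BicartesianSq

namespace GaloisModule

-- `ℤ`-linear maps and bases refer to the module structure which is part of a representation.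
attribute [local instance 2000] Rep.hV2

variable {G : Type u} [Group G]

section Elements

variable {X₁ X₂ X₃ X₄ : Rep.{u} ℤ G}
  {t : X₁ ⟶ X₂} {l : X₁ ⟶ X₃} {r : X₂ ⟶ X₄} {b : X₃ ⟶ X₄}

lemma comp_apply {A B D : Rep.{u} ℤ G} (f : A ⟶ B) (g : B ⟶ D) (x : A) :
    (f ≫ g).hom x = g.hom (f.hom x) := rfl

lemma exists_of_exact {A B D : Rep.{u} ℤ G} {f : A ⟶ B} {g : B ⟶ D} {w : f ≫ g = 0}
    (h : (ShortComplex.mk f g w).Exact) {y : B} (hy : g.hom y = 0) : ∃ x, f.hom x = y :=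
  exact_iff.1 h y hy

lemma comm_apply (sq : BicartesianSq t l r b) (x : X₁) :
    r.hom (t.hom x) = b.hom (l.hom x) := by
  rw [← comp_apply, ← comp_apply, sq.w]

lemma biprod_eq {A B : Rep.{u} ℤ G} (z : (A ⊞ B : Rep.{u} ℤ G)) :
    z = (biprod.inl : A ⟶ A ⊞ B).hom ((biprod.fst : A ⊞ B ⟶ A).hom z) +
      (biprod.inr : B ⟶ A ⊞ B).hom ((biprod.snd : A ⊞ B ⟶ B).hom z) :=
  (congrArg (fun f => f.hom z) (biprod.total (X := A) (Y := B))).symm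

lemma desc_apply {A B D : Rep.{u} ℤ G} (f : A ⟶ D) (g : B ⟶ D) (z : (A ⊞ B : Rep.{u} ℤ G)) :
    (biprod.desc f g).hom z = f.hom ((biprod.fst : A ⊞ B ⟶ A).hom z) +
      g.hom ((biprod.snd : A ⊞ B ⟶ B).hom z) := by
  conv_lhs => rw [biprod_eq z]
  rw [map_add, ← comp_apply _ (biprod.desc f g), ← comp_apply _ (biprod.desc f g),
    biprod.inl_desc, biprod.inr_desc]

lemma exists_biprod {A B : Rep.{u} ℤ G} (x : A) (y : B) : ∃ z : (A ⊞ B : Rep.{u} ℤ G),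
    (biprod.fst : A ⊞ B ⟶ A).hom z = x ∧ (biprod.snd : A ⊞ B ⟶ B).hom z = y := by
  refine ⟨(biprod.inl : A ⟶ A ⊞ B).hom x + (biprod.inr : B ⟶ A ⊞ B).hom y, ?_, ?_⟩
  · rw [map_add, ← comp_apply, ← comp_apply, biprod.inl_fst, biprod.inr_fst]
    exact add_zero x
  · rw [map_add, ← comp_apply, ← comp_apply, biprod.inl_snd, biprod.inr_snd]
    exact zero_add y

lemma exists_of_bicartesianSq (sq : BicartesianSq t l r b) {y : X₂} {z : X₃}
    (h : r.hom y = b.hom z) : ∃ x, t.hom x = y ∧ l.hom x = z := by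
  obtain ⟨w, rfl, rfl⟩ := exists_biprod y z
  obtain ⟨x, rfl⟩ := exists_of_exact sq.toIsPullback.exact_shortComplex' (y := w) (by
      rw [desc_apply, h]
      exact add_neg_cancel _)
  exact ⟨x, by rw [← comp_apply, biprod.lift_fst], by rw [← comp_apply, biprod.lift_snd]⟩

lemma eq_zero_of_bicartesianSq (sq : BicartesianSq t l r b) {x : X₁}
    (h : t.hom x = 0) (h' : l.hom x = 0) : x = 0 := by
  refine (Rep.mono_iff_injective (biprod.lift t l)).1 sq.toIsPullback.mono_shortComplex'_f ?_
  rw [map_zero, biprod_eq ((biprod.lift t l).hom x), ← comp_apply (biprod.lift t l),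
    ← comp_apply (biprod.lift t l), biprod.lift_fst, biprod.lift_snd, h, h', map_zero, map_zero,
    add_zero]

lemma exists_add_of_bicartesianSq (sq : BicartesianSq t l r b) (w : X₄) :
    ∃ y z, r.hom y + b.hom z = w := by
  obtain ⟨u, hu⟩ :=
    (Rep.epi_iff_surjective (biprod.desc r b)).1 sq.toIsPushout.epi_shortComplex_g w
  exact ⟨_, _, (desc_apply r b u).symm.trans hu⟩

end Elements

end GaloisModule

namespace GaloisModule

-- `ℤ`-linear maps and bases refer to the module structure which is part of a representation.
attribute [local instance 2000] Rep.hV2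
attribute [-instance] AddCommGroup.toIntModule

variable {G : Type u} [Group G]

/-- A `G`-lattice, that is, a finitely generated torsion-free abelian group with an action of `G`,
on which the subgroup `N` of `G` acts trivially. -/
structure IsLattice (N : Subgroup G) (M : Rep.{u} ℤ G) : Prop where
  finite : Module.Finite ℤ M
  torsionFree : ∀ (n : ℤ) (x : M), n • x = 0 → n = 0 ∨ x = 0
  trivial : ∀ g ∈ N, ∀ x : M, M.ρ g x = x

lemma IsLattice.free {N : Subgroup G} {M : Rep.{u} ℤ G} (h : IsLattice N M) : Module.Free ℤ M := by
  have := h.finite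
  have : Module.IsTorsionFree ℤ M := ⟨fun n hn x y hxy => by
    have h1 : n • (x - y) = 0 := by
      rw [zsmul_sub, sub_eq_zero, ← int_smul_eq_zsmul M.hV2, ← int_smul_eq_zsmul M.hV2]
      exact hxy
    exact sub_eq_zero.1 ((h.torsionFree n _ h1).resolve_left (isRegular_iff_ne_zero.1 hn))⟩
  exact Module.free_of_finite_type_torsion_free'

lemma IsLattice.of_free {N : Subgroup G} {M : Rep.{u} ℤ G} (h1 : Module.Finite ℤ M)
    (h2 : Module.Free ℤ M) (h3 : ∀ g ∈ N, ∀ x : M, M.ρ g x = x) : IsLattice N M where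
  finite := h1
  torsionFree n x h := by
    rw [← int_smul_eq_zsmul M.hV2] at h
    exact smul_eq_zero.1 h
  trivial := h3

lemma IsLattice.dual {N : Subgroup G} {M : Rep.{u} ℤ G} (h : IsLattice N M) :
    IsLattice N (Rep.of M.ρ.dual) := by
  have := h.finite
  have := h.free
  refine .of_free (inferInstanceAs (Module.Finite ℤ (Module.Dual ℤ M)))
    (inferInstanceAs (Module.Free ℤ (Module.Dual ℤ M))) fun g hg x => ?_
  refine LinearMap.ext fun y => ?_
  change x (M.ρ g⁻¹ y) = x y
  rw [h.trivial _ (N.inv_mem hg)]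

/-- The permutation representation of `G` on `ℤ[X]`, for a `G`-set `X`. -/
def permRep (G X : Type*) [Group G] [MulAction G X] : Representation ℤ G (X →₀ ℤ) where
  toFun g := Finsupp.lmapDomain ℤ ℤ (g • ·)
  map_one' := by ext; simp
  map_mul' g h := by ext; simp [mul_smul]

lemma permRep_basisSingleOne {X : Type*} [MulAction G X] (g : G) (x : X) :
    permRep G X g (Finsupp.basisSingleOne x) = Finsupp.basisSingleOne (g • x) := by
  simp [permRep]

section Squares

variable {X₁ X₂ X₃ X₄ : Rep.{u} ℤ G}
  {t : X₁ ⟶ X₂} {l : X₁ ⟶ X₃} {r : X₂ ⟶ X₄} {b : X₃ ⟶ X₄} {N : Subgroup G}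

lemma IsLattice.of_bicartesianSq_left (sq : BicartesianSq t l r b) (h₂ : IsLattice N X₂)
    (h₃ : IsLattice N X₃) : IsLattice N X₁ where
  finite := by
    have := h₂.finite
    have := h₃.finite
    refine Module.Finite.of_injective (t.hom.toLinearMap.prod l.hom.toLinearMap) ?_
    rw [injective_iff_map_eq_zero]
    intro x hx
    exact eq_zero_of_bicartesianSq sq (Prod.mk_eq_zero.1 hx).1 (Prod.mk_eq_zero.1 hx).2
  torsionFree n x hx := by
    by_cases hn : n = 0
    · exact Or.inl hn
    · refine Or.inr (eq_zero_of_bicartesianSq sq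
        ((h₂.torsionFree n _ ?_).resolve_left hn) ((h₃.torsionFree n _ ?_).resolve_left hn))
      · rw [← map_zsmul, hx, map_zero]
      · rw [← map_zsmul, hx, map_zero]
  trivial g hg x := by
    rw [← sub_eq_zero]
    refine eq_zero_of_bicartesianSq sq ?_ ?_
    · rw [map_sub, Rep.hom_comm_apply, h₂.trivial g hg, sub_self]
    · rw [map_sub, Rep.hom_comm_apply, h₃.trivial g hg, sub_self]

/-- The pushout `X₄` is torsion-free when `l` splits as a map of abelian groups, by a retraction
`s`. -/
lemma IsLattice.of_bicartesianSq_right (sq : BicartesianSq t l r b) (h₂ : IsLattice N X₂)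
    (h₃ : IsLattice N X₃) (s : X₃ →ₗ[ℤ] X₁) (hs : ∀ x, s (l.hom x) = x) : IsLattice N X₄ where
  finite := by
    have := h₂.finite
    have := h₃.finite
    refine Module.Finite.of_surjective (r.hom.toLinearMap.coprod b.hom.toLinearMap) fun w => ?_
    obtain ⟨y, z, h⟩ := exists_add_of_bicartesianSq sq w
    exact ⟨(y, z), h⟩
  torsionFree n w hw := by
    by_cases hn : n = 0
    · exact Or.inl hn
    right
    obtain ⟨y, z, rfl⟩ := exists_add_of_bicartesianSq sq w
    have h1 : r.hom (n • y) = b.hom (-(n • z)) := by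
      rw [map_neg, ← add_eq_zero_iff_eq_neg]
      rw [map_zsmul, map_zsmul, ← zsmul_add, hw]
    obtain ⟨m, hm, hm'⟩ := exists_of_bicartesianSq sq h1
    have h2 : m = n • (-s z) := by
      rw [← hs m, hm', map_neg, map_zsmul, zsmul_neg]
    have h3 : y = t.hom (-s z) := by
      rw [← sub_eq_zero]
      refine (h₂.torsionFree n _ ?_).resolve_left hn
      rw [zsmul_sub, ← hm, h2, map_zsmul, sub_self]
    have h4 : z = l.hom (s z) := by
      rw [← sub_eq_zero]
      refine (h₃.torsionFree n _ ?_).resolve_left hn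
      rw [zsmul_sub, ← map_zsmul, ← neg_inj, neg_sub, sub_eq_add_neg, ← hm', h2, zsmul_neg,
        map_neg, add_neg_cancel, neg_zero]
    rw [h3, comm_apply sq, map_neg, ← h4, map_neg, neg_add_cancel]
  trivial g hg w := by
    obtain ⟨y, z, rfl⟩ := exists_add_of_bicartesianSq sq w
    rw [map_add, ← Rep.hom_comm_apply, ← Rep.hom_comm_apply, h₂.trivial g hg, h₃.trivial g hg]

end Squares

variable [TopologicalSpace G]

/-- The kernel of a morphism `f` of representations satisfies the condition `H1Vanishing`. -/
def H1VanishingKer {V W : Type*} [AddCommGroup V] [Module ℤ V] [AddCommGroup W] [Module ℤ W]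
    (ρ : Representation ℤ G V) (f : V →ₗ[ℤ] W) : Prop :=
  ∀ H : Subgroup G, IsOpen (H : Set G) → ∀ c : G → V,
    (∀ g ∈ H, f (c g) = 0) → (∀ g ∈ H, ∀ h ∈ H, c (g * h) = c g + ρ g (c h)) →
      ∃ v, f v = 0 ∧ ∀ g ∈ H, c g = ρ g v - v

/-- In a cartesian square of representations, `X₁ → X₃` is surjective with the same kernel as
`X₂ → X₄`, so that the vanishing of `H¹` for `X₁` follows by dévissage. -/
lemma h1Vanishing_of_isPullback {V₁ V₂ V₃ V₄ : Type*} [AddCommGroup V₁] [Module ℤ V₁]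
    [AddCommGroup V₂] [Module ℤ V₂] [AddCommGroup V₃] [Module ℤ V₃] [AddCommGroup V₄] [Module ℤ V₄]
    {ρ₁ : Representation ℤ G V₁} {ρ₂ : Representation ℤ G V₂} {ρ₃ : Representation ℤ G V₃}
    {t : V₁ →ₗ[ℤ] V₂} {l : V₁ →ₗ[ℤ] V₃} {r : V₂ →ₗ[ℤ] V₄} {b : V₃ →ₗ[ℤ] V₄}
    (ht : ∀ g x, t (ρ₁ g x) = ρ₂ g (t x)) (hl : ∀ g x, l (ρ₁ g x) = ρ₃ g (l x))
    (w : ∀ x, r (t x) = b (l x)) (hinj : ∀ x, t x = 0 → l x = 0 → x = 0)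
    (hex : ∀ y z, r y = b z → ∃ x, t x = y ∧ l x = z) (hr : Function.Surjective r)
    (hker : H1VanishingKer ρ₂ r) (h₃ : H1Vanishing ρ₃) : H1Vanishing ρ₁ := by
  intro H hH c hc
  obtain ⟨v, hv⟩ := h₃ H hH (fun g => l (c g)) (fun g hg h hh => by
    rw [hc g hg h hh, map_add, hl])
  obtain ⟨y, hy⟩ := hr (b v)
  obtain ⟨x₀, -, hx₀⟩ := hex y v hy
  obtain ⟨y', hy', hy''⟩ := hker H hH (fun g => t (c g - (ρ₁ g x₀ - x₀))) (fun g hg => by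
    rw [w, map_sub, hv g hg, map_sub l, hl, hx₀, sub_self, map_zero]) (fun g hg h hh => by
    rw [hc g hg h hh, ← ht, ← map_add, map_mul, Module.End.mul_apply, map_sub (ρ₁ g),
      map_sub (ρ₁ g)]
    congr 1
    abel)
  obtain ⟨x', hx', hx''⟩ := hex y' 0 (by rw [hy', map_zero])
  refine ⟨x₀ + x', fun g hg => ?_⟩
  have h1 := hy'' g hg
  rw [← hx', ← ht, ← map_sub, ← sub_eq_zero, ← map_sub] at h1
  have h2 := hinj _ h1 (by
    rw [map_sub, map_sub, map_sub, map_sub, hv g hg, hl, hl, hx₀, hx'', map_zero, sub_self,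
      sub_self, sub_zero])
  rw [← sub_eq_zero, ← h2, map_add]
  abel

/-! ### Covers and embeddings of lattices -/

/-- A lattice `M` is covered by a permutation lattice, on the set `X` of conjugates of generators of
the groups of invariants `M ^ H`. As `ℤ[X] ^ H → M ^ H` is surjective for any `H`, the group `H¹` of
the kernel embeds in that of `ℤ[X]`. -/
theorem IsLattice.exists_cover [IsTopologicalGroup G] [CompactSpace G] [T2Space G]
    {N : Subgroup G} (hN : IsOpen (N : Set G)) {M : Rep.{u} ℤ G} (hM : IsLattice N M) :
    ∃ (P : Rep.{u} ℤ G) (p : P ⟶ M), IsPermutation P ∧ IsLattice N P ∧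
      Function.Surjective p.hom ∧ H1VanishingKer P.ρ p.hom.toLinearMap := by
  have := hM.finite
  -- the action factors through a finite set of endomorphisms
  have hfin : Finite (Set.range M.ρ) := by
    have : Finite (G ⧸ N) := N.quotient_finite_of_isOpen hN
    let f : G ⧸ N → (M →ₗ[ℤ] M) := fun x => M.ρ x.out
    refine Set.Finite.subset (Set.finite_range f) ?_
    rintro _ ⟨g, rfl⟩
    refine ⟨g, LinearMap.ext fun x => ?_⟩
    obtain ⟨n, hn⟩ := QuotientGroup.mk_out_eq_mul N g
    change M.ρ ((g : G ⧸ N).out) x = _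
    rw [hn, map_mul, Module.End.mul_apply, hM.trivial _ n.2]
  -- the elements fixed by a set `S` of endomorphisms, and a finite set of generators of this group
  let I (S : Set (Set.range M.ρ)) : Submodule ℤ M :=
    { carrier := {x | ∀ f ∈ S, f.1 x = x}
      zero_mem' := fun f _ => map_zero f.1
      add_mem' := fun hx hy f hf => by rw [map_add, hx f hf, hy f hf]
      smul_mem' := fun n x hx f hf => by rw [LinearMap.map_smul, hx f hf] }
  have hI (S) : ∃ T : Finset M, Submodule.span ℤ T = I S :=
    (IsNoetherian.noetherian (I S))
  choose T hT using hI
  let X : Set M := Set.image2 (fun f x => f x) (Set.range M.ρ) (⋃ S, (T S : Set M))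
  have hX : X.Finite :=
    Set.Finite.image2 _ hfin (Set.finite_iUnion fun S => (T S).finite_toSet)
  have hTX (S) (x) (hx : x ∈ T S) : x ∈ X :=
    ⟨M.ρ 1, ⟨1, rfl⟩, x, Set.mem_iUnion.2 ⟨S, hx⟩, by simp⟩
  have : Finite X := hX
  let : MulAction G X :=
    { smul := fun g x => ⟨M.ρ g x, by
        obtain ⟨_, ⟨h, rfl⟩, y, hy, hx⟩ := x.2
        refine ⟨M.ρ (g * h), ⟨_, rfl⟩, y, hy, ?_⟩
        rw [map_mul]
        exact congrArg (M.ρ g) hx⟩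
      one_smul := fun x => Subtype.ext (by change M.ρ 1 x.1 = x.1; simp)
      mul_smul := fun g h x => Subtype.ext (by
        change M.ρ (g * h) x.1 = M.ρ g (M.ρ h x.1); simp) }
  have hsmul (g : G) (x : X) : (g • x).1 = M.ρ g x.1 := rfl
  have hst (x : X) : N ≤ MulAction.stabilizer G x := fun g hg =>
    Subtype.ext (hM.trivial g hg x.1)
  let ρ := permRep G X
  let b : Module.Basis X ℤ (X →₀ ℤ) := Finsupp.basisSingleOne
  have hb (g : G) (x : X) : ρ g (b x) = b (g • x) := permRep_basisSingleOne g x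
  have ho (x : X) : IsOpen (MulAction.stabilizer G x : Set G) :=
    Subgroup.isOpen_mono (hst x) hN
  let p : Rep.of ρ ⟶ M := Rep.ofHom (σ := M.ρ) (ρ := ρ)
    ⟨b.constr ℕ fun x => x.1, fun g => b.ext fun x => by
      change b.constr ℕ _ (ρ g (b x)) = M.ρ g (b.constr ℕ _ (b x))
      rw [hb, b.constr_basis, b.constr_basis, hsmul]⟩
  have hp (x : X) : p.hom (b x) = x.1 := b.constr_basis ℕ _ x
  -- elements of `M` fixed by `S` lift to elements of `ℤ[X]` fixed by `S`
  have hlift (S : Set (Set.range M.ρ)) (m : M) (hm : m ∈ I S) :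
      ∃ y : X →₀ ℤ, p.hom y = m ∧ ∀ g, (⟨M.ρ g, g, rfl⟩ : Set.range M.ρ) ∈ S → ρ g y = y := by
    rw [← hT] at hm
    induction hm using Submodule.span_induction with
    | zero => exact ⟨0, map_zero _, fun _ _ => map_zero _⟩
    | add x y _ _ hx hy =>
      obtain ⟨x', hx', hx⟩ := hx
      obtain ⟨y', hy', hy⟩ := hy
      exact ⟨x' + y', by rw [map_add, hx', hy'], fun g hg => by rw [map_add, hx g hg, hy g hg]⟩
    | smul n x _ hx =>
      obtain ⟨x', rfl, hx⟩ := hx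
      exact ⟨n • x', p.hom.toLinearMap.map_smul n x', fun g hg => by rw [LinearMap.map_smul, hx g hg]⟩
    | mem x hx =>
      refine ⟨b ⟨x, hTX S x hx⟩, hp _, fun g hg => ?_⟩
      rw [hb]
      congr 1
      have : x ∈ I S := hT S ▸ Submodule.subset_span hx
      exact Subtype.ext (this _ hg)
  refine ⟨Rep.of ρ, p, isPermutation_of_basis b hb ho,
    .of_free (inferInstanceAs (Module.Finite ℤ (X →₀ ℤ)))
      (inferInstanceAs (Module.Free ℤ (X →₀ ℤ))) fun g hg => ?_, fun m => ?_, ?_⟩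
  · have : ρ g = LinearMap.id := b.ext fun x => by
      rw [hb, MulAction.mem_stabilizer_iff.1 (hst x hg)]
      rfl
    exact LinearMap.congr_fun this
  · obtain ⟨y, hy, -⟩ := hlift ∅ m (fun f hf => absurd hf (Set.notMem_empty _))
    exact ⟨y, hy⟩
  · intro H hH c hpc hc
    obtain ⟨v, hv⟩ := h1Vanishing_of_basis b hb ho H hH c hc
    obtain ⟨y, hy, hy'⟩ := hlift {f | ∃ h ∈ H, M.ρ h = f.1} (p.hom v) (by
      rintro f ⟨h, hh, hf⟩
      have h1 : p.hom (c h) = 0 := hpc h hh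
      rw [hv h hh, map_sub, sub_eq_zero] at h1
      rw [← hf]
      exact (Rep.hom_comm_apply p h v).symm.trans h1)
    refine ⟨v - y, ?_, fun g hg => ?_⟩
    · change p.hom (v - y) = 0
      rw [map_sub, hy, sub_self]
    · have := hy' g ⟨g, hg, rfl⟩
      change c g = ρ g (v - y) - (v - y)
      rw [hv g hg, map_sub, this]
      abel_nf

end GaloisModule

namespace GaloisModule

-- `ℤ`-linear maps and bases refer to the module structure which is part of a representation.
attribute [local instance 2000] Rep.hV2
attribute [-instance] AddCommGroup.toIntModule

variable {G : Type u} [Group G] [TopologicalSpace G]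

lemma IsPermutation.dual {P : Rep.{u} ℤ G} (hP : IsPermutation P) :
    IsPermutation (Rep.of P.ρ.dual) := by
  classical
  obtain ⟨n, _, b, hb, ho⟩ := hP.exists_mulAction
  refine isPermutation_of_basis (M := Rep.of P.ρ.dual) b.dualBasis (fun g x => ?_) ho
  refine b.ext fun y => ?_
  change b.dualBasis x (P.ρ g⁻¹ (b y)) = b.dualBasis (g • x) (b y)
  rw [hb, b.dualBasis_apply_self, b.dualBasis_apply_self]
  simp [inv_smul_eq_iff]

variable [IsTopologicalGroup G] [CompactSpace G] [T2Space G] {N : Subgroup G}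

/-- A lattice embeds in a permutation lattice, as a direct factor as an abelian group, so that `H¹`
of the dual of the quotient vanishes. This is dual to `IsLattice.exists_cover`. -/
theorem IsLattice.exists_embedding (hN : IsOpen (N : Set G)) {M : Rep.{u} ℤ G}
    (hM : IsLattice N M) :
    ∃ (Q : Rep.{u} ℤ G) (i : M ⟶ Q) (s : Q →ₗ[ℤ] M), IsPermutation Q ∧ IsLattice N Q ∧
      (∀ x, s (i.hom x) = x) ∧ H1VanishingKer Q.ρ.dual i.hom.toLinearMap.dualMap := by
  obtain ⟨P, p, hP, hP', hp, hker⟩ := hM.dual.exists_cover hN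
  have := hM.finite
  have := hM.free
  have := hP'.finite
  have := hP'.free
  have : Module.Free ℤ (Rep.of M.ρ.dual) := inferInstanceAs (Module.Free ℤ (Module.Dual ℤ M))
  obtain ⟨l, hl⟩ := Module.projective_lifting_property p.hom.toLinearMap LinearMap.id hp
  have hpg (g : G) (x : P) (m : M) : (show Module.Dual ℤ M from p.hom (P.ρ g x)) m =
      (show Module.Dual ℤ M from p.hom x) (M.ρ g⁻¹ m) :=
    LinearMap.congr_fun (Rep.hom_comm_apply p g x) m
  let pl : P →ₗ[ℤ] Module.Dual ℤ M := p.hom.toLinearMap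
  let ll : Module.Dual ℤ M →ₗ[ℤ] P := l
  let i : M ⟶ Rep.of P.ρ.dual := Rep.ofHom (σ := P.ρ.dual) (ρ := M.ρ)
    ⟨pl.flip, fun g => LinearMap.ext fun m => LinearMap.ext fun x => by
      have := hpg g⁻¹ x m
      rw [inv_inv] at this
      exact this.symm⟩
  refine ⟨Rep.of P.ρ.dual, i, (Module.evalEquiv ℤ M).symm.toLinearMap ∘ₗ ll.dualMap,
    hP.dual, hP'.dual, fun x => ?_, ?_⟩
  · change (Module.evalEquiv ℤ M).symm (ll.dualMap (pl.flip x)) = x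
    rw [LinearEquiv.symm_apply_eq]
    refine LinearMap.ext fun f => ?_
    change pl (ll f) x = f x
    exact LinearMap.congr_fun (LinearMap.congr_fun hl f) x
  · intro H hH c hc hc'
    let e := Module.evalEquiv ℤ P
    have he (x : P) (f : Module.Dual ℤ P) : e x f = f x := rfl
    have heg (g : G) (x : P) : e (P.ρ g x) = P.ρ.dual.dual g (e x) := by
      refine LinearMap.ext fun f => ?_
      change f (P.ρ g x) = f (P.ρ g⁻¹⁻¹ x)
      rw [inv_inv]
    have hec (x : P) (hx : i.hom.toLinearMap.dualMap (e x) = 0) : p.hom x = 0 :=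
      hx
    obtain ⟨v, hv, hv'⟩ := hker H hH (fun g => e.symm (c g))
      (fun g hg => hec _ (by rw [e.apply_symm_apply]; exact hc g hg))
      (fun g hg h hh => e.injective (by
        rw [e.apply_symm_apply, map_add, heg, e.apply_symm_apply, e.apply_symm_apply]
        exact hc' g hg h hh))
    refine ⟨e v, hv, fun g hg => ?_⟩
    have := congrArg e (hv' g hg)
    rw [e.apply_symm_apply, map_sub, heg] at this
    exact this

/-- A morphism `φ` of lattices is quasi-isomorphic, through two bicartesian squares, to a morphism
`X ⟶ Y` where `X` is coflasque and `Y` a permutation lattice: replace the source by a permutation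
lattice that contains it, and then pull back along a cover of the target. -/
theorem exists_coflasque_bicartesianSq (hN : IsOpen (N : Set G)) {M₁ M₂ : Rep.{u} ℤ G}
    (h₁ : IsLattice N M₁) (h₂ : IsLattice N M₂) (φ : M₂ ⟶ M₁) :
    ∃ (X Y A B : Rep.{u} ℤ G) (ψ : X ⟶ Y) (k : A ⟶ B) (j : M₂ ⟶ A) (i : M₁ ⟶ B) (j' : X ⟶ A)
      (i' : Y ⟶ B), BicartesianSq φ j i k ∧ BicartesianSq ψ j' i' k ∧
        IsLattice N X ∧ IsLattice N Y ∧ IsCoflasque X ∧ IsPermutation Y := by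
  obtain ⟨A, j, s, hA, hA', hs, -⟩ := h₂.exists_embedding hN
  have hj : Mono j := (Rep.mono_iff_injective j).2 (Function.LeftInverse.injective hs)
  have sq := bicartesianSq_of_isPushout_of_mono (IsPushout.of_hasPushout φ j) hj
  have hB := IsLattice.of_bicartesianSq_right sq h₁ hA' s hs
  obtain ⟨Y, p, hY, hY', hp, hker⟩ := hB.exists_cover hN
  have sq' := bicartesianSq_of_isPullback_of_epi (IsPullback.of_hasPullback p (pushout.inr φ j))
    ((Rep.epi_iff_surjective p).2 hp)
  refine ⟨_, Y, A, _, _, _, j, _, _, p, sq, sq', .of_bicartesianSq_left sq' hY' hA', hY', ?_, hY⟩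
  refine isCoflasque_of_h1Vanishing (h1Vanishing_of_isPullback
    (Rep.hom_comm_apply _) (Rep.hom_comm_apply _) (comm_apply sq')
    (fun _ => eq_zero_of_bicartesianSq sq') (fun _ _ => exists_of_bicartesianSq sq') hp hker
    hA.h1Vanishing)

/-- A morphism `φ` of lattices is quasi-isomorphic, through two bicartesian squares, to a morphism
`X ⟶ Y` where `X` is a permutation lattice and `Y` is flasque: pull back along a cover of the target,
and then replace the source by a permutation lattice that contains it. -/
theorem exists_flasque_bicartesianSq (hN : IsOpen (N : Set G)) {M₁ M₂ : Rep.{u} ℤ G}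
    (h₁ : IsLattice N M₁) (h₂ : IsLattice N M₂) (φ : M₂ ⟶ M₁) :
    ∃ (X Y A B : Rep.{u} ℤ G) (ψ : X ⟶ Y) (k : A ⟶ B) (j : A ⟶ M₂) (i : B ⟶ M₁) (j' : A ⟶ X)
      (i' : B ⟶ Y), BicartesianSq k j i φ ∧ BicartesianSq k j' i' ψ ∧
        IsLattice N X ∧ IsLattice N Y ∧ IsPermutation X ∧ IsFlasque Y := by
  obtain ⟨B, p, hB, hB', hp, -⟩ := h₁.exists_cover hN
  have sq := bicartesianSq_of_isPullback_of_epi (IsPullback.of_hasPullback p φ)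
    ((Rep.epi_iff_surjective p).2 hp)
  have hA := IsLattice.of_bicartesianSq_left sq hB' h₂
  obtain ⟨X, i, s, hX, hX', hs, hker⟩ := hA.exists_embedding hN
  have hi : Mono i := (Rep.mono_iff_injective i).2 (Function.LeftInverse.injective hs)
  have sq' := bicartesianSq_of_isPushout_of_mono (IsPushout.of_hasPushout (pullback.fst p φ) i) hi
  have hY := IsLattice.of_bicartesianSq_right sq' hB' hX' s hs
  refine ⟨X, _, _, B, _, _, _, p, i, _, sq, sq', hX', hY, hX, ?_⟩
  have := hY.free
  refine isFlasque_of_h1Vanishing_dual this ?_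
  -- the dual of the pushout square is a pullback square
  have hB'' : H1Vanishing B.ρ.dual := hB.dual.h1Vanishing
  have hdual {V W : Rep.{u} ℤ G} (f : V ⟶ W) (g : G) (x : Module.Dual ℤ W) :
      f.hom.toLinearMap.dualMap (W.ρ.dual g x) = V.ρ.dual g (f.hom.toLinearMap.dualMap x) := by
    refine LinearMap.ext fun m => ?_
    change x (W.ρ g⁻¹ (f.hom m)) = x (f.hom (V.ρ g⁻¹ m))
    rw [Rep.hom_comm_apply]
  refine h1Vanishing_of_isPullback (hdual (pushout.inr _ _)) (hdual (pushout.inl _ _))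
    (r := i.hom.toLinearMap.dualMap) (b := (pullback.fst p φ).hom.toLinearMap.dualMap)
    (fun x => LinearMap.ext fun m => congrArg x (comm_apply sq' m).symm)
    (fun x h h' => LinearMap.ext fun w => ?_) (fun y z h => ?_)
    (fun f => ⟨f ∘ₗ s, LinearMap.ext fun x => congrArg f (hs x)⟩) hker hB''
  · obtain ⟨y, z, rfl⟩ := exists_add_of_bicartesianSq sq' w
    rw [map_add]
    exact (congrArg₂ _ (LinearMap.congr_fun h' y) (LinearMap.congr_fun h z)).trans (add_zero _)
  · -- a functional on `B × X` which kills the kernel of the surjection to the pushout descends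
    obtain ⟨l, hl⟩ := Module.projective_lifting_property
      ((pushout.inl (pullback.fst p φ) i).hom.toLinearMap.coprod
        (pushout.inr (pullback.fst p φ) i).hom.toLinearMap) LinearMap.id (fun w => by
          obtain ⟨y, z, h⟩ := exists_add_of_bicartesianSq sq' w
          exact ⟨(y, z), h⟩)
    have hl' (w) : (pushout.inl (pullback.fst p φ) i).hom (l w).1 +
      (pushout.inr (pullback.fst p φ) i).hom (l w).2 = w := LinearMap.congr_fun hl w
    have key (w) (u : B) (v : X) (h' : (pushout.inl (pullback.fst p φ) i).hom u +
        (pushout.inr (pullback.fst p φ) i).hom v = w) : z (l w).1 + y (l w).2 = z u + y v := by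
      have h1 : (pushout.inl (pullback.fst p φ) i).hom (u - (l w).1) =
          (pushout.inr (pullback.fst p φ) i).hom ((l w).2 - v) := by
        rw [map_sub, map_sub, sub_eq_sub_iff_add_eq_add, h', add_comm, hl']
      obtain ⟨a, ha, ha'⟩ := exists_of_bicartesianSq sq' h1
      have h2 : y (i.hom a) = z ((pullback.fst p φ).hom a) := LinearMap.congr_fun h a
      rw [ha, ha', map_sub, map_sub] at h2
      linarith
    refine ⟨(z.coprod y) ∘ₗ l, LinearMap.ext fun v => ?_, LinearMap.ext fun u => ?_⟩
    · exact (key _ 0 v (by rw [map_zero, zero_add]; rfl)).trans (by rw [map_zero, zero_add])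
    · exact (key _ u 0 (by rw [map_zero, add_zero]; rfl)).trans (by rw [map_zero, add_zero])

end GaloisModule

/-! ### Galois descent -/

namespace Torus

variable {F K : Type u} [Field F] [Field K] [Algebra F K]

section Descent

variable {C D D' : Type u} [CommRing C] [Algebra F C] [CommRing D] [Algebra F D]
  [CommRing D'] [Algebra F D']

/-- The action of `σ` on `K ⊗ C` through the first factor, for a commutative algebra `C`. -/
def galTensor (C : Type u) [CommRing C] [Algebra F C] (σ : K ≃ₐ[F] K) :
    K ⊗[F] C →ₐ[F] K ⊗[F] C :=
  Algebra.TensorProduct.map (σ : K →ₐ[F] K) (AlgHom.id F C)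

variable (K) in
/-- The homomorphism `K ⊗ C → K ⊗ D` deduced from `f : C → D`. -/
def extend (f : C →ₐ[F] D) : K ⊗[F] C →ₐ[K] K ⊗[F] D :=
  Algebra.TensorProduct.map (AlgHom.id K K) f

lemma galTensor_tmul (σ : K ≃ₐ[F] K) (s : K) (a : C) :
    galTensor C σ (s ⊗ₜ a) = σ s ⊗ₜ a := rfl

lemma extend_tmul (f : C →ₐ[F] D) (s : K) (a : C) : extend K f (s ⊗ₜ a) = s ⊗ₜ f a := rfl

lemma galTensor_extend (σ : K ≃ₐ[F] K) (f : C →ₐ[F] D) (x : K ⊗[F] C) :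
    galTensor D σ (extend K f x) = extend K f (galTensor C σ x) := by
  induction x with
  | zero => simp
  | add x y hx hy => simp only [map_add, hx, hy]
  | tmul s a => rfl

lemma galTensor_smul (σ : K ≃ₐ[F] K) (s : K) (x : K ⊗[F] C) :
    galTensor C σ (s • x) = σ s • galTensor C σ x := by
  rw [Algebra.smul_def, map_mul, Algebra.smul_def]
  rfl

lemma extend_comp (g : D →ₐ[F] D') (f : C →ₐ[F] D) (x : K ⊗[F] C) :
    extend K (g.comp f) x = extend K g (extend K f x) := by
  induction x with
  | zero => simp
  | add x y hx hy => simp only [map_add, hx, hy]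
  | tmul s a => rfl

lemma extend_id (x : K ⊗[F] C) : extend K (AlgHom.id F C) x = x := by
  induction x with
  | zero => simp
  | add x y hx hy => simp only [map_add, hx, hy]
  | tmul s a => rfl

lemma one_tmul_injective : Function.Injective fun c : C => (1 : K) ⊗ₜ[F] c :=
  Algebra.TensorProduct.includeRight_injective (FaithfulSMul.algebraMap_injective F K)

lemma map_injective {E : Type*} [Field E] [Algebra F E] (φ : E →ₐ[F] K) :
    Function.Injective (Algebra.TensorProduct.map φ (AlgHom.id F C)) :=
  Module.Flat.rTensor_preserves_injective_linearMap φ.toLinearMap φ.injective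

lemma galTensor_map {E : Type*} [Field E] [Algebra F E] (φ : E →ₐ[F] K) (σ : K ≃ₐ[F] K)
    (x : E ⊗[F] C) : galTensor C σ (Algebra.TensorProduct.map φ (AlgHom.id F C) x) =
      Algebra.TensorProduct.map ((σ : K →ₐ[F] K).comp φ) (AlgHom.id F C) x := by
  induction x with
  | zero => simp
  | add x y hx hy => simp only [map_add, hx, hy]
  | tmul s a => rfl

lemma baseChange_repr_galTensor {ι : Type*} (b : Module.Basis ι F C) (σ : K ≃ₐ[F] K)
    (x : K ⊗[F] C) (i : ι) :
    (b.baseChange K).repr (galTensor C σ x) i = σ ((b.baseChange K).repr x i) := by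
  induction x with
  | zero => simp
  | add x y hx hy => simp only [map_add, Finsupp.add_apply, hx, hy]
  | tmul s a =>
    rw [galTensor_tmul, Module.Basis.baseChange_repr_tmul, Module.Basis.baseChange_repr_tmul,
      map_smul]

/-- Galois descent for elements: the elements of `K ⊗ C` fixed by the automorphisms of `K` over `E`
are those of `E ⊗ C`. -/
theorem exists_map_eq_of_fixed [IsGalois F K] {E : Type*} [Field E] [Algebra F E]
    (φ : E →ₐ[F] K) (y : K ⊗[F] C)
    (h : ∀ σ : K ≃ₐ[F] K, (∀ x, σ (φ x) = φ x) → galTensor C σ y = y) :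
    ∃ z : E ⊗[F] C, Algebra.TensorProduct.map φ (AlgHom.id F C) z = y := by
  let b := Module.Basis.ofVectorSpace F C
  let bK := b.baseChange K
  have hrepr (σ : K ≃ₐ[F] K) (x : K ⊗[F] C) (i) : bK.repr (galTensor C σ x) i = σ (bK.repr x i) :=
    baseChange_repr_galTensor b σ x i
  have hmem (i) : ∃ e : E, φ e = bK.repr y i := by
    have : bK.repr y i ∈ IntermediateField.fixedField φ.fieldRange.fixingSubgroup := by
      rw [IntermediateField.mem_fixedField_iff]
      intro σ hσ
      rw [← hrepr, h σ fun x => ?_]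
      exact (IntermediateField.mem_fixingSubgroup_iff _ _).1 hσ _ ⟨x, rfl⟩
    rw [InfiniteGalois.fixedField_fixingSubgroup] at this
    exact this
  choose e he using hmem
  refine ⟨∑ i ∈ (bK.repr y).support, e i ⊗ₜ b i, ?_⟩
  conv_rhs => rw [← bK.linearCombination_repr y, Finsupp.linearCombination_apply, Finsupp.sum]
  rw [map_sum]
  refine Finset.sum_congr rfl fun i _ => ?_
  rw [Algebra.TensorProduct.map_tmul, he, Module.Basis.baseChange_apply, TensorProduct.smul_tmul',
    smul_eq_mul, mul_one]
  rfl

lemma exists_one_tmul_eq_of_fixed [IsGalois F K] (y : K ⊗[F] C)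
    (h : ∀ σ : K ≃ₐ[F] K, galTensor C σ y = y) : ∃ c : C, 1 ⊗ₜ c = y := by
  obtain ⟨z, rfl⟩ := exists_map_eq_of_fixed (Algebra.ofId F K) y fun σ _ => h σ
  obtain ⟨c, rfl⟩ := (TensorProduct.lid F C).symm.surjective z
  exact ⟨c, by simp⟩

/-- Galois descent for homomorphisms of algebras. -/
theorem exists_extend_eq [IsGalois F K] (f : K ⊗[F] C →ₐ[K] K ⊗[F] D)
    (h : ∀ σ x, galTensor D σ (f x) = f (galTensor C σ x)) : ∃ g : C →ₐ[F] D, extend K g = f := by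
  have hg (c : C) : ∃ d : D, 1 ⊗ₜ d = f (1 ⊗ₜ c) :=
    exists_one_tmul_eq_of_fixed _ fun σ => by rw [h, galTensor_tmul, map_one]
  choose g hg using hg
  let i : D →ₐ[F] K ⊗[F] D := Algebra.TensorProduct.includeRight
  have hi : Function.Injective i := one_tmul_injective
  have hi' (c) : i (g c) = (f.restrictScalars F) (Algebra.TensorProduct.includeRight c) := hg c
  refine ⟨{ toFun := g
            map_one' := hi (by rw [hi', map_one, map_one, map_one])
            map_mul' := fun a b => hi (by rw [map_mul, hi', hi', hi', map_mul, map_mul])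
            map_zero' := hi (by rw [hi', map_zero, map_zero, map_zero])
            map_add' := fun a b => hi (by rw [map_add, hi', hi', hi', map_add, map_add])
            commutes' := fun r => hi (by rw [hi', AlgHom.commutes, AlgHom.commutes,
              AlgHom.commutes]) }, AlgHom.ext fun x => ?_⟩
  induction x with
  | zero => simp
  | add x y hx hy => simp only [map_add, hx, hy]
  | tmul s a =>
    rw [extend_tmul, ← mul_one s, ← smul_eq_mul, ← TensorProduct.smul_tmul',
      ← TensorProduct.smul_tmul', map_smul, ← hg]
    rfl

end Descent

section Diagonal

variable {M : Type u} [AddCommGroup M]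

/-- The representation `ρ` of the Galois group on `M` and the homomorphism `u` from `M` to the units
of `K ⊗ A` exhibit the algebra `A` as a form of the group algebra of `M`: the elements `u m` form a
basis of `K ⊗ A` over `K`, which the Galois group permutes as it does the elements of `M`. -/
structure IsDiagonal (ρ : Representation ℤ (K ≃ₐ[F] K) M) {A : Type u} [CommRing A] [Algebra F A]
    (u : Multiplicative M →* K ⊗[F] A) : Prop where
  galTensor_apply : ∀ σ m, galTensor A σ (u (.ofAdd m)) = u (.ofAdd (ρ σ m))
  bijective : Function.Bijective (AddMonoidAlgebra.lift K (K ⊗[F] A) M u)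

variable {ρ : Representation ℤ (K ≃ₐ[F] K) M} {A : Type u} [CommRing A] [Algebra F A]
  {C D : Type u} [CommRing C] [Algebra F C] [CommRing D] [Algebra F D]
  {u : Multiplicative M →* K ⊗[F] A}

lemma IsDiagonal.induction (h : IsDiagonal ρ u) {p : K ⊗[F] A → Prop} (x : K ⊗[F] A)
    (hu : ∀ m, p (u m)) (hadd : ∀ x y, p x → p y → p (x + y))
    (hsmul : ∀ (s : K) x, p x → p (s • x)) : p x := by
  obtain ⟨x, rfl⟩ := h.bijective.2 x
  induction x using AddMonoidAlgebra.induction_on with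
  | of m => simpa using hu (.ofAdd m)
  | add x y hx hy => rw [map_add]; exact hadd _ _ hx hy
  | smul s x hx => rw [map_smul]; exact hsmul _ _ hx

lemma IsDiagonal.algHom_ext (h : IsDiagonal ρ u) {f g : A →ₐ[F] C}
    (hfg : ∀ m, extend K f (u m) = extend K g (u m)) : f = g := by
  refine AlgHom.ext fun a => one_tmul_injective (F := F) (K := K) ?_
  change extend K f (1 ⊗ₜ a) = extend K g (1 ⊗ₜ a)
  exact h.induction (p := fun x => extend K f x = extend K g x) _ hfg
    (fun x y hx hy => by rw [map_add, map_add, hx, hy])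
    (fun s x hx => by rw [map_smul, map_smul, hx])

/-- Homomorphisms of algebras `A → C`, where `A` is a form of the group algebra of `M`, are
equivariant homomorphisms from `M` to the units of `K ⊗ C`. -/
theorem IsDiagonal.exists_algHom [IsGalois F K] (h : IsDiagonal ρ u)
    (v : Multiplicative M →* K ⊗[F] C)
    (hv : ∀ σ m, galTensor C σ (v (.ofAdd m)) = v (.ofAdd (ρ σ m))) :
    ∃ f : A →ₐ[F] C, ∀ m, extend K f (u m) = v m := by
  let e := AlgEquiv.ofBijective _ h.bijective
  have he (m) : e.symm (u m) = AddMonoidAlgebra.single m.toAdd 1 := by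
    rw [AlgEquiv.symm_apply_eq]
    change u m = AddMonoidAlgebra.lift K (K ⊗[F] A) M u _
    rw [AddMonoidAlgebra.lift_single, one_smul]
    rfl
  let f := (AddMonoidAlgebra.lift K (K ⊗[F] C) M v).comp e.symm.toAlgHom
  have hf (m) : f (u m) = v m := by
    change AddMonoidAlgebra.lift K (K ⊗[F] C) M v (e.symm (u m)) = v m
    rw [he, AddMonoidAlgebra.lift_single, one_smul]
    rfl
  obtain ⟨g, hg⟩ := exists_extend_eq f fun σ x => by
    refine h.induction (p := fun x => galTensor C σ (f x) = f (galTensor A σ x)) x (fun m => ?_)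
      (fun x y hx hy => by simp only [map_add, hx, hy])
      (fun s x hx => by rw [map_smul, galTensor_smul, galTensor_smul, map_smul, hx])
    rw [hf]
    refine (hv σ m.toAdd).trans ?_
    rw [← hf, ← h.galTensor_apply]
    rfl
  exact ⟨g, fun m => by rw [hg, hf]⟩

end Diagonal

end Torus

namespace Torus

variable {F K : Type u} [Field F] [Field K] [Algebra F K]

/-- A subspace of `K ⊗ C` which is stable under the Galois group and contains no nonzero element
of `C` is zero: a nonzero element with as few coordinates as possible, one of them equal to `1`,
would be invariant. -/
lemma eq_zero_of_mem_of_galTensor_mem [IsGalois F K] {C : Type u} [CommRing C] [Algebra F C]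
    (S : Submodule K (K ⊗[F] C)) (hS : ∀ σ, ∀ x ∈ S, galTensor C σ x ∈ S)
    (h0 : ∀ c : C, (1 : K) ⊗ₜ[F] c ∈ S → c = 0) {y : K ⊗[F] C} (hy : y ∈ S) : y = 0 := by
  classical
  let b := Module.Basis.ofVectorSpace F C
  let bK := b.baseChange K
  have hrepr (σ : K ≃ₐ[F] K) (x : K ⊗[F] C) (i) : bK.repr (galTensor C σ x) i = σ (bK.repr x i) :=
    baseChange_repr_galTensor b σ x i
  induction hn : (bK.repr y).support.card using Nat.strong_induction_on generalizing y with
  | _ n ih =>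
    by_contra hy0
    obtain ⟨i, hi⟩ : ∃ i, bK.repr y i ≠ 0 := by
      by_contra! h
      exact hy0 (bK.repr.injective (by rw [map_zero]; exact Finsupp.ext h))
    obtain ⟨y', hy'⟩ : ∃ y', y' = (bK.repr y i)⁻¹ • y := ⟨_, rfl⟩
    have hy'S : y' ∈ S := hy' ▸ S.smul_mem _ hy
    have hy'i : bK.repr y' i = 1 := by
      rw [hy', map_smul, Finsupp.smul_apply, smul_eq_mul, inv_mul_cancel₀ hi]
    have hfix (σ : K ≃ₐ[F] K) : galTensor C σ y' = y' := by
      rw [← sub_eq_zero]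
      refine ih _ ?_ (S.sub_mem (hS σ _ hy'S) hy'S) rfl
      rw [← hn]
      refine Finset.card_lt_card ((Finset.ssubset_iff_of_subset fun j hj => ?_).2
        ⟨i, Finsupp.mem_support_iff.2 hi, ?_⟩)
      · rw [Finsupp.mem_support_iff] at hj ⊢
        refine fun h => hj ?_
        have : bK.repr y' j = 0 := by rw [hy', map_smul, Finsupp.smul_apply, h, smul_zero]
        rw [map_sub, Finsupp.sub_apply, hrepr, this, map_zero, sub_zero]
      · rw [Finsupp.notMem_support_iff, map_sub, Finsupp.sub_apply, hrepr, hy'i, map_one, sub_self]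
    obtain ⟨c, hc⟩ := exists_one_tmul_eq_of_fixed y' hfix
    rw [h0 c (hc ▸ hy'S), TensorProduct.tmul_zero] at hc
    rw [← hc, map_zero] at hy'i
    exact zero_ne_one hy'i

section Invariants

variable {M : Type u} [AddCommGroup M] (ρ : Representation ℤ (K ≃ₐ[F] K) M)

/-- The semilinear action of the Galois group on the group algebra `K[M]`, through its actions
on `K` and on `M`. -/
def galGroupAlgebra (σ : K ≃ₐ[F] K) : AddMonoidAlgebra K M →+* AddMonoidAlgebra K M :=
  (AddMonoidAlgebra.mapRingHom M (σ : K →+* K)).comp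
    (AddMonoidAlgebra.mapDomainRingHom K (ρ σ : M →+ M))

lemma galGroupAlgebra_single (σ : K ≃ₐ[F] K) (m : M) (s : K) :
    galGroupAlgebra ρ σ (.single m s) = .single (ρ σ m) (σ s) := by
  simp [galGroupAlgebra]

/-- The algebra over `F` of the invariants of the Galois group in `K[M]`. -/
def invariants : Subalgebra F (AddMonoidAlgebra K M) where
  carrier := {x | ∀ σ, galGroupAlgebra ρ σ x = x}
  mul_mem' hx hy σ := by rw [map_mul, hx, hy]
  add_mem' hx hy σ := by rw [map_add, hx, hy]
  algebraMap_mem' r σ := by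
    change galGroupAlgebra ρ σ (.single 0 (algebraMap F K r)) = .single 0 (algebraMap F K r)
    rw [galGroupAlgebra_single, map_zero, AlgEquiv.commutes]

/-- The homomorphism from `K ⊗ K[M]ᴳ` to `K[M]`. -/
def ofInvariants : K ⊗[F] invariants ρ →ₐ[K] AddMonoidAlgebra K M :=
  Algebra.TensorProduct.lift (Algebra.ofId K _) (invariants ρ).val fun _ _ => mul_comm _ _

variable {ρ}

lemma ofInvariants_tmul (s : K) (a : invariants ρ) :
    ofInvariants ρ (s ⊗ₜ a) = .single 0 s * a := rfl

lemma ofInvariants_one_tmul (a : invariants ρ) : ofInvariants ρ (1 ⊗ₜ a) = a := by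
  rw [ofInvariants_tmul]
  exact one_mul _

lemma ofInvariants_galTensor (σ : K ≃ₐ[F] K) (x : K ⊗[F] invariants ρ) :
    ofInvariants ρ (galTensor _ σ x) = galGroupAlgebra ρ σ (ofInvariants ρ x) := by
  induction x with
  | zero => simp
  | add x y hx hy => simp only [map_add, hx, hy]
  | tmul s a =>
    rw [galTensor_tmul]
    rw [ofInvariants_tmul, ofInvariants_tmul, map_mul, galGroupAlgebra_single, map_zero, a.2 σ]

/-- Galois descent for the group algebra `K[M]`. Surjectivity is shown by means of the traces of the
elements `c m` for `m` in `M` and `c` in the field of definition of `m`, and of Dedekind's linear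
independence of the embeddings of this field. -/
theorem ofInvariants_bijective [IsGalois F K] (hρ : ∀ m, IsOpen {σ | ρ σ m = m}) :
    Function.Bijective (ofInvariants ρ) := by
  constructor
  · rw [injective_iff_map_eq_zero]
    intro x hx
    refine eq_zero_of_mem_of_galTensor_mem (LinearMap.ker (ofInvariants ρ).toLinearMap)
      (fun σ y hy => ?_) (fun c hc => ?_) hx
    · change ofInvariants ρ _ = 0
      rw [ofInvariants_galTensor, show ofInvariants ρ y = 0 from hy, map_zero]
    · exact Subtype.ext ((ofInvariants_one_tmul c).symm.trans hc)
  have key (m : M) : .single m 1 ∈ LinearMap.range (ofInvariants ρ).toLinearMap := by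
    by_contra hm
    obtain ⟨f, hf, hf'⟩ := Submodule.exists_le_ker_of_notMem hm
    refine hf ?_
    let H : Subgroup (K ≃ₐ[F] K) :=
      { carrier := {σ | ρ σ m = m}
        one_mem' := by simp
        mul_mem' := fun {σ τ} hσ hτ => by
          change ρ (σ * τ) m = m
          rw [map_mul, Module.End.mul_apply, hτ, hσ]
        inv_mem' := fun {σ} hσ => by
          change ρ σ⁻¹ m = m
          conv_lhs => rw [← (show ρ σ m = m from hσ)]
          simp }
    have hH : IsOpen (H : Set (K ≃ₐ[F] K)) := hρ m
    have : Finite ((K ≃ₐ[F] K) ⧸ H) := H.quotient_finite_of_isOpen hH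
    have := Fintype.ofFinite ((K ≃ₐ[F] K) ⧸ H)
    have hfix : (IntermediateField.fixedField H).fixingSubgroup = H :=
      InfiniteGalois.fixingSubgroup_fixedField ⟨H, H.isClosed_of_isOpen hH⟩
    -- the terms of the trace of `c m`, as a sum over cosets of the stabilizer of `m`
    have hcoset {σ τ : K ≃ₐ[F] K} (h : (σ : (K ≃ₐ[F] K) ⧸ H) = τ) (c : K)
        (hc : c ∈ IntermediateField.fixedField H) :
        (AddMonoidAlgebra.single (ρ σ m) (σ c) : AddMonoidAlgebra K M) = .single (ρ τ m) (τ c) := by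
      obtain ⟨g, hg, rfl⟩ : ∃ g ∈ H, τ = σ * g :=
        ⟨σ⁻¹ * τ, QuotientGroup.eq.1 h, by rw [mul_inv_cancel_left]⟩
      rw [map_mul, Module.End.mul_apply, show ρ g m = m from hg, AlgEquiv.mul_apply,
        (IntermediateField.mem_fixedField_iff _ _).1 hc g hg]
    have htrace (c : K) (hc : c ∈ IntermediateField.fixedField H) :
        ∑ q : (K ≃ₐ[F] K) ⧸ H, (AddMonoidAlgebra.single (ρ q.out m) (q.out c) :
          AddMonoidAlgebra K M) ∈ invariants ρ := by
      intro σ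
      rw [map_sum]
      refine Fintype.sum_equiv (MulAction.toPerm σ) _ _ fun q => ?_
      rw [galGroupAlgebra_single, ← Module.End.mul_apply, ← map_mul, ← AlgEquiv.mul_apply]
      refine hcoset ?_ c hc
      rw [QuotientGroup.out_eq']
      change ((σ • (q.out : (K ≃ₐ[F] K) ⧸ H)) : (K ≃ₐ[F] K) ⧸ H) = σ • q
      rw [QuotientGroup.out_eq']
    -- the linear form `f` kills the traces, as they are in the image
    have hsum (c : IntermediateField.fixedField H) :
        ∑ q : (K ≃ₐ[F] K) ⧸ H, f (.single (ρ q.out m) 1) * q.out (c : K) = 0 := by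
      have h1 := hf' ⟨1 ⊗ₜ ⟨_, htrace c c.2⟩, ofInvariants_one_tmul _⟩
      rw [LinearMap.mem_ker, map_sum] at h1
      rw [← h1]
      refine Finset.sum_congr rfl fun q _ => ?_
      rw [mul_comm, ← smul_eq_mul, ← map_smul, AddMonoidAlgebra.smul_single, smul_eq_mul, mul_one]
    let χ (q : (K ≃ₐ[F] K) ⧸ H) : IntermediateField.fixedField H →* K :=
      ((q.out : K →ₐ[F] K).comp (IntermediateField.fixedField H).val : _ →* K)
    have hχ : Function.Injective χ := fun q q' h => by
      rw [← QuotientGroup.out_eq' q, ← QuotientGroup.out_eq' q', QuotientGroup.eq]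
      refine hfix.le ((IntermediateField.mem_fixingSubgroup_iff _ _).2 ?_)
      intro x hx
      have := DFunLike.congr_fun h ⟨x, hx⟩
      rw [AlgEquiv.mul_apply, AlgEquiv.aut_inv, AlgEquiv.symm_apply_eq]
      exact this.symm
    have hli := (linearIndependent_monoidHom (IntermediateField.fixedField H) K).comp χ hχ
    have h0 := Fintype.linearIndependent_iff.1 hli (fun q => f (.single (ρ q.out m) 1))
      (funext fun c => by
        rw [Finset.sum_apply]
        exact hsum c) ((1 : K ≃ₐ[F] K) : (K ≃ₐ[F] K) ⧸ H)
    have h1 := hcoset (QuotientGroup.out_eq' ((1 : K ≃ₐ[F] K) : (K ≃ₐ[F] K) ⧸ H)) 1 (one_mem _)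
    rw [map_one, map_one, map_one] at h1
    rw [h1] at h0
    exact h0
  intro x
  induction x using AddMonoidAlgebra.induction_on with
  | of m => exact key m
  | add x y hx hy =>
    obtain ⟨x, rfl⟩ := hx
    obtain ⟨y, rfl⟩ := hy
    exact ⟨x + y, map_add _ _ _⟩
  | smul s x hx =>
    obtain ⟨x, rfl⟩ := hx
    exact ⟨s • x, map_smul _ _ _⟩

variable (ρ) in
/-- Every continuous representation on an abelian group `M` corresponds to a form of the group
algebra of `M`. -/
theorem exists_isDiagonal [IsGalois F K] (hρ : ∀ m, IsOpen {σ | ρ σ m = m}) :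
    ∃ (A : Type u) (_ : CommRing A) (_ : Algebra F A) (u : Multiplicative M →* K ⊗[F] A),
      IsDiagonal ρ u := by
  let e := AlgEquiv.ofBijective _ (ofInvariants_bijective hρ)
  have he (x) : e x = ofInvariants ρ x := rfl
  refine ⟨invariants ρ, inferInstance, inferInstance,
    (e.symm : _ →* _).comp (AddMonoidAlgebra.of K M), fun σ m => ?_, ?_⟩
  · apply e.injective
    change e (galTensor _ σ (e.symm (.single m 1))) = e (e.symm (.single (ρ σ m) 1))
    rw [he, ofInvariants_galTensor, ← he, e.apply_symm_apply, e.apply_symm_apply,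
      galGroupAlgebra_single, map_one]
  · have : AddMonoidAlgebra.lift K (K ⊗[F] invariants ρ) M
        ((e.symm : _ →* _).comp (AddMonoidAlgebra.of K M)) = e.symm.toAlgHom := by
      refine AddMonoidAlgebra.algHom_ext' (MonoidHom.ext fun m => ?_) ?_
      · simp
      · ext
    rw [this]
    exact e.symm.bijective

end Invariants

end Torus

/-! ### Group-like elements -/

namespace Torus

variable {F K : Type u} [Field F] [Field K] [Algebra F K]

section GroupLike

variable {A B : Type u} [CommRing A] [CommRing B]

section Tensor

variable [Algebra F A] [Algebra F B]

variable (K A B) in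
/-- The embedding of `K ⊗ A` in `K ⊗ (A ⊗ B)`. -/
def extendLeft : K ⊗[F] A →ₐ[K] K ⊗[F] (A ⊗[F] B) :=
  extend K Algebra.TensorProduct.includeLeft

variable (K A B) in
/-- The embedding of `K ⊗ B` in `K ⊗ (A ⊗ B)`. -/
def extendRight : K ⊗[F] B →ₐ[K] K ⊗[F] (A ⊗[F] B) :=
  extend K Algebra.TensorProduct.includeRight

open TensorProduct.AlgebraTensorModule in
lemma distribBaseChange_mul (x : K ⊗[F] A) (y : K ⊗[F] B) :
    distribBaseChange F K A B (extendLeft K A B x * extendRight K A B y) = x ⊗ₜ y := by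
  induction x with
  | zero => simp
  | add x x' hx hx' => simp only [TensorProduct.add_tmul, map_add, add_mul, hx, hx']
  | tmul s a =>
    induction y with
    | zero => simp
    | add y y' hy hy' => simp only [TensorProduct.tmul_add, map_add, mul_add, hy, hy']
    | tmul t b =>
      change distribBaseChange F K A B ((s ⊗ₜ (a ⊗ₜ 1)) * (t ⊗ₜ (1 ⊗ₜ b))) = _
      rw [Algebra.TensorProduct.tmul_mul_tmul, Algebra.TensorProduct.tmul_mul_tmul, mul_one,
        one_mul, distribBaseChange_tmul, mul_comm, ← smul_eq_mul, ← TensorProduct.smul_tmul',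
        TensorProduct.smul_tmul, TensorProduct.smul_tmul', smul_eq_mul, mul_one]

end Tensor

variable [HopfAlgebra F A] [HopfAlgebra F B]

/-- The definition of group-like elements of `K ⊗ A`, in terms of the structure of `A` over `F`. -/
lemma isGroupLikeElem_iff {x : K ⊗[F] A} : IsGroupLikeElem K x ↔
    extend K (Bialgebra.counitAlgHom F A) x = 1 ∧
      extend K (Bialgebra.comulAlgHom F A) x = extendLeft K A A x * extendRight K A A x := by
  have h1 : Coalgebra.counit (R := K) x =
      Algebra.TensorProduct.rid F K K (extend K (Bialgebra.counitAlgHom F A) x) := by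
    induction x with
    | zero => simp
    | add x y hx hy => simp only [map_add, hx, hy]
    | tmul s a => simp [extend_tmul]
  have h2 : Coalgebra.comul (R := K) x = TensorProduct.AlgebraTensorModule.distribBaseChange F K A A
      (extend K (Bialgebra.comulAlgHom F A) x) := comul_baseChange x
  constructor
  · intro h
    refine ⟨(Algebra.TensorProduct.rid F K K).injective ?_,
      (TensorProduct.AlgebraTensorModule.distribBaseChange F K A A).injective ?_⟩
    · rw [← h1, h.counit_eq_one, map_one]
    · rw [← h2, h.comul_eq_tmul_self, distribBaseChange_mul]
  · rintro ⟨h3, h4⟩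
    refine ⟨?_, ?_⟩
    · rw [h1, h3, map_one]
    · rw [h2, h4, distribBaseChange_mul]

lemma isGroupLikeElem_extend {x : K ⊗[F] A} (hx : IsGroupLikeElem K x) (f : A →ₐc[F] B) :
    IsGroupLikeElem K (extend K (f : A →ₐ[F] B) x) :=
  hx.map (Bialgebra.TensorProduct.map (BialgHom.id K K) f)

lemma isGroupLikeElem_extendLeft_mul_extendRight {x : K ⊗[F] A} {y : K ⊗[F] B}
    (hx : IsGroupLikeElem K x) (hy : IsGroupLikeElem K y) :
    IsGroupLikeElem K (extendLeft K A B x * extendRight K A B y) := by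
  let i : A →ₐc[F] A ⊗[F] B := BialgHom.ofAlgHom Algebra.TensorProduct.includeLeft
    (AlgHom.ext fun a => by simp) (AlgHom.ext fun a => by
      change _ = Coalgebra.comul (R := F) (a ⊗ₜ[F] (1 : B))
      rw [TensorProduct.comul_tmul, Bialgebra.comul_one]
      change Algebra.TensorProduct.map _ _ (Coalgebra.comul (R := F) a) = _
      induction Coalgebra.comul (R := F) a with
      | zero => simp
      | add x y hx hy => simp only [TensorProduct.add_tmul, map_add, hx, hy]
      | tmul x y => rfl)
  let j : B →ₐc[F] A ⊗[F] B := BialgHom.ofAlgHom Algebra.TensorProduct.includeRight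
    (AlgHom.ext fun a => by simp) (AlgHom.ext fun a => by
      change _ = Coalgebra.comul (R := F) ((1 : A) ⊗ₜ[F] a)
      rw [TensorProduct.comul_tmul, Bialgebra.comul_one]
      change Algebra.TensorProduct.map _ _ (Coalgebra.comul (R := F) a) = _
      induction Coalgebra.comul (R := F) a with
      | zero => simp
      | add x y hx hy => simp only [TensorProduct.tmul_add, map_add, hx, hy]
      | tmul x y => rfl)
  exact (isGroupLikeElem_extend hx i).mul (isGroupLikeElem_extend hy j)

end GroupLike

section Diagonal

variable {M : Type u} [AddCommGroup M] {ρ : Representation ℤ (K ≃ₐ[F] K) M}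
  {A B : Type u} [CommRing A] [CommRing B] [HopfAlgebra F A] [HopfAlgebra F B]
  {u : Multiplicative M →* K ⊗[F] A}

/-- Group-like elements which generate `K ⊗ A` form a basis, since they are linearly independent. -/
lemma IsDiagonal.of_isGroupLikeElem (hu : ∀ σ m, galTensor A σ (u (.ofAdd m)) = u (.ofAdd (ρ σ m)))
    (hg : ∀ m, IsGroupLikeElem K (u m)) (hi : Function.Injective u)
    (hs : Submodule.span K (Set.range u) = ⊤) : IsDiagonal ρ u := by
  refine ⟨hu, ?_, ?_⟩
  · have hli : LinearIndependent K fun m : M => u (.ofAdd m) :=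
      (linearIndep_groupLikeVal (R := K) (A := K ⊗[F] A)).comp
        (fun m : M => (⟨u (.ofAdd m), hg _⟩ : GroupLike K (K ⊗[F] A)))
        fun m m' h => hi (congrArg GroupLike.val h)
    intro x y h
    apply AddMonoidAlgebra.coeff_injective
    refine hli ?_
    rw [AddMonoidAlgebra.lift_apply, AddMonoidAlgebra.lift_apply] at h
    exact h
  · intro x
    have hx : x ∈ Submodule.span K (Set.range u) := hs ▸ Submodule.mem_top
    induction hx using Submodule.span_induction with
    | zero => exact ⟨0, map_zero _⟩
    | mem x hx =>
      obtain ⟨m, rfl⟩ := hx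
      exact ⟨.single m.toAdd 1, by rw [AddMonoidAlgebra.lift_single, one_smul]; rfl⟩
    | add x y _ _ hx hy =>
      obtain ⟨x, rfl⟩ := hx
      obtain ⟨y, rfl⟩ := hy
      exact ⟨x + y, map_add _ _ _⟩
    | smul s x _ hx =>
      obtain ⟨x, rfl⟩ := hx
      exact ⟨s • x, map_smul _ _ _⟩

lemma IsDiagonal.injective (h : IsDiagonal ρ u) : Function.Injective u := fun m m' hm => by
  have := @h.bijective.1 (.single m.toAdd 1) (.single m'.toAdd 1) (by
    rw [AddMonoidAlgebra.lift_single, AddMonoidAlgebra.lift_single]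
    exact congrArg _ hm)
  exact Multiplicative.toAdd.injective
    (AddMonoidAlgebra.of_injective this)

/-- All group-like elements belong to a basis of group-like elements. -/
lemma IsDiagonal.exists_eq (h : IsDiagonal ρ u) (hg : ∀ m, IsGroupLikeElem K (u m))
    {x : K ⊗[F] A} (hx : IsGroupLikeElem K x) : ∃ m, u m = x := by
  have hli := linearIndep_groupLikeVal (R := K) (A := K ⊗[F] A)
  have hx' : x ∈ Submodule.span K (Set.range u) := by
    refine h.induction (p := (· ∈ Submodule.span K (Set.range u))) x
      (fun m => Submodule.subset_span ⟨m, rfl⟩) (fun x y => Submodule.add_mem _)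
      (fun s x => Submodule.smul_mem _ s)
  by_contra! hne
  let s : Set (GroupLike K (K ⊗[F] A)) := Set.range fun m => ⟨u m, hg m⟩
  refine hli.notMem_span_image (s := s) (x := ⟨x, hx⟩) ?_ ?_
  · rintro ⟨m, hm⟩
    exact hne m (congrArg GroupLike.val hm)
  · have : GroupLike.val '' s = Set.range u := by
      rw [← Set.range_comp]
      rfl
    rwa [this]

lemma IsDiagonal.bialgHom_ext (h : IsDiagonal ρ u) {f g : A →ₐc[F] B}
    (hfg : ∀ m, extend K (f : A →ₐ[F] B) (u m) = extend K (g : A →ₐ[F] B) (u m)) : f = g := by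
  have := h.algHom_ext hfg
  exact DFunLike.ext _ _ fun x => DFunLike.congr_fun this x

/-- Cartier duality for homomorphisms: a homomorphism from `M` to the group-like elements of `K ⊗ B`
comes from a homomorphism of Hopf algebras. -/
theorem IsDiagonal.exists_bialgHom [IsGalois F K] (h : IsDiagonal ρ u)
    (hg : ∀ m, IsGroupLikeElem K (u m)) (v : Multiplicative M →* K ⊗[F] B)
    (hv : ∀ σ m, galTensor B σ (v (.ofAdd m)) = v (.ofAdd (ρ σ m)))
    (hvg : ∀ m, IsGroupLikeElem K (v m)) :
    ∃ f : A →ₐc[F] B, ∀ m, extend K (f : A →ₐ[F] B) (u m) = v m := by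
  obtain ⟨f, hf⟩ := h.exists_algHom v hv
  refine ⟨BialgHom.ofAlgHom f (h.algHom_ext fun m => ?_) (h.algHom_ext fun m => ?_), hf⟩
  · rw [extend_comp, hf, (isGroupLikeElem_iff.1 (hvg m)).1, (isGroupLikeElem_iff.1 (hg m)).1]
  · rw [extend_comp, extend_comp, hf, (isGroupLikeElem_iff.1 (hvg m)).2,
      (isGroupLikeElem_iff.1 (hg m)).2, map_mul, extendLeft, extendRight, extendLeft, extendRight,
      ← extend_comp, ← extend_comp, Algebra.TensorProduct.map_comp_includeLeft,
      Algebra.TensorProduct.map_comp_includeRight, extend_comp, extend_comp, hf]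

end Diagonal

/-- The form `A` of the group algebra of `M` has a structure of Hopf algebra for which the given
basis of `K ⊗ A` consists of group-like elements. -/
theorem exists_hopfAlgebra [IsGalois F K] {M : Type u} [AddCommGroup M]
    (ρ : Representation ℤ (K ≃ₐ[F] K) M) (hρ : ∀ m, IsOpen {σ | ρ σ m = m}) :
    ∃ (A : Type u) (_ : CommRing A) (_ : HopfAlgebra F A) (u : Multiplicative M →* K ⊗[F] A),
      IsDiagonal ρ u ∧ ∀ m, IsGroupLikeElem K (u m) := by
  obtain ⟨A, _, _, u, h⟩ := exists_isDiagonal ρ hρ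
  obtain ⟨ε, hε⟩ := h.exists_algHom (C := F) 1 (fun _ _ => map_one _)
  obtain ⟨S, hS⟩ := h.exists_algHom (u.comp (invMonoidHom (α := Multiplicative M))) fun σ m => by
    change galTensor A σ (u (.ofAdd (-m))) = u (.ofAdd (-(ρ σ m)))
    rw [h.galTensor_apply, map_neg]
  obtain ⟨Δ, hΔ⟩ := h.exists_algHom
    (((extendLeft K A A : K ⊗[F] A →ₐ[K] _) : K ⊗[F] A →* K ⊗[F] (A ⊗[F] A)).comp u *
      ((extendRight K A A : K ⊗[F] A →ₐ[K] _) : K ⊗[F] A →* K ⊗[F] (A ⊗[F] A)).comp u) fun σ m => by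
      change galTensor _ σ (extendLeft K A A (u (.ofAdd m)) * extendRight K A A (u (.ofAdd m))) =
        extendLeft K A A (u (.ofAdd (ρ σ m))) * extendRight K A A (u (.ofAdd (ρ σ m)))
      rw [map_mul, extendLeft, extendRight, galTensor_extend, galTensor_extend, h.galTensor_apply]
  replace hΔ (m) : extend K Δ (u m) = extend K Algebra.TensorProduct.includeLeft (u m) *
    extend K Algebra.TensorProduct.includeRight (u m) := hΔ m
  replace hε (m) : extend K ε (u m) = 1 := hε m
  replace hS (m) : extend K S (u m) = u m⁻¹ := hS m
  have hconst {C : Type u} [CommRing C] [Algebra F C] (f : F →ₐ[F] C) (m) :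
      extend K (f.comp ε) (u m) = 1 := by rw [extend_comp, hε, map_one]
  have hlift (f g : A →ₐ[F] A) (m) :
      extend K ((Algebra.TensorProduct.lift f g fun _ _ => .all _ _).comp Δ) (u m) =
        extend K f (u m) * extend K g (u m) := by
    rw [extend_comp, hΔ, map_mul, ← extend_comp, ← extend_comp,
      Algebra.TensorProduct.lift_comp_includeLeft]
    congr 3
    exact AlgHom.ext fun a => by simp
  let bi : Bialgebra F A := Bialgebra.ofAlgHom Δ ε
    (h.algHom_ext fun m => by
      simp only [extend_comp, hΔ, map_mul]
      simp only [← extend_comp, Algebra.TensorProduct.map_comp_includeLeft,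
        Algebra.TensorProduct.map_comp_includeRight]
      simp only [extend_comp, hΔ, map_mul]
      simp only [← extend_comp, mul_assoc]
      rfl)
    (h.algHom_ext fun m => by
      rw [extend_comp, hΔ, map_mul, ← extend_comp, ← extend_comp,
        Algebra.TensorProduct.map_comp_includeLeft, hconst, one_mul,
        Algebra.TensorProduct.map_comp_includeRight]
      rfl)
    (h.algHom_ext fun m => by
      rw [extend_comp, hΔ, map_mul, ← extend_comp, ← extend_comp,
        Algebra.TensorProduct.map_comp_includeRight, hconst, mul_one,
        Algebra.TensorProduct.map_comp_includeLeft]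
      rfl)
  let ho : HopfAlgebra F A := HopfAlgebra.ofAlgHom S
    (h.algHom_ext fun m => ((hlift _ _ m).trans (by
      rw [hS, extend_id, ← map_mul, inv_mul_cancel, map_one])).trans (hconst (Algebra.ofId F A) m).symm)
    (h.algHom_ext fun m => ((hlift _ _ m).trans (by
      rw [hS, extend_id, ← map_mul, mul_inv_cancel, map_one])).trans (hconst (Algebra.ofId F A) m).symm)
  exact ⟨A, _, ho, u, h, fun m => isGroupLikeElem_iff.2 ⟨hε m, hΔ m⟩⟩

end Torus

/-! ### Cartier duality -/

namespace Torus

variable {F K : Type u} [Field F] [Field K] [Algebra F K]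

section Split

variable {A B : Type u} [CommRing A] [HopfAlgebra F A] [CommRing B] [HopfAlgebra F B]

variable (F K) in
/-- The group of characters of `Spec A` over `K`, written additively. -/
abbrev CharGroup (A : Type u) [CommRing A] [HopfAlgebra F A] : Type u :=
  Additive (GroupLike K (K ⊗[F] A))

variable (F K A) in
/-- The inclusion of the group of characters in `K ⊗ A`. -/
def charVal : Multiplicative (CharGroup F K A) →* K ⊗[F] A where
  toFun χ := χ.toAdd.toMul.val
  map_one' := rfl
  map_mul' _ _ := rfl

lemma isGroupLikeElem_charVal (χ) : IsGroupLikeElem K (charVal F K A χ) :=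
  χ.toAdd.toMul.isGroupLikeElem_val

lemma galTensor_charVal (σ : K ≃ₐ[F] K) (χ) :
    galTensor A σ (charVal F K A (.ofAdd χ)) = charVal F K A (.ofAdd (charRep F K A σ χ)) := rfl

lemma charVal_injective : Function.Injective (charVal F K A) := fun _ _ h =>
  Multiplicative.toAdd.injective (Additive.toMul.injective (GroupLike.ext h))

variable (F K A) in
/-- The characters span `K ⊗ A`, and hence form a basis of it: the group `Spec A` becomes
diagonalizable over `K`. -/
def IsMultiplicative : Prop := Submodule.span K (Set.range (charVal F K A)) = ⊤

lemma IsMultiplicative.isDiagonal (h : IsMultiplicative F K A) :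
    IsDiagonal (charRep F K A) (charVal F K A) :=
  .of_isGroupLikeElem galTensor_charVal isGroupLikeElem_charVal charVal_injective h

/-- Any equivariant homomorphism between groups of characters is induced by a homomorphism of
Hopf algebras. -/
theorem IsMultiplicative.exists_charMap_eq [IsGalois F K] (h : IsMultiplicative F K A)
    (f : (charRep F K A).IntertwiningMap (charRep F K B)) : ∃ g : A →ₐc[F] B, charMap F K g = f := by
  obtain ⟨g, hg⟩ := h.isDiagonal.exists_bialgHom isGroupLikeElem_charVal
    ((charVal F K B).comp (AddMonoidHom.toMultiplicative f.toLinearMap.toAddMonoidHom))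
    (fun σ χ => by
      change galTensor B σ (charVal F K B (.ofAdd (f χ))) =
        charVal F K B (.ofAdd (f (charRep F K A σ χ)))
      rw [galTensor_charVal]
      congr 2
      exact (LinearMap.congr_fun (f.isIntertwining' σ) χ).symm)
    (fun χ => isGroupLikeElem_charVal _)
  refine ⟨g, Representation.IntertwiningMap.ext (LinearMap.ext fun χ => ?_)⟩
  exact Multiplicative.ofAdd.injective (charVal_injective (hg (.ofAdd χ)))

/-- Hopf algebras with isomorphic groups of characters are isomorphic. -/
theorem IsMultiplicative.nonempty_bialgEquiv [IsGalois F K] (hA : IsMultiplicative F K A)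
    (hB : IsMultiplicative F K B)
    (e : CharGroup F K A ≃+ CharGroup F K B)
    (he : ∀ σ χ, e (charRep F K A σ χ) = charRep F K B σ (e χ)) : Nonempty (A ≃ₐc[F] B) := by
  obtain ⟨f, hf⟩ := hA.exists_charMap_eq
    ⟨e.toAddMonoidHom.toIntLinearMap, fun σ => LinearMap.ext (he σ)⟩
  obtain ⟨g, hg⟩ := hB.exists_charMap_eq (B := A)
    ⟨e.symm.toAddMonoidHom.toIntLinearMap, fun σ => LinearMap.ext fun χ => by
      change e.symm (charRep F K B σ χ) = charRep F K A σ (e.symm χ)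
      rw [AddEquiv.symm_apply_eq, he, e.apply_symm_apply]⟩
  have h1 : g.comp f = BialgHom.id F A := hA.isDiagonal.bialgHom_ext fun χ => by
    have h2 : charMap F K g (charMap F K f χ.toAdd) = χ.toAdd := by
      rw [hf, hg]
      exact e.symm_apply_apply _
    refine Eq.trans ?_ (extend_id _).symm
    refine (extend_comp (g : B →ₐ[F] A) (f : A →ₐ[F] B) _).trans ?_
    exact congrArg (fun ψ => charVal F K A (.ofAdd ψ)) h2
  have h1' : f.comp g = BialgHom.id F B := hB.isDiagonal.bialgHom_ext fun χ => by
    have h2 : charMap F K f (charMap F K g χ.toAdd) = χ.toAdd := by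
      rw [hf, hg]
      exact e.apply_symm_apply _
    refine Eq.trans ?_ (extend_id _).symm
    refine (extend_comp (f : A →ₐ[F] B) (g : B →ₐ[F] A) _).trans ?_
    exact congrArg (fun ψ => charVal F K B (.ofAdd ψ)) h2
  exact ⟨BialgEquiv.ofBijective f (Function.bijective_iff_has_inverse.2
    ⟨g, fun x => DFunLike.congr_fun h1 x, fun x => DFunLike.congr_fun h1' x⟩)⟩

/-- The characters of a product are the pairs of characters. -/
theorem exists_charRep_tensorProduct (hA : IsMultiplicative F K A) (hB : IsMultiplicative F K B) :
    IsMultiplicative F K (A ⊗[F] B) ∧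
    ∃ e : CharGroup F K A × CharGroup F K B ≃+
      CharGroup F K (A ⊗[F] B),
      ∀ σ χ, e (charRep F K A σ χ.1, charRep F K B σ χ.2) = charRep F K (A ⊗[F] B) σ (e χ) := by
  let e : CharGroup F K A × CharGroup F K B →+
      CharGroup F K (A ⊗[F] B) :=
    { toFun := fun χ => .ofMul ⟨extendLeft K A B χ.1.toMul.val * extendRight K A B χ.2.toMul.val,
        isGroupLikeElem_extendLeft_mul_extendRight χ.1.toMul.2 χ.2.toMul.2⟩
      map_zero' := Additive.toMul.injective (GroupLike.ext (by
        change extendLeft K A B 1 * extendRight K A B 1 = 1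
        rw [map_one, map_one, one_mul]))
      map_add' := fun χ ψ => Additive.toMul.injective (GroupLike.ext (by
        change extendLeft K A B (χ.1.toMul.val * ψ.1.toMul.val) *
            extendRight K A B (χ.2.toMul.val * ψ.2.toMul.val) =
          (extendLeft K A B χ.1.toMul.val * extendRight K A B χ.2.toMul.val) *
            (extendLeft K A B ψ.1.toMul.val * extendRight K A B ψ.2.toMul.val)
        rw [map_mul, map_mul, mul_mul_mul_comm])) }
  have hval (χ) : (e χ).toMul.val =
    extendLeft K A B χ.1.toMul.val * extendRight K A B χ.2.toMul.val := rfl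
  have he (σ χ) : e (charRep F K A σ χ.1, charRep F K B σ χ.2) =
      charRep F K (A ⊗[F] B) σ (e χ) := by
    apply Additive.toMul.injective
    apply GroupLike.ext
    change extendLeft K A B (galTensor A σ χ.1.toMul.val) *
      extendRight K A B (galTensor B σ χ.2.toMul.val) =
        galTensor (A ⊗[F] B) σ
          (extendLeft K A B χ.1.toMul.val * extendRight K A B χ.2.toMul.val)
    rw [map_mul, extendLeft, extendRight, galTensor_extend, galTensor_extend]
  -- restricting to the factors `Spec A` and `Spec B` recovers the two characters
  have hi : Function.Injective e := by
    intro χ ψ h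
    have h1 := congrArg (fun x => x.toMul.val) h
    simp only [hval] at h1
    let p : A ⊗[F] B →ₐ[F] A := Algebra.TensorProduct.lift (AlgHom.id F A)
      ((Algebra.ofId F A).comp (Bialgebra.counitAlgHom F B)) fun _ _ => .all _ _
    let q : A ⊗[F] B →ₐ[F] B := Algebra.TensorProduct.lift
      ((Algebra.ofId F B).comp (Bialgebra.counitAlgHom F A)) (AlgHom.id F B) fun _ _ => .all _ _
    have hp (x : K ⊗[F] A) {y : K ⊗[F] B} (hy : IsGroupLikeElem K y) :
        extend K p (extendLeft K A B x * extendRight K A B y) = x := by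
      rw [map_mul, extendLeft, extendRight, ← extend_comp, ← extend_comp,
        show p.comp Algebra.TensorProduct.includeLeft = AlgHom.id F A from
          AlgHom.ext fun a => by simp [p],
        show p.comp Algebra.TensorProduct.includeRight =
          (Algebra.ofId F A).comp (Bialgebra.counitAlgHom F B) from AlgHom.ext fun a => by simp [p],
        extend_comp, (isGroupLikeElem_iff.1 hy).1, map_one, mul_one, extend_id]
    have hq {x : K ⊗[F] A} (y : K ⊗[F] B) (hx : IsGroupLikeElem K x) :
        extend K q (extendLeft K A B x * extendRight K A B y) = y := by
      rw [map_mul, extendLeft, extendRight, ← extend_comp, ← extend_comp,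
        show q.comp Algebra.TensorProduct.includeRight = AlgHom.id F B from
          AlgHom.ext fun a => by simp [q],
        show q.comp Algebra.TensorProduct.includeLeft =
          (Algebra.ofId F B).comp (Bialgebra.counitAlgHom F A) from AlgHom.ext fun a => by simp [q],
        extend_comp, (isGroupLikeElem_iff.1 hx).1, map_one, one_mul, extend_id]
    refine Prod.ext (Additive.toMul.injective (GroupLike.ext ?_))
      (Additive.toMul.injective (GroupLike.ext ?_))
    · have := congrArg (extend K p) h1
      rwa [hp _ χ.2.toMul.2, hp _ ψ.2.toMul.2] at this
    · have := congrArg (extend K q) h1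
      rwa [hq _ χ.1.toMul.2, hq _ ψ.1.toMul.2] at this
  let v : Multiplicative (CharGroup F K A × CharGroup F K B) →*
    K ⊗[F] (A ⊗[F] B) := (charVal F K (A ⊗[F] B)).comp (AddMonoidHom.toMultiplicative e)
  have hs : Submodule.span K (Set.range v) = ⊤ := by
    have h1 (x : K ⊗[F] A) (y : K ⊗[F] B) :
        extendLeft K A B x * extendRight K A B y ∈ Submodule.span K (Set.range v) := by
      refine hA.isDiagonal.induction (p := fun x => extendLeft K A B x * extendRight K A B y ∈
        Submodule.span K (Set.range v)) x (fun χ => ?_)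
        (fun x x' hx hx' => by rw [map_add, add_mul]; exact Submodule.add_mem _ hx hx')
        (fun s x hx => by rw [map_smul, smul_mul_assoc]; exact Submodule.smul_mem _ s hx)
      refine hB.isDiagonal.induction (p := fun y => extendLeft K A B (charVal F K A χ) *
        extendRight K A B y ∈ Submodule.span K (Set.range v)) y (fun ψ => ?_)
        (fun x x' hx hx' => by rw [map_add, mul_add]; exact Submodule.add_mem _ hx hx')
        (fun s x hx => by rw [map_smul, mul_smul_comm]; exact Submodule.smul_mem _ s hx)
      exact Submodule.subset_span ⟨.ofAdd (χ.toAdd, ψ.toAdd), rfl⟩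
    rw [eq_top_iff]
    rintro x -
    induction x with
    | zero => exact Submodule.zero_mem _
    | add x y hx hy => exact Submodule.add_mem _ hx hy
    | tmul s c =>
      induction c with
      | zero => rw [TensorProduct.tmul_zero]; exact Submodule.zero_mem _
      | add x y hx hy => rw [TensorProduct.tmul_add]; exact Submodule.add_mem _ hx hy
      | tmul a b =>
        have := h1 (s ⊗ₜ a) (1 ⊗ₜ b)
        rw [extendLeft, extendRight, extend_tmul, extend_tmul] at this
        simpa using this
  -- the products of characters form a basis, so that there is no other character
  have hd : IsDiagonal _ v := .of_isGroupLikeElem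
    (ρ := { toFun := fun σ => (charRep F K A σ).prodMap (charRep F K B σ)
            map_one' := by rw [map_one, map_one]; rfl
            map_mul' := fun σ τ => by rw [map_mul, map_mul]; rfl })
    (fun σ χ => congrArg (fun ψ => charVal F K (A ⊗[F] B) (.ofAdd ψ)) (he σ χ).symm)
    (fun χ => isGroupLikeElem_charVal _)
    (fun _ _ h => hi (charVal_injective h)) hs
  refine ⟨eq_top_iff.2 (hs.symm.le.trans (Submodule.span_mono ?_)),
    AddEquiv.ofBijective e ⟨hi, fun χ => ?_⟩, he⟩
  · rintro _ ⟨χ, rfl⟩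
    exact ⟨_, rfl⟩
  · obtain ⟨ψ, hψ⟩ := hd.exists_eq (fun χ => isGroupLikeElem_charVal _) χ.toMul.2
    exact ⟨ψ.toAdd, Additive.toMul.injective (GroupLike.ext hψ)⟩

end Split

lemma isMultiplicative (T : Torus F K) : IsMultiplicative F K T.coord := by
  obtain ⟨n, ⟨e⟩⟩ := T.isForm
  rw [IsMultiplicative, eq_top_iff]
  rintro x -
  obtain ⟨y, rfl⟩ : ∃ y, e.symm y = x := ⟨e x, e.symm_apply_apply x⟩
  induction y using AddMonoidAlgebra.induction_on with
  | of m =>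
    have h : IsGroupLikeElem K (AddMonoidAlgebra.of K (Fin n → ℤ) (.ofAdd m)) :=
      AddMonoidAlgebra.isGroupLikeElem_iff_mem_range_of.2 ⟨_, rfl⟩
    exact Submodule.subset_span ⟨.ofAdd (.ofMul ⟨_, h.map e.symm⟩), rfl⟩
  | add x y hx hy => rw [map_add]; exact Submodule.add_mem _ hx hy
  | smul s x hx => rw [map_smul]; exact Submodule.smul_mem _ s hx

instance [IsGalois F K] : (charFunctor F K).Full where
  map_surjective {T T'} f := by
    obtain ⟨g, hg⟩ := T'.isMultiplicative.exists_charMap_eq (B := T.coord) f.unop.hom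
    exact ⟨g, Quiver.Hom.unop_inj (Rep.hom_ext hg)⟩

end Torus

namespace Torus

variable {F K : Type u} [Field F] [Field K] [Algebra F K]

lemma exists_addEquiv_charGroup (T : Torus F K) :
    ∃ n : ℕ, Nonempty ((Fin n → ℤ) ≃+ CharGroup F K T.coord) := by
  obtain ⟨n, ⟨e⟩⟩ := T.isForm
  have hg (m : Fin n → ℤ) : IsGroupLikeElem K (AddMonoidAlgebra.of K (Fin n → ℤ) (.ofAdd m)) :=
    AddMonoidAlgebra.isGroupLikeElem_iff_mem_range_of.2 ⟨_, rfl⟩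
  let f : (Fin n → ℤ) →+ CharGroup F K T.coord :=
    { toFun := fun m => .ofMul ⟨_, (hg m).map e.symm⟩
      map_zero' := Additive.toMul.injective (GroupLike.ext (by
        change e.symm (AddMonoidAlgebra.of K (Fin n → ℤ) 1) = 1
        rw [map_one, map_one]))
      map_add' := fun m m' => Additive.toMul.injective (GroupLike.ext (by
        change e.symm (AddMonoidAlgebra.of K (Fin n → ℤ) (.ofAdd m * .ofAdd m')) =
          e.symm (AddMonoidAlgebra.of K (Fin n → ℤ) (.ofAdd m)) *
            e.symm (AddMonoidAlgebra.of K (Fin n → ℤ) (.ofAdd m'))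
        rw [map_mul, map_mul])) }
  refine ⟨n, ⟨AddEquiv.ofBijective f ⟨fun m m' h => ?_, fun χ => ?_⟩⟩⟩
  · have h1 : e.symm (AddMonoidAlgebra.of K (Fin n → ℤ) (.ofAdd m)) =
        e.symm (AddMonoidAlgebra.of K (Fin n → ℤ) (.ofAdd m')) :=
      congrArg (fun χ => χ.toMul.val) h
    have h2 := congrArg e h1
    rw [e.apply_symm_apply, e.apply_symm_apply] at h2
    exact Multiplicative.ofAdd.injective (AddMonoidAlgebra.of_injective h2)
  · obtain ⟨m, hm⟩ := AddMonoidAlgebra.isGroupLikeElem_iff_mem_range_of.1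
      (χ.toMul.isGroupLikeElem_val.map e)
    refine ⟨m.toAdd, Additive.toMul.injective (GroupLike.ext ?_)⟩
    change e.symm (AddMonoidAlgebra.of K (Fin n → ℤ) m) = χ.toMul.val
    rw [hm, e.symm_apply_apply]

lemma isLattice_charModule (T : Torus F K) {N : Subgroup (K ≃ₐ[F] K)}
    (hN : ∀ σ ∈ N, ∀ χ, T.charModule.ρ σ χ = χ) : GaloisModule.IsLattice N T.charModule := by
  obtain ⟨n, ⟨e⟩⟩ := T.exists_addEquiv_charGroup
  exact .of_free (Module.Finite.equiv e.toIntLinearEquiv) (Module.Free.of_equiv e.toIntLinearEquiv)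
    hN

lemma exists_isOpen_galTensor [Algebra.IsIntegral F K] {C : Type u} [CommRing C] [Algebra F C]
    (x : K ⊗[F] C) : ∃ U : Subgroup (K ≃ₐ[F] K), IsOpen (U : Set (K ≃ₐ[F] K)) ∧
      ∀ σ ∈ U, galTensor C σ x = x := by
  induction x with
  | zero => exact ⟨⊤, isOpen_univ, fun σ _ => map_zero _⟩
  | add x y hx hy =>
    obtain ⟨U, hU, hx⟩ := hx
    obtain ⟨V, hV, hy⟩ := hy
    exact ⟨U ⊓ V, hU.inter hV, fun σ hσ => by rw [map_add, hx σ hσ.1, hy σ hσ.2]⟩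
  | tmul s a =>
    refine ⟨MulAction.stabilizer (K ≃ₐ[F] K) s, stabilizer_isOpen_of_isIntegral s, fun σ hσ => ?_⟩
    rw [galTensor_tmul, show σ s = s from hσ]

/-- The Galois action on the character module of a torus factors through a finite quotient. -/
lemma isOpen_ker_charModule [Algebra.IsIntegral F K] (T : Torus F K) :
    IsOpen (MonoidHom.ker (charRep F K T.coord) : Set (K ≃ₐ[F] K)) := by
  obtain ⟨n, ⟨e⟩⟩ := T.exists_addEquiv_charGroup
  have := Module.Finite.equiv e.toIntLinearEquiv
  obtain ⟨S, hS⟩ := (Module.Finite.fg_top : (⊤ : Submodule ℤ (CharGroup F K T.coord)).FG)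
  have hU (χ : CharGroup F K T.coord) : ∃ U : Subgroup (K ≃ₐ[F] K), IsOpen (U : Set (K ≃ₐ[F] K)) ∧
      ∀ σ ∈ U, charRep F K T.coord σ χ = χ := by
    obtain ⟨U, hU, h⟩ := exists_isOpen_galTensor χ.toMul.val
    exact ⟨U, hU, fun σ hσ => Additive.toMul.injective (GroupLike.ext (h σ hσ))⟩
  choose U hU hU' using hU
  refine Subgroup.isOpen_of_mem_nhds (g := 1) _ (Filter.mem_of_superset
    ((isOpen_biInter_finset (s := S) fun χ _ => hU χ).mem_nhds
      (Set.mem_iInter₂.2 fun χ _ => (U χ).one_mem)) fun σ hσ => ?_)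
  change charRep F K T.coord σ = 1
  refine LinearMap.ext_on hS fun χ hχ => ?_
  exact hU' χ σ (Set.mem_iInter₂.1 hσ χ hχ)

/-- Every continuous lattice is the character module of a torus. -/
theorem exists_charModule_iso [IsGalois F K] {V : Type u} [AddCommGroup V] [Module.Finite ℤ V]
    [Module.Free ℤ V] (ρ : Representation ℤ (K ≃ₐ[F] K) V) (hρ : ∀ m, IsOpen {σ | ρ σ m = m}) :
    ∃ T : Torus F K, Nonempty (T.charModule ≅ Rep.of ρ) := by
  obtain ⟨A, _, _, u, h, hg⟩ := exists_hopfAlgebra ρ hρ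
  let b := Module.finBasis ℤ V
  let f := AlgEquiv.ofBijective _ h.bijective
  have hf (m : V) : f (.single m 1) = u (.ofAdd m) := by
    change AddMonoidAlgebra.lift K (K ⊗[F] A) V u _ = _
    rw [AddMonoidAlgebra.lift_single, one_smul]
  let e : AddMonoidAlgebra K (Fin (Module.finrank ℤ V) → ℤ) ≃ₐ[K] K ⊗[F] A :=
    (AddMonoidAlgebra.domCongr K K b.equivFun.symm.toAddEquiv).trans f
  have he (m) : e (.single m 1) = u (.ofAdd (b.equivFun.symm m)) := by
    rw [← hf]
    change f (AddMonoidAlgebra.domCongr K K b.equivFun.symm.toAddEquiv (.single m 1)) = _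
    rw [AddMonoidAlgebra.domCongr_single]
    rfl
  let T : Torus F K :=
    { coord := A
      isForm := ⟨_, ⟨(BialgEquiv.ofAlgEquiv e
        (AddMonoidAlgebra.algHom_ext' (MonoidHom.ext fun m => by
          change Coalgebra.counit (R := K) (e (.single m.toAdd 1)) =
            Coalgebra.counit (R := K) (AddMonoidAlgebra.single m.toAdd (1 : K))
          rw [he, (hg _).counit_eq_one]
          simp) (by ext))
        (AddMonoidAlgebra.algHom_ext' (MonoidHom.ext fun m => by
          change Algebra.TensorProduct.map e.toAlgHom e.toAlgHom (Coalgebra.comul (R := K)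
            (AddMonoidAlgebra.single m.toAdd (1 : K))) =
              Coalgebra.comul (R := K) (e (.single m.toAdd 1))
          rw [he, (hg _).comul_eq_tmul_self, AddMonoidAlgebra.comul_single]
          simp [he]) (by ext))).symm⟩⟩ }
  let φ : V →+ CharGroup F K A :=
    { toFun := fun m => .ofMul ⟨u (.ofAdd m), hg _⟩
      map_zero' := Additive.toMul.injective (GroupLike.ext (map_one u))
      map_add' := fun m m' => Additive.toMul.injective (GroupLike.ext (map_mul u _ _)) }
  let φ' : Rep.of ρ ⟶ T.charModule := Rep.ofHom (ρ := ρ) (σ := charRep F K A)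
    ⟨φ.toIntLinearMap, fun σ => LinearMap.ext fun m => Additive.toMul.injective (GroupLike.ext
      (h.galTensor_apply σ m).symm)⟩
  have : Mono φ' := (Rep.mono_iff_injective φ').2 fun m m' hm =>
    Multiplicative.ofAdd.injective (h.injective (congrArg (fun χ => χ.toMul.val) hm))
  have : Epi φ' := (Rep.epi_iff_surjective φ').2 fun χ => by
    obtain ⟨m, hm⟩ := h.exists_eq hg χ.toMul.2
    exact ⟨m.toAdd, Additive.toMul.injective (GroupLike.ext hm)⟩
  have := isIso_of_mono_of_epi φ'
  exact ⟨T, ⟨(asIso φ').symm⟩⟩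

end Torus

namespace GaloisModule

variable {F K : Type u} [Field F] [Field K] [Algebra F K]

lemma IsLattice.exists_charModule_iso [IsGalois F K] {N : Subgroup (K ≃ₐ[F] K)}
    (hN : IsOpen (N : Set (K ≃ₐ[F] K))) {M : Rep.{u} ℤ (K ≃ₐ[F] K)} (hM : IsLattice N M) :
    ∃ T : Torus F K, Nonempty (T.charModule ≅ M) := by
  have h1 := hM.finite
  have h2 := hM.free
  have h3 := hM.trivial
  clear hM
  obtain @⟨V, a, m, ρ⟩ := M
  obtain rfl : m = AddCommGroup.toIntModule V := Subsingleton.elim _ _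
  change Module.Finite ℤ V at h1
  change Module.Free ℤ V at h2
  refine Torus.exists_charModule_iso ρ fun x => ?_
  let H : Subgroup (K ≃ₐ[F] K) :=
    { carrier := {σ | ρ σ x = x}
      one_mem' := by simp
      mul_mem' := fun {σ τ} hσ hτ => by
        change ρ (σ * τ) x = x
        rw [map_mul, Module.End.mul_apply, hτ, hσ]
      inv_mem' := fun {σ} hσ => by
        change ρ σ⁻¹ x = x
        conv_lhs => rw [← (show ρ σ x = x from hσ)]
        simp }
  exact Subgroup.isOpen_mono (H₂ := H) (fun σ hσ => h3 σ hσ x) hN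

variable {G : Type u} [Group G] [TopologicalSpace G] {M M' : Rep.{u} ℤ G}

lemma IsFlasque.of_iso (h : IsFlasque M) (e : M ≅ M') : IsFlasque M' := by
  intro P hP
  let := HasExt.standard (Rep.{u} ℤ G)
  have := h P hP
  refine subsingleton_of_forall_eq 0 fun x => ?_
  have h1 : (Abelian.Ext.mk₀ e.hom).comp x (zero_add 1) = 0 := Subsingleton.elim _ _
  have h2 := congrArg (fun y => (Abelian.Ext.mk₀ e.inv).comp y (zero_add 1)) h1
  simpa using h2

lemma IsCoflasque.of_iso (h : IsCoflasque M) (e : M ≅ M') : IsCoflasque M' := by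
  intro P hP
  let := HasExt.standard (Rep.{u} ℤ G)
  have := h P hP
  refine subsingleton_of_forall_eq 0 fun x => ?_
  have h1 : x.comp (Abelian.Ext.mk₀ e.inv) (add_zero 1) = 0 := Subsingleton.elim _ _
  have h2 := congrArg (fun y => y.comp (Abelian.Ext.mk₀ e.hom) (add_zero 1)) h1
  simpa using h2

attribute [local instance 2000] Rep.hV2 in
omit [TopologicalSpace G] in
lemma exists_linearEquiv_of_iso (e : M ≅ M') :
    ∃ l : M ≃ₗ[ℤ] M', ∀ g x, M'.ρ g (l x) = l (M.ρ g x) :=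
  ⟨.ofLinearMap e.hom.hom.toLinearMap e.inv.hom.toLinearMap
    (LinearMap.ext fun x => congrArg (fun f => f.hom x) e.inv_hom_id)
    (LinearMap.ext fun x => congrArg (fun f => f.hom x) e.hom_inv_id),
    fun g x => (Rep.hom_comm_apply e.hom g x).symm⟩

attribute [local instance 2000] Rep.hV2 in
lemma IsPermutation.of_iso (h : IsPermutation M) (e : M ≅ M') : IsPermutation M' := by
  obtain ⟨n, _, b, hb, ho⟩ := h.exists_mulAction
  obtain ⟨l, hl⟩ := exists_linearEquiv_of_iso e
  exact isPermutation_of_basis (b.map l) (fun g x => (hl g _).trans (congrArg l (hb g x))) ho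

end GaloisModule

/-! ### Quasitrivial tori -/

namespace Torus

variable {F K : Type u} [Field F] [Field K] [Algebra F K]

section Points

variable {A : Type u} [CommRing A] [HopfAlgebra F A] {B B' : Type u} [CommRing B] [Algebra F B]
  [CommRing B'] [Algebra F B']

variable (K) in
/-- The values of the characters at a point with coordinates in `B`. -/
def eval (t : A →ₐ[F] B) : Multiplicative (CharGroup F K A) →* (K ⊗[F] B)ˣ :=
  ((extend K t : K ⊗[F] A →* K ⊗[F] B).comp (charVal F K A)).toHomUnits

lemma val_eval (t : A →ₐ[F] B) (χ) : (eval K t χ : K ⊗[F] B) = extend K t (charVal F K A χ) := rfl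

lemma eval_comp (h : B →ₐ[F] B') (t : A →ₐ[F] B) (χ) :
    eval K (h.comp t) χ = Units.map (extend K h : K ⊗[F] B →* K ⊗[F] B') (eval K t χ) :=
  Units.ext (extend_comp h t _)

lemma eval_mul (t t' : WithConv (A →ₐ[F] B)) (χ) :
    eval K (t * t').ofConv χ = eval K t.ofConv χ * eval K t'.ofConv χ := by
  refine Units.ext ?_
  rw [Units.val_mul, val_eval, val_eval, val_eval, AlgHom.convMul_def]
  rw [extend_comp, extend_comp, (isGroupLikeElem_iff.1 (isGroupLikeElem_charVal χ)).2, map_mul,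
    map_mul, extendLeft, extendRight, ← extend_comp, ← extend_comp, ← extend_comp, ← extend_comp]
  congr 3 <;> exact AlgHom.ext fun a => by simp

/-- The Galois action on the units of `K ⊗ B`. -/
def galUnits (B : Type u) [CommRing B] [Algebra F B] (σ : K ≃ₐ[F] K) : (K ⊗[F] B)ˣ →* (K ⊗[F] B)ˣ :=
  Units.map (galTensor B σ : K ⊗[F] B →* K ⊗[F] B)

lemma galUnits_eval (σ : K ≃ₐ[F] K) (t : A →ₐ[F] B) (χ) :
    galUnits B σ (eval K t (.ofAdd χ)) = eval K t (.ofAdd (charRep F K A σ χ)) :=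
  Units.ext (galTensor_extend σ t _)

/-- The embedding of the units of `E ⊗ B` in those of `K ⊗ B`. -/
def unitsMap {E : Type u} [Field E] [Algebra F E] (φ : E →ₐ[F] K) (B : Type u) [CommRing B]
    [Algebra F B] : (E ⊗[F] B)ˣ →* (K ⊗[F] B)ˣ :=
  Units.map (Algebra.TensorProduct.map φ (AlgHom.id F B) : E ⊗[F] B →* K ⊗[F] B)

lemma unitsMap_injective {E : Type u} [Field E] [Algebra F E] (φ : E →ₐ[F] K) :
    Function.Injective (unitsMap φ B) :=
  Units.map_injective (map_injective φ)

lemma exists_unitsMap_eq [IsGalois F K] {E : Type u} [Field E] [Algebra F E] (φ : E →ₐ[F] K)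
    (w : (K ⊗[F] B)ˣ)
    (hw : ∀ σ : K ≃ₐ[F] K, (∀ x, σ (φ x) = φ x) → galUnits B σ w = w) :
    ∃ z, unitsMap φ B z = w := by
  obtain ⟨y, hy⟩ := exists_map_eq_of_fixed φ (w : K ⊗[F] B)
    fun σ hσ => congrArg Units.val (hw σ hσ)
  obtain ⟨y', hy'⟩ := exists_map_eq_of_fixed φ ((w⁻¹ : (K ⊗[F] B)ˣ) : K ⊗[F] B) fun σ hσ => by
    have := congrArg (fun v : (K ⊗[F] B)ˣ => ((v⁻¹ : (K ⊗[F] B)ˣ) : K ⊗[F] B)) (hw σ hσ)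
    exact this
  exact ⟨⟨y, y', map_injective φ (by rw [map_mul, hy, hy', map_one, Units.mul_inv]),
    map_injective φ (by rw [map_mul, hy, hy', map_one, Units.inv_mul])⟩, Units.ext hy⟩

/-- The points of a torus whose character module has a basis `X` permuted by the Galois group are
the equivariant maps from `X` to the units of `K ⊗ B`. If the stabilizers of representatives
`x i` of the orbits are the Galois groups of the fields `E i`, these maps correspond to the families
of units of the algebras `E i ⊗ B`. -/
theorem exists_points_mulEquiv [IsGalois F K] {X : Type*} [MulAction (K ≃ₐ[F] K) X]
    (hA : IsMultiplicative F K A) (b : Module.Basis X ℤ (CharGroup F K A))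
    (hb : ∀ σ y, charRep F K A σ (b y) = b (σ • y)) {m : ℕ} (x : Fin m → X)
    (hx : ∀ y, ∃ i, ∃ σ : K ≃ₐ[F] K, σ • x i = y)
    (hx' : ∀ (i j) (σ : K ≃ₐ[F] K), σ • x i = x j → i = j)
    (E : Fin m → Type u) [∀ i, Field (E i)] [∀ i, Algebra F (E i)] (φ : ∀ i, E i →ₐ[F] K)
    (hφ : ∀ (i) (σ : K ≃ₐ[F] K), σ • x i = x i ↔ ∀ e, σ (φ i e) = φ i e) :
    ∃ Φ : ∀ (B : Type u) [CommRing B] [Algebra F B],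
      WithConv (A →ₐ[F] B) ≃* (∀ i, (E i ⊗[F] B)ˣ),
      ∀ (B B' : Type u) [CommRing B] [Algebra F B] [CommRing B'] [Algebra F B'] (h : B →ₐ[F] B')
        (t : A →ₐ[F] B) (i : Fin m),
        Φ B' (WithConv.toConv (h.comp t)) i =
          Units.map (Algebra.TensorProduct.map (AlgHom.id F (E i)) h : E i ⊗[F] B →* E i ⊗[F] B')
            (Φ B (WithConv.toConv t) i) := by
  have hex (B : Type u) [CommRing B] [Algebra F B] (t : A →ₐ[F] B) (i) :
      ∃ z, unitsMap (φ i) B z = eval K t (.ofAdd (b (x i))) :=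
    exists_unitsMap_eq (φ i) _ fun σ hσ => by rw [galUnits_eval, hb, (hφ i σ).2 hσ]
  choose f hf using hex
  -- a point is determined by the values of the characters `b y`, and these by those of the `b (x i)`
  have hinj (B : Type u) [CommRing B] [Algebra F B] : Function.Injective (f B) := by
    intro t t' htt'
    have h1 (y) : eval K t (.ofAdd (b y)) = eval K t' (.ofAdd (b y)) := by
      obtain ⟨i, σ, rfl⟩ := hx y
      rw [← hb, ← galUnits_eval, ← galUnits_eval, ← hf, ← hf, htt']
    have h2 : (MonoidHom.toAdditive (eval K t)).toIntLinearMap =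
        (MonoidHom.toAdditive (eval K t')).toIntLinearMap := b.ext h1
    refine hA.isDiagonal.algHom_ext fun χ => ?_
    exact congrArg Units.val (LinearMap.congr_fun h2 χ.toAdd)
  have hsurj (B : Type u) [CommRing B] [Algebra F B] : Function.Surjective (f B) := by
    intro z
    let : MulAction (K ≃ₐ[F] K) (K ⊗[F] B)ˣ :=
      { smul := fun σ w => galUnits B σ w
        one_smul := fun w => Units.ext (by
          change Algebra.TensorProduct.map (AlgHom.id F K) (AlgHom.id F B) w.val = w.val
          rw [Algebra.TensorProduct.map_id]
          rfl)
        mul_smul := fun σ τ w => Units.ext (by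
          change galTensor B (σ * τ) w.val = galTensor B σ (galTensor B τ w.val)
          induction w.val with
          | zero => simp
          | add x y hx hy => simp only [map_add, hx, hy]
          | tmul s a => rfl) }
    -- the units `z i` extend to an equivariant map from `X` to the units of `K ⊗ B`
    obtain ⟨s, hs, hs'⟩ := GaloisModule.exists_equivariant_choice (G := K ≃ₐ[F] K) (X := X)
      (E := (K ⊗[F] B)ˣ)
      (fun y w => ∃ i, ∃ σ : K ≃ₐ[F] K, σ • x i = y ∧ σ • unitsMap (φ i) B (z i) = w)
      (fun τ y w ⟨i, σ, h1, h2⟩ => ⟨i, τ * σ, by rw [mul_smul, h1], by rw [mul_smul, h2]⟩)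
      (fun y => by
        obtain ⟨i, σ, rfl⟩ := hx y
        refine ⟨_, ⟨i, σ, rfl, rfl⟩, fun τ hτ => ?_⟩
        rw [MulAction.mem_stabilizer_iff, smul_smul, ← inv_smul_eq_iff, smul_smul, hφ] at hτ
        rw [smul_smul, ← inv_smul_eq_iff, smul_smul]
        refine Units.ext ((galTensor_map _ _ _).trans ?_)
        rw [show ((σ⁻¹ * (τ * σ) : K ≃ₐ[F] K) : K →ₐ[F] K).comp (φ i) = φ i from AlgHom.ext hτ]
        rfl)
    have hsx (i) : s (x i) = unitsMap (φ i) B (z i) := by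
      obtain ⟨j, σ, h1, h2⟩ := hs (x i)
      obtain rfl := hx' j i σ h1
      rw [hφ] at h1
      rw [← h2]
      refine Units.ext ((galTensor_map _ _ _).trans ?_)
      rw [show ((σ : K ≃ₐ[F] K) : K →ₐ[F] K).comp (φ j) = φ j from AlgHom.ext h1]
      rfl
    let v : CharGroup F K A →ₗ[ℤ] Additive (K ⊗[F] B)ˣ := b.constr ℕ fun y => .ofMul (s y)
    have hv (y) : v (b y) = .ofMul (s y) := b.constr_basis ℕ _ y
    have hvσ (σ : K ≃ₐ[F] K) (χ : CharGroup F K A) :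
        galUnits B σ (v χ).toMul = (v (charRep F K A σ χ)).toMul := by
      have : (MonoidHom.toAdditive (galUnits B σ)).toIntLinearMap ∘ₗ v = v ∘ₗ charRep F K A σ :=
        b.ext fun y => by
          rw [LinearMap.comp_apply, LinearMap.comp_apply, hv, hb, hv, hs']
          rfl
      exact LinearMap.congr_fun this χ
    obtain ⟨t, ht⟩ := hA.isDiagonal.exists_algHom
      ((Units.coeHom (K ⊗[F] B)).comp (AddMonoidHom.toMultiplicativeLeft v.toAddMonoidHom))
      fun σ χ => congrArg Units.val (hvσ σ χ)
    refine ⟨t, funext fun i => unitsMap_injective (φ i) ?_⟩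
    rw [hf, ← hsx]
    refine Units.ext ?_
    rw [val_eval, ht]
    exact congrArg (fun w : Additive (K ⊗[F] B)ˣ => w.toMul.val) (hv (x i))
  refine ⟨fun B _ _ => MulEquiv.ofBijective
    (MonoidHom.mk' (fun t : WithConv (A →ₐ[F] B) => f B t.ofConv) fun t t' => ?_)
    ⟨fun t t' h => WithConv.ofConv_injective (hinj B h), fun z => ?_⟩, ?_⟩
  · refine funext fun i => unitsMap_injective (φ i) ?_
    rw [hf, Pi.mul_apply, map_mul, hf, hf, eval_mul]
  · obtain ⟨t, ht⟩ := hsurj B z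
    exact ⟨.toConv t, ht⟩
  · intro B B' _ _ _ _ h t i
    refine unitsMap_injective (φ i) ?_
    change unitsMap (φ i) B' (f B' (h.comp t) i) = unitsMap (φ i) B' (Units.map _ (f B t i))
    rw [hf, eval_comp, ← hf]
    refine Units.ext ?_
    change extend K h (Algebra.TensorProduct.map (φ i) (AlgHom.id F B) (f B t i).val) =
      Algebra.TensorProduct.map (φ i) (AlgHom.id F B')
        (Algebra.TensorProduct.map (AlgHom.id F (E i)) h (f B t i).val)
    induction (f B t i).val with
    | zero => simp
    | add x y hx hy => simp only [map_add, hx, hy]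
    | tmul s a => rfl

/-- Yoneda's lemma: affine group schemes with the same points are isomorphic. -/
theorem nonempty_bialgEquiv_of_points {A' : Type u} [CommRing A'] [HopfAlgebra F A']
    (Φ : ∀ (B : Type u) [CommRing B] [Algebra F B],
      WithConv (A →ₐ[F] B) ≃* WithConv (A' →ₐ[F] B))
    (hΦ : ∀ (B B' : Type u) [CommRing B] [Algebra F B] [CommRing B'] [Algebra F B']
      (h : B →ₐ[F] B') (t : A →ₐ[F] B),
      Φ B' (.toConv (h.comp t)) = .toConv (h.comp (Φ B (.toConv t)).ofConv)) :
    Nonempty (A' ≃ₐc[F] A) := by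
  -- every point is the image of the universal one
  have hf {B : Type u} [CommRing B] [Algebra F B] (t : A →ₐ[F] B) :
      t.comp (Φ A (.toConv (AlgHom.id F A))).ofConv = (Φ B (.toConv t)).ofConv := by
    have := hΦ A B t (AlgHom.id F A)
    rw [AlgHom.comp_id] at this
    rw [this]
  obtain ⟨g, hg⟩ := (Φ A').surjective (.toConv (AlgHom.id F A'))
  have hfg : (g.ofConv.comp (Φ A (.toConv (AlgHom.id F A))).ofConv) = AlgHom.id F A' := by
    rw [hf, WithConv.toConv_ofConv, hg]
  have hgf : ((Φ A (.toConv (AlgHom.id F A))).ofConv.comp g.ofConv) = AlgHom.id F A := by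
    refine WithConv.toConv_injective ((Φ A).injective (WithConv.ofConv_injective ?_))
    rw [← hf, AlgHom.comp_assoc, hfg, AlgHom.comp_id]
  refine ⟨BialgEquiv.ofBijective
    (BialgHom.ofAlgHom (Φ A (.toConv (AlgHom.id F A))).ofConv ?_ ?_)
    (Function.bijective_iff_has_inverse.2 ⟨g.ofConv, DFunLike.congr_fun hfg,
      DFunLike.congr_fun hgf⟩)⟩
  · rw [hf]
    have h1 : (.toConv (Bialgebra.counitAlgHom F A) : WithConv (A →ₐ[F] F)) = 1 := by
      rw [AlgHom.convOne_def]
      congr 1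
    have h2 : (1 : WithConv (A' →ₐ[F] F)) = .toConv (Bialgebra.counitAlgHom F A') := by
      rw [AlgHom.convOne_def]
      congr 1
    rw [h1, map_one, h2]
  · rw [hf]
    have hcomul {C : Type u} [CommRing C] [HopfAlgebra F C] {B : Type u} [CommRing B] [Algebra F B]
        (t t' : C →ₐ[F] B) : (Algebra.TensorProduct.map t t').comp (Bialgebra.comulAlgHom F C) =
        (WithConv.toConv ((Algebra.TensorProduct.includeLeft : B →ₐ[F] B ⊗[F] B).comp t) *
          WithConv.toConv
            ((Algebra.TensorProduct.includeRight : B →ₐ[F] B ⊗[F] B).comp t')).ofConv := by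
      rw [AlgHom.convMul_def]
      change _ = (Algebra.TensorProduct.lmul' F).comp _
      rw [← AlgHom.comp_assoc]
      congr 1
      exact Algebra.TensorProduct.ext' fun a b => by simp
    have h1 := hcomul (AlgHom.id F A) (AlgHom.id F A)
    rw [Algebra.TensorProduct.map_id, AlgHom.id_comp, AlgHom.comp_id, AlgHom.comp_id] at h1
    rw [hcomul, hf, hf, WithConv.toConv_ofConv, WithConv.toConv_ofConv, ← map_mul, h1,
      WithConv.toConv_ofConv]

end Points

variable [IsGalois F K]

/-- A torus whose character module is a permutation lattice is quasitrivial. -/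
theorem isQuasitrivial_of_isPermutation {T : Torus F K}
    (hT : GaloisModule.IsPermutation T.charModule) : T.IsQuasitrivial := by
  obtain ⟨n, _, b, hb, ho⟩ := hT.exists_mulAction
  let Ω := MulAction.orbitRel.Quotient (K ≃ₐ[F] K) (Fin n)
  have : Finite Ω := Quotient.finite _
  obtain ⟨m, ⟨e⟩⟩ := Finite.exists_equiv_fin Ω
  let x (i : Fin m) : Fin n := (e.symm i).out
  have hx (i) : (Quotient.mk _ (x i) : Ω) = e.symm i := Quotient.out_eq _
  -- the factors are the fixed fields of the stabilizers of representatives `x i` of the orbits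
  let H (i : Fin m) : Subgroup (K ≃ₐ[F] K) := MulAction.stabilizer _ (x i)
  have hH (i) : IsOpen (H i : Set (K ≃ₐ[F] K)) := ho (x i)
  have hfix (i) : (IntermediateField.fixedField (H i)).fixingSubgroup = H i :=
    InfiniteGalois.fixingSubgroup_fixedField ⟨H i, (H i).isClosed_of_isOpen (hH i)⟩
  refine ⟨m, fun i => IntermediateField.fixedField (H i), inferInstance, inferInstance,
    fun i => ?_, fun i => inferInstance, ?_⟩
  · refine (InfiniteGalois.isOpen_iff_finite _).1 ?_
    rw [hfix]
    exact hH i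
  · refine exists_points_mulEquiv T.isMultiplicative b hb x (fun y => ?_) (fun i j σ h => ?_) _
      (fun i => (IntermediateField.fixedField (H i)).val) (fun i σ => ?_)
    · refine ⟨e (Quotient.mk _ y), ?_⟩
      have h1 := hx (e (Quotient.mk _ y))
      rw [e.symm_apply_apply] at h1
      exact MulAction.mem_orbit_symm.1 (MulAction.orbitRel_apply.1 (Quotient.exact h1))
    · have h1 : (Quotient.mk _ (x j) : Ω) = Quotient.mk _ (x i) :=
        Quotient.sound (MulAction.orbitRel_apply.2 ⟨σ, h⟩)
      rw [hx, hx] at h1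
      exact e.symm.injective h1.symm
    · change σ ∈ H i ↔ _
      refine (show σ ∈ H i ↔ σ ∈ (IntermediateField.fixedField (H i)).fixingSubgroup by
        rw [hfix i]).trans ?_
      rw [IntermediateField.mem_fixingSubgroup_iff]
      exact (Subtype.forall (p := fun e => e ∈ IntermediateField.fixedField (H i))
        (q := fun e => σ e = e)).symm

/-- The Galois group acts transitively on the embeddings of an extension in `K`. -/
lemma exists_comp_eq {E : Type*} [Field E] [Algebra F E] (φ ψ : E →ₐ[F] K) :
    ∃ σ : K ≃ₐ[F] K, (σ : K →ₐ[F] K).comp φ = ψ := by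
  refine ⟨(φ.equivFieldRange.symm.trans ψ.equivFieldRange).liftNormal K, AlgHom.ext fun x => ?_⟩
  have h := (φ.equivFieldRange.symm.trans ψ.equivFieldRange).liftNormal_commutes K
    (φ.equivFieldRange x)
  rw [AlgEquiv.trans_apply, AlgEquiv.symm_apply_apply] at h
  exact h

/-- The character module of a quasitrivial torus is a permutation lattice, with basis the union
of the sets of embeddings in `K` of the fields `E i`. -/
theorem isPermutation_of_isQuasitrivial [IsSepClosed K] {T : Torus F K} (hT : T.IsQuasitrivial) :
    GaloisModule.IsPermutation T.charModule := by
  obtain ⟨m, E, _, _, hfin, hsep, Φ, hΦ⟩ := hT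
  let X := Σ i, (E i →ₐ[F] K)
  have : Finite X := inferInstance
  let : MulAction (K ≃ₐ[F] K) X :=
    { smul := fun σ x => ⟨x.1, (σ : K →ₐ[F] K).comp x.2⟩
      one_smul := fun x => rfl
      mul_smul := fun σ τ x => rfl }
  have hsmul (σ : K ≃ₐ[F] K) (i) (ψ : E i →ₐ[F] K) :
    σ • (⟨i, ψ⟩ : X) = ⟨i, (σ : K →ₐ[F] K).comp ψ⟩ := rfl
  have hstab (σ : K ≃ₐ[F] K) (i) (ψ : E i →ₐ[F] K) :
      σ • (⟨i, ψ⟩ : X) = ⟨i, ψ⟩ ↔ ∀ e, σ (ψ e) = ψ e := by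
    rw [hsmul, Sigma.mk.injEq, heq_eq_eq, AlgHom.ext_iff]
    simp
  have ho (x : X) : IsOpen (MulAction.stabilizer (K ≃ₐ[F] K) x : Set (K ≃ₐ[F] K)) := by
    obtain ⟨i, ψ⟩ := x
    have : FiniteDimensional F ψ.fieldRange :=
      Module.Finite.of_surjective ψ.rangeRestrict.toLinearMap ψ.rangeRestrict_surjective
    refine Subgroup.isOpen_mono (fun σ hσ => ?_) ψ.fieldRange.fixingSubgroup_isOpen
    rw [MulAction.mem_stabilizer_iff, hstab]
    exact fun e => (IntermediateField.mem_fixingSubgroup_iff _ _).1 hσ _ ⟨e, rfl⟩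
  have hN : IsOpen ((⨅ x : X, MulAction.stabilizer (K ≃ₐ[F] K) x : Subgroup (K ≃ₐ[F] K)) :
      Set (K ≃ₐ[F] K)) := by
    rw [Subgroup.coe_iInf]
    exact isOpen_iInter_of_finite ho
  have hlat : GaloisModule.IsLattice (⨅ x : X, MulAction.stabilizer (K ≃ₐ[F] K) x)
      (Rep.of (GaloisModule.permRep (K ≃ₐ[F] K) X)) := by
    refine .of_free (inferInstanceAs (Module.Finite ℤ (X →₀ ℤ)))
      (inferInstanceAs (Module.Free ℤ (X →₀ ℤ))) fun σ hσ => ?_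
    have : GaloisModule.permRep (K ≃ₐ[F] K) X σ = LinearMap.id :=
      Finsupp.basisSingleOne.ext fun x => by
        rw [GaloisModule.permRep_basisSingleOne, (Subgroup.mem_iInf.1 hσ x :)]
        rfl
    exact LinearMap.congr_fun this
  -- the torus with character module `ℤ[X]` has the same points as `T`
  obtain ⟨T', ⟨e⟩⟩ := hlat.exists_charModule_iso hN
  obtain ⟨l, hl⟩ := GaloisModule.exists_linearEquiv_of_iso e.symm
  let b : Module.Basis X ℤ T'.charModule := Finsupp.basisSingleOne.map l
  have hb (σ : K ≃ₐ[F] K) (x : X) : T'.charModule.ρ σ (b x) = b (σ • x) :=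
    (hl σ _).trans (congrArg l (GaloisModule.permRep_basisSingleOne σ x))
  obtain ⟨Φ', hΦ'⟩ := exists_points_mulEquiv T'.isMultiplicative b hb
    (fun i => ⟨i, IsSepClosed.lift⟩) (fun ⟨i, ψ⟩ => ⟨i, by
      obtain ⟨σ, hσ⟩ := exists_comp_eq (IsSepClosed.lift : E i →ₐ[F] K) ψ
      exact ⟨σ, by rw [hsmul, hσ]⟩⟩)
    (fun i j σ h => congrArg Sigma.fst h) E (fun i => IsSepClosed.lift)
    (fun i σ => hstab σ i _)
  obtain ⟨f⟩ := nonempty_bialgEquiv_of_points (fun B _ _ => (Φ B).trans (Φ' B).symm)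
    (fun B B' _ _ _ _ h t => by
      apply (Φ' B').injective
      refine funext fun i => ?_
      rw [hΦ']
      change Φ' B' ((Φ' B').symm _) i = Units.map _ (Φ' B ((Φ' B).symm _) i)
      rw [MulEquiv.apply_symm_apply, MulEquiv.apply_symm_apply]
      exact hΦ B B' h t i)
  let e' : T ≅ T' := ⟨(f : T'.coord →ₐc[F] T.coord), (f.symm : T.coord →ₐc[F] T'.coord),
    BialgHom.ext fun x => f.apply_symm_apply x, BialgHom.ext fun x => f.symm_apply_apply x⟩
  exact (GaloisModule.isPermutation_of_basis b hb ho).of_iso ((charFunctor F K).mapIso e').unop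

end Torus

/-! ### Resolutions of complexes of tori -/

section Opposite

variable {C : Type u} [Category.{v} C]

lemma bicartesianSq_op {W X Y Z : C} {f : W ⟶ X} {g : W ⟶ Y} {h : X ⟶ Z} {i : Y ⟶ Z}
    (sq : BicartesianSq f g h i) : BicartesianSq i.op h.op g.op f.op :=
  .of_isPullback_isPushout sq.toIsPushout.op sq.toIsPullback.op

lemma bicartesianSq_op_of_iso {A B X Y : C} (a : A ≅ Y) (b : B ≅ X) (ψ : X ⟶ Y) :
    BicartesianSq (b.hom ≫ ψ ≫ a.inv).op a.inv.op b.inv.op ψ.op :=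
  have w : CommSq (b.hom ≫ ψ ≫ a.inv).op a.inv.op b.inv.op ψ.op :=
    ⟨by rw [← op_comp, ← op_comp, b.inv_hom_id_assoc]⟩
  .of_isPullback_isPushout (.of_vert_isIso w) (.of_vert_isIso w)

end Opposite

namespace GaloisModule

-- `ℤ`-linear maps and bases refer to the module structure which is part of a representation.
attribute [local instance 2000] Rep.hV2

variable {G : Type u} [Group G]

/-- The elements of the direct sum formed in the opposite category. -/
lemma exists_addEquiv_biprod_op (M N : Rep.{u} ℤ G) :
    ∃ l : (Opposite.op M ⊞ Opposite.op N).unop ≃+ M × N,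
      ∀ g w, l ((Opposite.op M ⊞ Opposite.op N).unop.ρ g w) = (M.ρ g (l w).1, N.ρ g (l w).2) := by
  have h {A B : (Rep.{u} ℤ G)ᵒᵖ} (f g : A ⟶ B) (h : f = g) (x : B.unop) :
    f.unop.hom x = g.unop.hom x := by rw [h]
  let i₁ := (biprod.inl : Opposite.op M ⟶ Opposite.op M ⊞ Opposite.op N)
  let i₂ := (biprod.inr : Opposite.op N ⟶ Opposite.op M ⊞ Opposite.op N)
  let p₁ := (biprod.fst : Opposite.op M ⊞ Opposite.op N ⟶ Opposite.op M)
  let p₂ := (biprod.snd : Opposite.op M ⊞ Opposite.op N ⟶ Opposite.op N)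
  refine ⟨⟨⟨fun w => (i₁.unop.hom w, i₂.unop.hom w),
    fun x => p₁.unop.hom x.1 + p₂.unop.hom x.2, fun w => ?_, fun x => ?_⟩,
    fun w w' => ?_⟩, fun g w => ?_⟩
  · exact h _ _ biprod.total w
  · refine Prod.ext ?_ ?_
    · exact (map_add i₁.unop.hom _ _).trans ((congrArg₂ _ (h _ _ biprod.inl_fst x.1)
        (h _ _ biprod.inl_snd x.2)).trans (add_zero x.1))
    · exact (map_add i₂.unop.hom _ _).trans ((congrArg₂ _ (h _ _ biprod.inr_fst x.1)
        (h _ _ biprod.inr_snd x.2)).trans (zero_add x.2))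
  · exact Prod.ext (map_add i₁.unop.hom _ _) (map_add i₂.unop.hom _ _)
  · exact Prod.ext (Rep.hom_comm_apply i₁.unop g w) (Rep.hom_comm_apply i₂.unop g w)

lemma exists_addEquiv_of_biprod_op_iso {M N M' N' : Rep.{u} ℤ G}
    (θ : Opposite.op M ⊞ Opposite.op N ≅ Opposite.op M' ⊞ Opposite.op N') :
    ∃ l : M × N ≃+ M' × N',
      ∀ g x, l (M.ρ g x.1, N.ρ g x.2) = (M'.ρ g (l x).1, N'.ρ g (l x).2) := by
  obtain ⟨l, hl⟩ := exists_addEquiv_biprod_op M N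
  obtain ⟨l', hl'⟩ := exists_addEquiv_biprod_op M' N'
  obtain ⟨m, hm⟩ := exists_linearEquiv_of_iso θ.symm.unop
  refine ⟨(l.symm.trans m.toAddEquiv).trans l', fun g x => ?_⟩
  obtain ⟨w, rfl⟩ := l.surjective x
  rw [← hl]
  change l' (m (l.symm (l _))) =
    (M'.ρ g (l' (m (l.symm (l w)))).1, N'.ρ g (l' (m (l.symm (l w)))).2)
  rw [l.symm_apply_apply, l.symm_apply_apply, ← hl']
  exact congrArg l' (hm g w).symm

end GaloisModule

namespace Torus

variable {F K : Type u} [Field F] [Field K] [Algebra F K] [IsGalois F K]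

/-- Products of groups of multiplicative type are isomorphic if the direct sums of their groups of
characters are. -/
theorem IsMultiplicative.nonempty_bialgEquiv_tensorProduct {A B A' B' : Type u}
    [CommRing A] [HopfAlgebra F A] [CommRing B] [HopfAlgebra F B] [CommRing A']
    [HopfAlgebra F A'] [CommRing B'] [HopfAlgebra F B'] (hA : IsMultiplicative F K A)
    (hB : IsMultiplicative F K B) (hA' : IsMultiplicative F K A') (hB' : IsMultiplicative F K B')
    (l : CharGroup F K A × CharGroup F K B ≃+ CharGroup F K A' × CharGroup F K B')
    (hl : ∀ σ x, l (charRep F K A σ x.1, charRep F K B σ x.2) =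
      (charRep F K A' σ (l x).1, charRep F K B' σ (l x).2)) :
    Nonempty (A ⊗[F] B ≃ₐc[F] A' ⊗[F] B') := by
  obtain ⟨h, e, he⟩ := exists_charRep_tensorProduct hA hB
  obtain ⟨h', e', he'⟩ := exists_charRep_tensorProduct hA' hB'
  refine h.nonempty_bialgEquiv h' ((e.symm.trans l).trans e') fun σ χ => ?_
  obtain ⟨x, rfl⟩ := e.surjective χ
  rw [← he]
  change e' (l (e.symm (e _))) = charRep F K _ σ (e' (l (e.symm (e x))))
  rw [AddEquiv.symm_apply_apply, AddEquiv.symm_apply_apply, ← he']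
  exact congrArg e' (hl σ x)

end Torus

namespace TorusResolution

open Torus

variable {F K : Type u} [Field F] [Field K] [Algebra F K] [IsGalois F K] {T₁ T₂ : Torus F K}
  {d : T₁ ⟶ T₂}

/-- Schanuel's lemma for resolutions. -/
theorem nonempty_bialgEquiv {R R' : TorusResolution d}
    (h : TwoTerm.NoExtension ((charFunctor F K).obj R.right) ((charFunctor F K).obj R'.left))
    (h' : TwoTerm.NoExtension ((charFunctor F K).obj R'.right) ((charFunctor F K).obj R.left)) :
    Nonempty (R.left.coord ⊗[F] R'.right.coord ≃ₐc[F] R'.left.coord ⊗[F] R.right.coord) := by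
  obtain ⟨θ⟩ := TwoTerm.nonempty_biprod_iso R.iso R'.iso h h'
  obtain ⟨l, hl⟩ := GaloisModule.exists_addEquiv_of_biprod_op_iso θ
  exact R.left.isMultiplicative.nonempty_bialgEquiv_tensorProduct R'.right.isMultiplicative
    R'.left.isMultiplicative R.right.isMultiplicative l hl

theorem lifts_of_noExtension {T₁' T₂' : Torus F K} {d' : T₁' ⟶ T₂'} {R : TorusResolution d}
    {R' : TorusResolution d'}
    (h : TwoTerm.NoExtension ((charFunctor F K).obj R.right) ((charFunctor F K).obj R'.left))
    (f : twoTerm d ⟶ twoTerm d') : R.Lifts R' f := by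
  obtain ⟨a, b, φ, h1, h2, h3⟩ := TwoTerm.exists_triangle_hom R.iso R'.iso h f
  obtain ⟨a, rfl⟩ := (charFunctor F K).map_surjective a
  obtain ⟨b, rfl⟩ := (charFunctor F K).map_surjective b
  exact ⟨a, b, φ, h1, h2, h3⟩

/-- `Ext¹(Ŝ', Q̂) = 0` for `S'` flasque and `Q` quasitrivial. -/
lemma IsFlasque.noExtension [IsSepClosed K] {T₁' T₂' : Torus F K} {d' : T₁' ⟶ T₂'}
    {R : TorusResolution d} {R' : TorusResolution d'} (h : R.IsFlasque) (h' : R'.IsFlasque) :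
    TwoTerm.NoExtension ((charFunctor F K).obj R.right) ((charFunctor F K).obj R'.left) := by
  let := HasExt.standard (Rep.{u} ℤ (K ≃ₐ[F] K))
  exact noExtension_op (h'.1 _ (isPermutation_of_isQuasitrivial h.2))

/-- `Ext¹(P̂', R̂) = 0` for `P'` quasitrivial and `R` coflasque. -/
lemma IsCoflasque.noExtension [IsSepClosed K] {T₁' T₂' : Torus F K} {d' : T₁' ⟶ T₂'}
    {R : TorusResolution d} {R' : TorusResolution d'} (h : R.IsCoflasque) (h' : R'.IsCoflasque) :
    TwoTerm.NoExtension ((charFunctor F K).obj R.right) ((charFunctor F K).obj R'.left) := by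
  let := HasExt.standard (Rep.{u} ℤ (K ≃ₐ[F] K))
  exact noExtension_op (h.2 _ (isPermutation_of_isQuasitrivial h'.1))

/-- Cartier duality turns a two-term complex of lattices with the right class in the derived
category into a resolution. -/
lemma exists_of_isLattice {N : Subgroup (K ≃ₐ[F] K)} (hN : IsOpen (N : Set (K ≃ₐ[F] K)))
    {X Y : Rep.{u} ℤ (K ≃ₐ[F] K)} (hX : GaloisModule.IsLattice N X)
    (hY : GaloisModule.IsLattice N Y) (ψ : X ⟶ Y)
    (θ : DerivedCategory.Q.obj (TwoTerm.complex ψ.op) ≅ twoTerm d) :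
    ∃ R : TorusResolution d,
      Nonempty (R.left.charModule ≅ Y) ∧ Nonempty (R.right.charModule ≅ X) := by
  obtain ⟨A, ⟨a⟩⟩ := hY.exists_charModule_iso hN
  obtain ⟨B, ⟨b⟩⟩ := hX.exists_charModule_iso hN
  obtain ⟨f, hf⟩ := (charFunctor F K).map_surjective (X := A) (Y := B) (b.hom ≫ ψ ≫ a.inv).op
  have sq : BicartesianSq ((charFunctor F K).map f) a.inv.op b.inv.op ψ.op :=
    hf ▸ bicartesianSq_op_of_iso a b ψ
  exact ⟨⟨A, B, f, TwoTerm.isoOfBicartesian sq ≪≫ θ⟩, ⟨a⟩, ⟨b⟩⟩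

end TorusResolution

namespace Torus

variable {F K : Type u} [Field F] [Field K] [Algebra F K]

lemma ρ_apply_eq_of_iso {N : Subgroup (K ≃ₐ[F] K)} {T : Torus F K} {M : Rep.{u} ℤ (K ≃ₐ[F] K)}
    (hM : GaloisModule.IsLattice N M) (e : T.charModule ≅ M) {σ : K ≃ₐ[F] K} (hσ : σ ∈ N)
    (χ : T.charModule) : T.charModule.ρ σ χ = χ := by
  obtain ⟨l, hl⟩ := GaloisModule.exists_linearEquiv_of_iso e
  apply l.injective
  rw [← hl, hM.trivial σ hσ]

variable [IsGalois F K] {T₁ T₂ : Torus F K} (d : T₁ ⟶ T₂)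

/-- If an open subgroup `N` of the Galois group acts trivially on the characters of `T₁` and `T₂`, there
are a flasque and a coflasque resolution by tori on whose characters `N` acts trivially. -/
theorem exists_torusResolution {N : Subgroup (K ≃ₐ[F] K)} (hN : IsOpen (N : Set (K ≃ₐ[F] K)))
    (h₁ : ∀ σ ∈ N, ∀ χ, T₁.charModule.ρ σ χ = χ) (h₂ : ∀ σ ∈ N, ∀ χ, T₂.charModule.ρ σ χ = χ) :
    (∃ R : TorusResolution d, R.IsFlasque ∧ ∀ σ ∈ N,
      (∀ χ, R.left.charModule.ρ σ χ = χ) ∧ ∀ χ, R.right.charModule.ρ σ χ = χ) ∧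
    ∃ R : TorusResolution d, R.IsCoflasque ∧ ∀ σ ∈ N,
      (∀ χ, R.left.charModule.ρ σ χ = χ) ∧ ∀ χ, R.right.charModule.ρ σ χ = χ := by
  constructor
  · obtain ⟨X, Y, A, B, ψ, k, j, i, j', i', sq, sq', hX, hY, hX', hY'⟩ :=
      GaloisModule.exists_flasque_bicartesianSq hN (T₁.isLattice_charModule h₁)
        (T₂.isLattice_charModule h₂) ((charFunctor F K).map d).unop
    obtain ⟨R, ⟨a⟩, ⟨b⟩⟩ := TorusResolution.exists_of_isLattice hN hX hY ψ
      (TwoTerm.isoOfBicartesian (bicartesianSq_op sq') ≪≫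
        (TwoTerm.isoOfBicartesian (bicartesianSq_op sq)).symm)
    exact ⟨R, ⟨hY'.of_iso a.symm, isQuasitrivial_of_isPermutation (hX'.of_iso b.symm)⟩,
      fun σ hσ => ⟨ρ_apply_eq_of_iso hY a hσ, ρ_apply_eq_of_iso hX b hσ⟩⟩
  · obtain ⟨X, Y, A, B, ψ, k, j, i, j', i', sq, sq', hX, hY, hX', hY'⟩ :=
      GaloisModule.exists_coflasque_bicartesianSq hN (T₁.isLattice_charModule h₁)
        (T₂.isLattice_charModule h₂) ((charFunctor F K).map d).unop
    obtain ⟨R, ⟨a⟩, ⟨b⟩⟩ := TorusResolution.exists_of_isLattice hN hX hY ψ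
      ((TwoTerm.isoOfBicartesian (bicartesianSq_op sq')).symm ≪≫
        TwoTerm.isoOfBicartesian (bicartesianSq_op sq))
    exact ⟨R, ⟨isQuasitrivial_of_isPermutation (hY'.of_iso a.symm), hX'.of_iso b.symm⟩,
      fun σ hσ => ⟨ρ_apply_eq_of_iso hY a hσ, ρ_apply_eq_of_iso hX b hσ⟩⟩

end Torus

end

theorem mainTheorem5 {F K : Type u} [Field F] [Field K] [Algebra F K] [IsSepClosure F K]
    {T₁ T₂ : Torus F K} (d : T₁ ⟶ T₂) :
    -- existence, uniqueness and functoriality of flasque resolutions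
    ((∃ R : TorusResolution d, R.IsFlasque) ∧
      (∀ R R' : TorusResolution d, R.IsFlasque → R'.IsFlasque →
        Nonempty (R.left.coord ⊗[F] R'.right.coord ≃ₐc[F] R'.left.coord ⊗[F] R.right.coord)) ∧
      (∀ {T₁' T₂' : Torus F K} (d' : T₁' ⟶ T₂') (f : Torus.twoTerm d ⟶ Torus.twoTerm d')
        (R : TorusResolution d) (R' : TorusResolution d'),
        R.IsFlasque → R'.IsFlasque → R.Lifts R' f)) ∧
    -- existence, uniqueness and functoriality of coflasque resolutions
    ((∃ R : TorusResolution d, R.IsCoflasque) ∧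
      (∀ R R' : TorusResolution d, R.IsCoflasque → R'.IsCoflasque →
        Nonempty (R.left.coord ⊗[F] R'.right.coord ≃ₐc[F] R'.left.coord ⊗[F] R.right.coord)) ∧
      (∀ {T₁' T₂' : Torus F K} (d' : T₁' ⟶ T₂') (f : Torus.twoTerm d ⟶ Torus.twoTerm d')
        (R : TorusResolution d) (R' : TorusResolution d'),
        R.IsCoflasque → R'.IsCoflasque → R.Lifts R' f)) ∧
    -- splitting fields
    (∀ (E : Type v) [Field E] [Algebra F E] [FiniteDimensional F E] [Algebra.IsSeparable F E],
      T₁.IsSplitBy E → T₂.IsSplitBy E →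
        (∃ R : TorusResolution d, R.IsFlasque ∧ R.IsSplitBy E) ∧
        (∃ R : TorusResolution d, R.IsCoflasque ∧ R.IsSplitBy E)) := by
  have : IsSepClosed K := IsSepClosure.sep_closed F
  -- the Galois group acts on the characters of `T₁` and `T₂` through its quotient by `N`
  let N : Subgroup (K ≃ₐ[F] K) :=
    MonoidHom.ker (Torus.charRep F K T₁.coord) ⊓ MonoidHom.ker (Torus.charRep F K T₂.coord)
  have hN : IsOpen (N : Set (K ≃ₐ[F] K)) :=
    T₁.isOpen_ker_charModule.inter T₂.isOpen_ker_charModule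
  have hNd := Torus.exists_torusResolution d hN
    (fun σ hσ χ => LinearMap.congr_fun (MonoidHom.mem_ker.1 hσ.1) χ)
    (fun σ hσ χ => LinearMap.congr_fun (MonoidHom.mem_ker.1 hσ.2) χ)
  -- `N` contains the Galois groups of the fields which split `T₁` and `T₂`
  have hE (E : Type v) [Field E] [Algebra F E] (h₁ : T₁.IsSplitBy E) (h₂ : T₂.IsSplitBy E)
      (R : TorusResolution d) (hR : ∀ σ ∈ N, (∀ χ, R.left.charModule.ρ σ χ = χ) ∧
        ∀ χ, R.right.charModule.ρ σ χ = χ) : R.IsSplitBy E := by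
    have h (φ : E →ₐ[F] K) (σ : K ≃ₐ[F] K) (hσ : ∀ x, σ (φ x) = φ x) : σ ∈ N :=
      ⟨MonoidHom.mem_ker.2 (LinearMap.ext (h₁ φ σ hσ)),
        MonoidHom.mem_ker.2 (LinearMap.ext (h₂ φ σ hσ))⟩
    exact ⟨fun φ σ hσ => (hR σ (h φ σ hσ)).1, fun φ σ hσ => (hR σ (h φ σ hσ)).2⟩
  obtain ⟨⟨R, hR, hRN⟩, R', hR', hRN'⟩ := hNd
  refine ⟨⟨⟨R, hR⟩, fun S S' hS hS' => ?_, fun d' f S S' hS hS' => ?_⟩,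
    ⟨⟨R', hR'⟩, fun S S' hS hS' => ?_, fun d' f S S' hS hS' => ?_⟩,
    fun E _ _ _ _ h₁ h₂ => ⟨⟨R, hR, hE E h₁ h₂ R hRN⟩, R', hR', hE E h₁ h₂ R' hRN'⟩⟩
  · exact TorusResolution.nonempty_bialgEquiv (hS.noExtension hS') (hS'.noExtension hS)
  · exact TorusResolution.lifts_of_noExtension (hS.noExtension hS') f
  · exact TorusResolution.nonempty_bialgEquiv (hS.noExtension hS') (hS'.noExtension hS)
  · exact TorusResolution.lifts_of_noExtension (hS.noExtension hS') f
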